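/- Let $p,q\ge 1$, let $G=\mathrm{SO}(p,q+1)_e$ be the identity component of the group $\mathrm{SO}(p,q+1)$ of the form $x_1^2+\dots+x_p^2-x_{p+1}^2-\dots-x_{p+q+1}^2$ on $\mathbb R^{p+q+1}$, and let $H=\mathrm{SO}(p,q)_e$ be the stabilizer of $x_0=e_{p+q+1}$ in $G$, so that $G/H$ is identified with the hyperboloid $Gx_0$, where the form equals $-1$. Let $K=\mathrm{SO}(p)\times\mathrm{SO}(q+1)$. Let $a_t\in G$ be the hyperbolic rotation by $t$ in the coordinates $1$ and $p+q+1$, and $k_\theta\in K$ the rotation by $\theta$ in the coordinates $p+1$ and $p+q+1$, so that $$k_\theta a_t x_0=(\sinh t,0,\dots,0;\ \sin\theta\cosh t,0,\dots,0,\cos\theta\cosh t).$$ A $K\cap H$-invariant function on $G/H$ is determined by its values at the points $k_\theta a_t x_0$. For $u\in\mathbb R^{p-1}$ and $v\in\mathbb R^{q}$ (rows) let $$n_{u,v}=\exp\begin{pmatrix}0&u&v&0\\-u^t&0&0&u^t\\v^t&0&0&-v^t\\0&u&v&0\end{pmatrix}\in G,$$ write $u=(u_1,\dots,u_{p-1})$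 and $v=(v_q,\dots,v_1)$, and let $N^*$ be the $\max(p-1,q)$-dimensional abelian group of all $n_{u,v}$ with $u_j=v_j$ for $1\le j\le\min(p-1,q)$, with a Haar measure $dn^*$. For a function $f$ on $G/H$ put $$Rf(g)=\int_{N^*}f(gn^*H)\,dn^*\qquad(g\in G),$$ provided that the integral converges absolutely. Let $\rho=\frac12(p+q-1)$, $\rho_c=\frac12(q-1)$, and $\rho_1=\frac12(p-q-1)$ if $p>q$, $\rho_1=\frac12(q-p+1)$ if $p\le q$. Put $\mu_\lambda=\lambda+\rho-2\rho_c$ for $\lambda>0$ and, if $q=1$, $\mu_\lambda=\lambda-\rho$ for $\lambda<0$. The discrete series of $G/H$ is parametrized, for $q>1$, by the $\lambda>0$ with $\mu_\lambda\in\mathbb Z$ and, for $q=1$, by the real $\lambda\ne0$ with $|\lambda|+\rho\in\mathbb Z$. For a discrete series parameter $\lambda$ let $f$ be the following $K\cap H$-invariant generating function of the corresponding representation: * if $q=1$: $f(k_\theta a_tx_0)=e^{i\mu_\lambda\theta}(\cosh t)^{-|\lambda|-\rho}$; * if $q>1$ and $\mu_\lambda\ge0$: $f(k_\theta a_tx_0)=R_{\mu_\lambda}(\cos\theta)(\cosh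 t)^{-\lambda-\rho}$, where $R_\mu=C_\mu^{(\rho_c)}/C_\mu^{(\rho_c)}(1)$ is the normalized Gegenbauer polynomial of degree $\mu$; * if $q>1$ and $\mu_\lambda=-n<0$: $f(k_\theta a_tx_0)=\phi_{n,m}(\sinh^2t)$ if $n=2m$ is even, and $f(k_\theta a_tx_0)=\cos\theta\cosh t\,\phi_{n,m}(\sinh^2t)$ if $n=2m-1$ is odd, where $\phi_{n,m}(s^2)$ is the value at $x=(s,0,\dots,0)\in\mathbb R^p$ of $\omega^m(1+|x|^2)^{n-\rho_c}$, with $\omega$ the Laplace operator of $\mathbb R^p$. Theorem 5.2. Let $\lambda\neq0$ be a discrete series parameter and $f$ the generating function above. 1. If $\lambda>0$ and $\mu_\lambda>0$, or if $\lambda<0$ and $\mu_\lambda<0$, then the integral defining $Rf(g)$ converges absolutely and $Rf(g)=0$ for every $g\in G$. 2. If $\lambda>0$ and $\mu_\lambda\le0$, then there is a constant $C\neq0$ such that, for every $s\in\mathbb R$, the integral defining $Rf(a_s)$ converges absolutely and $Rf(a_s)=Ce^{(\lambda-\rho_1)s}$. -/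

import Mathlib

namespace Hyperbolic

noncomputable section

open scoped Matrix

/-- Coordinates of `ℝ^{p+q+1}` for `p ≥ 1`, split as `1 + (p-1)` and `q + 1`; the first summand of
the outer sum carries the `p` positive, the second the `q+1` negative squares. -/
abbrev Idx (p q : ℕ) : Type := (Unit ⊕ Fin (p - 1)) ⊕ (Fin q ⊕ Unit)

abbrev Mat (p q : ℕ) : Type := Matrix (Idx p q) (Idx p q) ℝ

/-- The form `x_1² + … + x_p² - x_{p+1}² - … - x_{p+q+1}²`. -/
def form (p q : ℕ) : Mat p q :=
  LieAlgebra.Orthogonal.indefiniteDiagonal (Unit ⊕ Fin (p - 1)) (Fin q ⊕ Unit) ℝ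

/-- `G = SO(p,q+1)_e`, the identity component of `SO(p,q+1)`, as a set of matrices. -/
def groupG (p q : ℕ) : Set (Mat p q) :=
  connectedComponentIn {g | gᵀ * form p q * g = form p q ∧ g.det = 1} 1

/-- The base point `x_0 = e_{p+q+1}`. The space `G/H` is the orbit `G x_0`, the hyperboloid on
which the form takes the value `-1`. -/
def basePoint (p q : ℕ) : Idx p q → ℝ := Pi.single (Sum.inr (Sum.inr ())) 1

/-- The one-parameter group `a_t`. -/
def boost (p q : ℕ) (t : ℝ) : Mat p q :=
  Matrix.fromBlocks
    (Matrix.fromBlocks (Matrix.of fun _ _ => Real.cosh t) 0 0 1)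
    (Matrix.fromBlocks 0 (Matrix.of fun _ _ => Real.sinh t) 0 0)
    (Matrix.fromBlocks 0 0 (Matrix.of fun _ _ => Real.sinh t) 0)
    (Matrix.fromBlocks 1 0 0 (Matrix.of fun _ _ => Real.cosh t))

/-- The one-parameter group `k_θ`, rotating the first and the last of the `q+1` negative
coordinates. -/
def rot (p q : ℕ) (θ : ℝ) : Mat p q :=
  Matrix.fromBlocks 1 0 0
    (Matrix.fromBlocks (Matrix.diagonal fun k => if (k : ℕ) = 0 then Real.cos θ else 1)
      (Matrix.of fun k _ => if (k : ℕ) = 0 then Real.sin θ else 0)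
      (Matrix.of fun _ k => if (k : ℕ) = 0 then -Real.sin θ else 0)
      (Matrix.of fun _ _ => Real.cos θ))

/-- The Lie algebra element `Z_{u,v}`, with `u`, `v` as rows in the `1 + (p-1) + q + 1` block
decomposition. -/
def nilElt (p q : ℕ) (u : Fin (p - 1) → ℝ) (v : Fin q → ℝ) : Mat p q :=
  Matrix.fromBlocks
    (Matrix.fromBlocks 0 (Matrix.replicateRow Unit u) (-Matrix.replicateCol Unit u) 0)
    (Matrix.fromBlocks (Matrix.replicateRow Unit v) 0 0 (Matrix.replicateCol Unit u))
    (Matrix.fromBlocks (Matrix.replicateCol Unit v) 0 0 (Matrix.replicateRow Unit u))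
    (Matrix.fromBlocks 0 (-Matrix.replicateCol Unit v) (Matrix.replicateRow Unit v) 0)

/-- `n_{u,v} = exp Z_{u,v}`. -/
def unip (p q : ℕ) (u : Fin (p - 1) → ℝ) (v : Fin q → ℝ) : Mat p q :=
  NormedSpace.exp (nilElt p q u v)

/-- The entries `u = (u_1, …, u_{p-1})` with `u_j = w_j`. -/
def uPart (p q : ℕ) (w : Fin (max (p - 1) q) → ℝ) : Fin (p - 1) → ℝ :=
  fun i => w (Fin.castLE (le_max_left _ _) i)

/-- The entries `v = (v_q, …, v_1)`, numbered from right to left, with `v_j = w_j`. -/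
def vPart (p q : ℕ) (w : Fin (max (p - 1) q) → ℝ) : Fin q → ℝ :=
  fun k => w (Fin.castLE (le_max_right _ _) k.rev)

/-- The subgroup `N^*` of all `n_{u,v}` with `u_j = v_j` for `1 ≤ j ≤ min (p-1) q`
(the index `j` below is `j - 1`, and `v = (v_q, …, v_1)`). -/
def groupNStar (p q : ℕ) : Set (Mat p q) :=
  {n | ∃ (u : Fin (p - 1) → ℝ) (v : Fin q → ℝ),
    (∀ (j : ℕ) (hu : j < p - 1) (hv : j < q), u ⟨j, hu⟩ = v (Fin.rev ⟨j, hv⟩)) ∧ n = unip p q u v}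

/-- The coordinates `w ∈ ℝ^{max(p-1,q)}` on `N^*`. -/
def nStar (p q : ℕ) (w : Fin (max (p - 1) q) → ℝ) : Mat p q :=
  unip p q (uPart p q w) (vPart p q w)

/-- The coordinates `w` exhaust `N^*`. -/
theorem range_nStar (p q : ℕ) : Set.range (nStar p q) = groupNStar p q := by
  ext n
  constructor
  · rintro ⟨w, rfl⟩
    refine ⟨_, _, fun j hu hv => ?_, rfl⟩
    simp only [uPart, vPart, Fin.rev_rev]
    rfl
  · rintro ⟨u, v, h, rfl⟩
    refine ⟨fun j => if hu : (j : ℕ) < p - 1 then u ⟨j, hu⟩ else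
      if hv : (j : ℕ) < q then v (Fin.rev ⟨j, hv⟩) else 0, ?_⟩
    have h1 : uPart p q (fun j => if hu : (j : ℕ) < p - 1 then u ⟨j, hu⟩ else
      if hv : (j : ℕ) < q then v (Fin.rev ⟨j, hv⟩) else 0) = u := by
      funext i
      simp [uPart]
    have h2 : vPart p q (fun j => if hu : (j : ℕ) < p - 1 then u ⟨j, hu⟩ else
      if hv : (j : ℕ) < q then v (Fin.rev ⟨j, hv⟩) else 0) = v := by
      funext k
      simp only [vPart, Fin.val_castLE]
      split_ifs with ha hb
      · rw [h _ ha k.rev.isLt]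
        exact congrArg v (Fin.rev_rev k)
      · exact congrArg v (Fin.rev_rev k)
      · exact absurd k.rev.isLt hb
    rw [nStar, h1, h2]

/-- The coordinates `w` are additive-to-multiplicative, so Lebesgue measure in `w` is a Haar
measure of `N^*`. -/
theorem nStar_add (p q : ℕ) (w w' : Fin (max (p - 1) q) → ℝ) :
    nStar p q (w + w') = nStar p q w * nStar p q w' := by
  have hadd : nilElt p q (uPart p q (w + w')) (vPart p q (w + w')) =
      nilElt p q (uPart p q w) (vPart p q w) + nilElt p q (uPart p q w') (vPart p q w') := by
    ext (( i | i) | (i | i)) ((j | j) | (j | j)) <;>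
      simp [nilElt, uPart, vPart] <;> ring_nf
  have hcomm : Commute (nilElt p q (uPart p q w) (vPart p q w))
      (nilElt p q (uPart p q w') (vPart p q w')) := by
    have hrc : ∀ (n : ℕ) (a b : Fin n → ℝ), Matrix.replicateRow Unit a * Matrix.replicateCol Unit b
        = Matrix.replicateRow Unit b * Matrix.replicateCol Unit a := by
      intro n a b
      ext i j
      simp [Matrix.mul_apply, mul_comm]
    rw [Commute, SemiconjBy]
    simp [nilElt, Matrix.fromBlocks_multiply, Matrix.fromBlocks_add, hrc _ (uPart p q w),
      hrc _ (vPart p q w)]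
  rw [nStar, unip, hadd, Matrix.exp_add_of_commute _ _ hcomm]
  rfl

/-- The Radon transform `R f(g) = ∫_{N^*} f(g n H) dn` of a function on `G/H`, given as a function
of the point `g x_0`; only its values on the orbit `G x_0` matter. It is meaningful where
`RadonConverges` holds. -/
def radon (p q : ℕ) (f : (Idx p q → ℝ) → ℂ) (g : Mat p q) : ℂ :=
  ∫ w : Fin (max (p - 1) q) → ℝ, f ((g * nStar p q w) *ᵥ basePoint p q)

/-- The integral that defines `R f(g)` converges absolutely. -/
def RadonConverges (p q : ℕ) (f : (Idx p q → ℝ) → ℂ) (g : Mat p q) : Prop :=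
  MeasureTheory.Integrable
    (fun w : Fin (max (p - 1) q) → ℝ => f ((g * nStar p q w) *ᵥ basePoint p q))

def rho (p q : ℕ) : ℝ := ((p : ℝ) + q - 1) / 2

def rhoC (q : ℕ) : ℝ := ((q : ℝ) - 1) / 2

def rhoOne (p q : ℕ) : ℝ := if q < p then ((p : ℝ) - q - 1) / 2 else ((q : ℝ) - p + 1) / 2

/-- `μ_λ = λ + ρ - 2ρ_c` for `λ > 0`, and `μ_λ = λ - ρ` for `λ < 0` (which only occurs for
`q = 1`). -/
def muParam (p q : ℕ) (lam : ℝ) : ℝ :=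
  if 0 < lam then lam + rho p q - 2 * rhoC q else lam - rho p q

/-- The parameters of the discrete series of `G/H`. -/
def IsDiscreteSeriesParameter (p q : ℕ) (lam : ℝ) : Prop :=
  if q = 1 then lam ≠ 0 ∧ ∃ k : ℤ, |lam| + rho p q = k
  else 0 < lam ∧ ∃ k : ℤ, muParam p q lam = k

/-- The Gegenbauer polynomial `C_n^{(ν)}`. -/
def gegenbauer (ν : ℝ) : ℕ → ℝ → ℝ
  | 0, _ => 1
  | 1, x => 2 * ν * x
  | n + 2, x =>
    (2 * (n + 1 + ν) * x * gegenbauer ν (n + 1) x - (n + 2 * ν) * gegenbauer ν n x) / (n + 2)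

/-- The zonal spherical function of degree `n` of `SO(q+1)/SO(q)`, for `q > 1`: the Gegenbauer
polynomial of index `(q-1)/2`, normalized to take the value `1` at `1`. -/
def zonal (q n : ℕ) (x : ℝ) : ℝ := gegenbauer (rhoC q) n x / gegenbauer (rhoC q) n 1

/-- The length of the last `q+1` coordinates; it is `cosh t` at `k_θ a_t x_0`. -/
def coshPart (p q : ℕ) (x : Idx p q → ℝ) : ℝ := Real.sqrt (∑ k, x (Sum.inr k) ^ 2)

/-- The last coordinate; it is `cos θ cosh t` at `k_θ a_t x_0`. -/
def lastCoord (p q : ℕ) (x : Idx p q → ℝ) : ℝ := x (Sum.inr (Sum.inr ()))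

/-- The `m`-th power of the Laplace operator of `ℝ^p`, applied to `(1 + |z|²)^{n-ρ_c}`, at the
point `z` that consists of the first `p` coordinates; `z = (sinh t, 0, …, 0)` at `k_θ a_t x_0`. -/
def phi (p q n m : ℕ) (x : Idx p q → ℝ) : ℝ :=
  (fun h : EuclideanSpace ℝ (Unit ⊕ Fin (p - 1)) → ℝ => Laplacian.laplacian h)^[m]
    (fun z => (1 + ‖z‖ ^ 2) ^ ((n : ℝ) - rhoC q)) (WithLp.toLp 2 fun i => x (Sum.inl i))

/-- The `K ∩ H`-invariant generating function of the discrete series representation with parameter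
`λ`, where `μ = μ_λ`, as a function on the orbit `G x_0`. In polar coordinates `k_θ a_t x_0` it is
* `exp (iμθ) (cosh t)^{-|λ|-ρ}` if `q = 1`,
* `R_μ(cos θ) (cosh t)^{-λ-ρ}` if `q > 1` and `μ ≥ 0`,
* `φ_{n,m}(sinh² t)` if `q > 1` and `-μ = n = 2m > 0`,
* `cos θ cosh t φ_{n,m}(sinh² t)` if `q > 1` and `-μ = n = 2m - 1 > 0`. -/
def generatingFunction (p q : ℕ) (lam : ℝ) (μ : ℤ) (x : Idx p q → ℝ) : ℂ :=
  if hq : q = 1 then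
    (((lastCoord p q x / coshPart p q x : ℝ) : ℂ) +
      Complex.I * ((x (Sum.inr (Sum.inl ⟨0, by omega⟩)) / coshPart p q x : ℝ) : ℂ)) ^ μ *
      ((coshPart p q x ^ (-|lam| - rho p q) : ℝ) : ℂ)
  else if 0 ≤ μ then
    ((zonal q μ.toNat (lastCoord p q x / coshPart p q x) *
      coshPart p q x ^ (-lam - rho p q) : ℝ) : ℂ)
  else if Even μ then
    ((phi p q (-μ).toNat ((-μ).toNat / 2) x : ℝ) : ℂ)
  else
    ((lastCoord p q x * phi p q (-μ).toNat (((-μ).toNat + 1) / 2) x : ℝ) : ℂ)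

/-- `k_θ a_t x_0 = (sinh t, 0, …, 0; sin θ cosh t, 0, …, 0, cos θ cosh t)`. -/
theorem polar_point (p q : ℕ) (θ t : ℝ) :
    (rot p q θ * boost p q t) *ᵥ basePoint p q =
      Sum.elim (Sum.elim (fun _ => Real.sinh t) 0)
        (Sum.elim (fun k : Fin q => if (k : ℕ) = 0 then Real.sin θ * Real.cosh t else 0)
          (fun _ => Real.cos θ * Real.cosh t)) := by
  rw [← Matrix.mulVec_mulVec]
  have h : boost p q t *ᵥ basePoint p q = Sum.elim (Sum.elim (fun _ => Real.sinh t) 0)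
      (Sum.elim 0 (fun _ => Real.cosh t)) := by
    ext ((i | i) | (i | i)) <;> simp [boost, basePoint, Matrix.fromBlocks]
  rw [h]
  ext ((i | i) | (i | i)) <;>
    simp [rot, Matrix.fromBlocks, Matrix.mulVec, dotProduct, Fintype.sum_sum_type, Matrix.one_apply,
      Matrix.diagonal_apply]

theorem coshPart_polar (p q : ℕ) (hq : 1 ≤ q) (θ t : ℝ) :
    coshPart p q ((rot p q θ * boost p q t) *ᵥ basePoint p q) = Real.cosh t := by
  obtain ⟨r, rfl⟩ : ∃ r, q = r + 1 := ⟨q - 1, by omega⟩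
  rw [polar_point, coshPart]
  have h : (∑ k, (Sum.elim (Sum.elim (fun _ : Unit => Real.sinh t) (0 : Fin (p - 1) → ℝ))
      (Sum.elim (fun k : Fin (r + 1) => if (k : ℕ) = 0 then Real.sin θ * Real.cosh t else 0)
        (fun _ : Unit => Real.cos θ * Real.cosh t)) (Sum.inr k)) ^ 2) = Real.cosh t ^ 2 := by
    simp only [Sum.elim_inr, Fintype.sum_sum_type, Fin.sum_univ_succ]
    simp
    linear_combination Real.cosh t ^ 2 * Real.sin_sq_add_cos_sq θ
  rw [h, Real.sqrt_sq (Real.cosh_pos t).le]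

/-- The polar coordinate form of the generating function for `q = 1`. -/
theorem generatingFunction_polar_one (p : ℕ) (lam : ℝ) (μ : ℤ) (θ t : ℝ) :
    generatingFunction p 1 lam μ ((rot p 1 θ * boost p 1 t) *ᵥ basePoint p 1) =
      Complex.exp (Complex.I * μ * θ) * ((Real.cosh t ^ (-|lam| - rho p 1) : ℝ) : ℂ) := by
  have hc := (Real.cosh_pos t).ne'
  rw [generatingFunction, dif_pos rfl, coshPart_polar p 1 le_rfl, polar_point]
  congr 1
  simp only [lastCoord, Sum.elim_inr, Sum.elim_inl, if_true, mul_div_cancel_right₀ _ hc]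
  rw [mul_right_comm, mul_comm _ (μ : ℂ), Complex.exp_int_mul, mul_comm Complex.I (θ : ℂ),
    Complex.exp_mul_I]
  push_cast
  ring_nf

/-- The polar coordinate form of the generating function for `q > 1` and `μ ≥ 0`. -/
theorem generatingFunction_polar_nonneg (p q : ℕ) (hq : 1 < q) (lam : ℝ) (n : ℕ) (θ t : ℝ) :
    generatingFunction p q lam n ((rot p q θ * boost p q t) *ᵥ basePoint p q) =
      ((zonal q n (Real.cos θ) * Real.cosh t ^ (-lam - rho p q) : ℝ) : ℂ) := by
  have hc := (Real.cosh_pos t).ne'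
  rw [generatingFunction, dif_neg hq.ne', if_pos (by positivity), coshPart_polar p q hq.le,
    polar_point]
  simp [lastCoord, mul_div_cancel_right₀ _ hc]

end

end Hyperbolic

/-!
If `μ_λ > 0` or `q = 1`, then `f(x) = F(x₋)`, where `x₋ ∈ ℝ^{q+1}` collects the negative coordinates
and `F` is harmonic off the origin and homogeneous of degree `-(|λ| + ρ)`: a derivative of the
Newtonian potential if `q > 1`, a complex power if `q = 1`. An orbit of `N^*` projects to a
paraboloid in `ℝ^{q+1}`, which moves in a family with parameter `ε`. Harmonicity of `F` becomes a
differential equation in coordinates adapted to this family, and together with Euler's identity and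
integration by parts it gives `(|λ| + 1) b + ε b' = 0` for the integral `b(ε)` of the derivative of
`F` in the direction of motion. Since `b` is bounded near `ε = 0`, it vanishes, so the integral of
`F` does not depend on `ε`; it tends to `0` as `ε → ∞`.

If `μ_λ = -n ≤ 0`, then `p - 1 < q` and `f` is, up to a factor `cos θ cosh t`, an iterated Laplacian
of a power of `1 + |x₊|²`. Integration over the coordinates on which `u` depends is a Beta-type
integral that lowers the dimension `p` to `1`. What remains is a fractional integral of derivatives
of a power of `1 + x²`; the substitution `v = √τ - cosh s / √τ` turns it into an exponential in `s`.
-/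

namespace Hyperbolic

open MeasureTheory Filter Topology Set InnerProductSpace
open scoped Matrix ContDiff Laplacian

section OrbitWeight

/-- The weight `1 + |w|² + (ε + Σ e_j w_j²)²`, comparable with the squared norm of the points of an
orbit of `N^*`. -/
def orbitWeight {ι : Type*} [Fintype ι] (e : ι → ℝ) (ε : ℝ) (w : ι → ℝ) : ℝ :=
  1 + ∑ j, w j ^ 2 + (ε + ∑ j, e j * w j ^ 2) ^ 2

variable {ι : Type*} [Fintype ι] {e : ι → ℝ}

lemma sum_sq_nonneg (w : ι → ℝ) : 0 ≤ ∑ j, w j ^ 2 :=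
  Finset.sum_nonneg fun j _ => sq_nonneg (w j)

lemma sq_le_sum_sq (w : ι → ℝ) (j : ι) : w j ^ 2 ≤ ∑ i, w i ^ 2 :=
  Finset.single_le_sum (fun i _ => sq_nonneg (w i)) (Finset.mem_univ j)

lemma one_add_sum_sq_le_orbitWeight (ε : ℝ) (w : ι → ℝ) :
    1 + ∑ j, w j ^ 2 ≤ orbitWeight e ε w :=
  le_add_of_nonneg_right (sq_nonneg _)

lemma one_le_orbitWeight (ε : ℝ) (w : ι → ℝ) : 1 ≤ orbitWeight e ε w :=
  (le_add_of_nonneg_right (sum_sq_nonneg w)).trans (one_add_sum_sq_le_orbitWeight ε w)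

lemma orbitWeight_pos (ε : ℝ) (w : ι → ℝ) : 0 < orbitWeight e ε w :=
  one_pos.trans_le (one_le_orbitWeight ε w)

lemma one_add_sq_le_orbitWeight (ε : ℝ) (w : ι → ℝ) (j : ι) :
    1 + w j ^ 2 ≤ orbitWeight e ε w :=
  (add_le_add_right (sq_le_sum_sq w j) 1).trans (one_add_sum_sq_le_orbitWeight ε w)

lemma continuous_orbitWeight (ε : ℝ) : Continuous (orbitWeight e ε) := by
  unfold orbitWeight; fun_prop

lemma continuous_orbitWeight_rpow (ε s : ℝ) : Continuous fun w => orbitWeight e ε w ^ s :=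
  (continuous_orbitWeight ε).rpow_const fun w => Or.inl (orbitWeight_pos ε w).ne'

lemma orbitWeight_zero_le {ε M : ℝ} (hε : 0 ≤ ε) (hM : ε ≤ M) (w : ι → ℝ) :
    orbitWeight e 0 w ≤ (2 + 2 * M ^ 2) * orbitWeight e ε w := by
  have hw := sum_sq_nonneg w
  have hεM : ε ^ 2 ≤ M ^ 2 := pow_le_pow_left₀ hε hM 2
  unfold orbitWeight
  set d := ∑ j, e j * w j ^ 2
  nlinarith [sq_nonneg (d + 2 * ε), mul_nonneg (sq_nonneg M) hw, sq_nonneg (M * (ε + d))]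

lemma sq_mul_sq_le_sq_sum (hs : (∀ j, 0 ≤ e j) ∨ ∀ j, e j ≤ 0) (w : ι → ℝ) (j : ι) :
    (e j * w j ^ 2) ^ 2 ≤ (∑ j, e j * w j ^ 2) ^ 2 := by
  rw [sq_le_sq]
  rcases hs with hs | hs
  · have hterm : ∀ i, 0 ≤ e i * w i ^ 2 := fun i => mul_nonneg (hs i) (sq_nonneg _)
    rw [abs_of_nonneg (hterm j), abs_of_nonneg (Finset.sum_nonneg fun i _ => hterm i)]
    exact Finset.single_le_sum (fun i _ => hterm i) (Finset.mem_univ j)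
  · have hterm : ∀ i, e i * w i ^ 2 ≤ 0 := fun i => mul_nonpos_of_nonpos_of_nonneg (hs i)
      (sq_nonneg _)
    rw [abs_of_nonpos (hterm j), abs_of_nonpos (Finset.sum_nonpos fun i _ => hterm i),
      ← Finset.sum_neg_distrib]
    exact Finset.single_le_sum (fun i _ => neg_nonneg.2 (hterm i)) (Finset.mem_univ j)

lemma eq_zero_or_sq_eq_one {x : ℝ} (hx : x ^ 3 = x) : x = 0 ∨ x ^ 2 = 1 := by
  have h : x * (x ^ 2 - 1) = 0 := by linear_combination hx
  exact (mul_eq_zero.1 h).imp_right sub_eq_zero.1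

lemma one_add_sq_rpow_le_orbitWeight (he : ∀ j, e j ^ 3 = e j)
    (hs : (∀ j, 0 ≤ e j) ∨ ∀ j, e j ≤ 0) (w : ι → ℝ) (j : ι) :
    (1 + w j ^ 2) ^ (1 + e j ^ 2) ≤ 2 * orbitWeight e 0 w := by
  rcases eq_zero_or_sq_eq_one (he j) with hj | hj
  · rw [hj, zero_pow two_ne_zero, add_zero, Real.rpow_one]
    linarith [one_add_sq_le_orbitWeight (e := e) 0 w j, one_le_orbitWeight (e := e) 0 w]
  · have hterm := sq_mul_sq_le_sq_sum hs w j
    rw [mul_pow, hj, one_mul] at hterm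
    have hquartic : 1 + (w j ^ 2) ^ 2 ≤ orbitWeight e 0 w := by
      unfold orbitWeight
      linarith [sum_sq_nonneg w]
    rw [hj, one_add_one_eq_two, Real.rpow_two]
    linarith [sq_nonneg (w j ^ 2 - 1)]

lemma rpow_neg_le_of_le {a b c r : ℝ} (ha : 0 < a) (hc : 0 < c) (hr : 0 ≤ r) (h : a ≤ c * b) :
    b ^ (-r) ≤ c ^ r * a ^ (-r) := by
  have hb : 0 < b := pos_of_mul_pos_right (ha.trans_le h) hc.le
  rw [Real.rpow_neg hb.le, Real.rpow_neg ha.le, ← div_eq_mul_inv, inv_le_comm₀ (by positivity)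
    (by positivity), inv_div, div_le_iff₀ (by positivity), ← Real.mul_rpow hb.le hc.le, mul_comm b]
  exact Real.rpow_le_rpow ha.le h hr

lemma integrable_one_add_sq_rpow {s : ℝ} (hs : 1 < s) :
    Integrable fun x : ℝ => (1 + x ^ 2) ^ (-s / 2) := by
  simpa using integrable_rpow_neg_one_add_norm_sq (E := ℝ) (μ := volume) (r := s)
    (by simpa using hs)

/-- The number `N = λ + Σ_j (1 - e_j²/2)`; for `λ > 0` a function that is homogeneous of degree `-N`
has absolutely convergent integrals over the orbits of `N^*`. -/
noncomputable def orbitDegree (e : ι → ℝ) (lam : ℝ) : ℝ := lam + ∑ j, (1 - e j ^ 2 / 2)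

lemma orbitDegree_nonneg (he : ∀ j, e j ^ 3 = e j) {lam : ℝ} (hlam : 0 ≤ lam) :
    0 ≤ orbitDegree e lam := by
  refine add_nonneg hlam (Finset.sum_nonneg fun j _ => ?_)
  rcases eq_zero_or_sq_eq_one (he j) with hj | hj <;> rw [hj] <;> norm_num

theorem integrable_orbitWeight_rpow [Nonempty ι] (he : ∀ j, e j ^ 3 = e j)
    (hs : (∀ j, 0 ≤ e j) ∨ ∀ j, e j ≤ 0) {lam : ℝ} (hlam : 0 < lam) :
    Integrable fun w : ι → ℝ => orbitWeight e 0 w ^ (-(orbitDegree e lam / 2)) := by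
  -- The exponent is split as `Σ r_j`, one share for each coordinate, so that Fubini applies.
  set d : ℝ := (Fintype.card ι : ℝ)
  have hd : 0 < d := Nat.cast_pos.2 Fintype.card_pos
  have hshare : 0 < lam / d := div_pos hlam hd
  let r : ι → ℝ := fun j => (1 - e j ^ 2 / 2 + lam / d) / 2
  have hr : ∀ j, 0 ≤ r j ∧ 1 < (1 + e j ^ 2) * (2 * r j) := fun j => by
    rcases eq_zero_or_sq_eq_one (he j) with hj | hj <;> simp only [r, hj] <;>
      constructor <;> linarith
  have hsum : ∑ j, r j = orbitDegree e lam / 2 := by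
    simp only [r, orbitDegree]
    rw [← Finset.sum_div, Finset.sum_add_distrib, Finset.sum_const, Finset.card_univ, nsmul_eq_mul,
      mul_div_cancel₀ _ hd.ne', add_comm]
  have hfactor : ∀ j, Integrable fun x : ℝ =>
      2 ^ r j * ((1 + x ^ 2) ^ (1 + e j ^ 2)) ^ (-r j) := fun j => by
    refine ((integrable_one_add_sq_rpow (hr j).2).congr
      (Eventually.of_forall fun x => ?_)).const_mul _
    simp only
    rw [← Real.rpow_mul (by positivity)]
    congr 1; ring
  refine (Integrable.fintype_prod (μ := fun _ : ι => (volume : Measure ℝ)) hfactor).mono'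
    (continuous_orbitWeight_rpow 0 _).aestronglyMeasurable (Eventually.of_forall fun w => ?_)
  rw [Real.norm_of_nonneg (Real.rpow_nonneg (orbitWeight_pos 0 w).le _), ← hsum,
    ← Finset.sum_neg_distrib, Real.rpow_sum_of_pos (orbitWeight_pos 0 w)]
  exact Finset.prod_le_prod (fun j _ => Real.rpow_nonneg (orbitWeight_pos 0 w).le _) fun j _ =>
    rpow_neg_le_of_le (by positivity) two_pos (hr j).1 (one_add_sq_rpow_le_orbitWeight he hs w j)

end OrbitWeight

section Homogeneous

variable {E W : Type*} [NormedAddCommGroup E] [NormedSpace ℝ E]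
  [NormedAddCommGroup W] [NormedSpace ℝ W] {F : E → W} {N : ℝ}

/-- `F` is positively homogeneous of degree `-N` away from the origin. -/
def IsHomogeneousNeg (F : E → W) (N : ℝ) : Prop :=
  ∀ r : ℝ, 0 < r → ∀ y : E, y ≠ 0 → F (r • y) = r ^ (-N) • F y

lemma IsHomogeneousNeg.exists_bound [FiniteDimensional ℝ E] (h : IsHomogeneousNeg F N)
    (hc : ContinuousOn F {0}ᶜ) : ∃ C, 0 ≤ C ∧ ∀ y, y ≠ 0 → ‖F y‖ ≤ C * ‖y‖ ^ (-N) := by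
  obtain ⟨C, hC⟩ := (isCompact_sphere (0 : E) 1).exists_bound_of_continuousOn
    (hc.mono fun y hy => ne_zero_of_mem_unit_sphere ⟨y, hy⟩)
  refine ⟨max C 0, le_max_right _ _, fun y hy => ?_⟩
  have hn : 0 < ‖y‖ := norm_pos_iff.2 hy
  have hunit : ‖y‖⁻¹ • y ∈ Metric.sphere (0 : E) 1 := by
    rw [mem_sphere_zero_iff_norm, norm_smul, norm_inv, norm_norm, inv_mul_cancel₀ hn.ne']
  have hscale : F y = ‖y‖ ^ (-N) • F (‖y‖⁻¹ • y) := by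
    rw [← h _ hn _ (ne_zero_of_mem_unit_sphere ⟨_, hunit⟩), smul_inv_smul₀ hn.ne']
  rw [hscale, norm_smul, Real.norm_of_nonneg (by positivity), mul_comm]
  gcongr
  exact (hC _ hunit).trans (le_max_left _ _)

lemma isHomogeneousNeg_fderiv (h : IsHomogeneousNeg F N) :
    IsHomogeneousNeg (fderiv ℝ F) (N + 1) := by
  intro r hr y hy
  have hcongr : (fun x => F (r • x)) =ᶠ[𝓝 y] r ^ (-N) • F := by
    filter_upwards [isOpen_compl_singleton.mem_nhds hy] with x hx using h r hr x hx
  have hderiv := hcongr.fderiv_eq (𝕜 := ℝ)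
  rw [fderiv_comp_smul, fderiv_const_smul_field] at hderiv
  refine smul_right_injective _ hr.ne' ?_
  simp only
  rw [hderiv, Pi.smul_apply, smul_smul, neg_add', Real.rpow_sub_one hr.ne',
    mul_div_cancel₀ _ hr.ne']

lemma IsHomogeneousNeg.euler (h : IsHomogeneousNeg F N) {y : E} (hy : y ≠ 0)
    (hd : DifferentiableAt ℝ F y) :
    fderiv ℝ F y y = -N • F y := by
  have hchain : HasDerivAt (fun r : ℝ => F (r • y)) (fderiv ℝ F y y) 1 := by
    have hray : HasDerivAt (fun r : ℝ => r • y) y 1 := by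
      simpa using (hasDerivAt_id (1 : ℝ)).smul_const y
    exact ((one_smul ℝ y).symm ▸ hd.hasFDerivAt :
      HasFDerivAt F (fderiv ℝ F y) ((1 : ℝ) • y)).comp_hasDerivAt (1 : ℝ) hray
  have hpow : HasDerivAt (fun r : ℝ => r ^ (-N) • F y) (-N • F y) 1 := by
    simpa using (Real.hasDerivAt_rpow_const (x := 1) (p := -N)
      (Or.inl one_ne_zero)).smul_const (F y)
  refine hchain.unique (hpow.congr_of_eventuallyEq ?_)
  filter_upwards [lt_mem_nhds (zero_lt_one' ℝ)] with r hr using h r hr y hy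

end Homogeneous

/-- A family of paraboloids in `E`: the one with parameter `ε` consists of the points
`½ vertex + ½ (ε + Σ e_j w_j²) axis + Σ w_j chord_j`, where `e = coeff`. The coefficients are `-1`,
`0` or `1`, written as `e_j³ = e_j`, and do not have opposite signs. The vector `conj_j` agrees with
`e_j chord_j` if `e_j ≠ 0` and is free otherwise. The last field keeps the paraboloids with `ε ≥ 0`
away from the origin. -/
structure ParaboloidFamily (ι E : Type*) [Fintype ι] [NormedAddCommGroup E] [NormedSpace ℝ E] where
  coeff : ι → ℝ
  axis : E
  vertex : E
  chord : ι → E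
  conj : ι → E
  lowerConst : ℝ
  lowerConst_pos : 0 < lowerConst
  coeff_cube : ∀ j, coeff j ^ 3 = coeff j
  coeff_sign : (∀ j, 0 ≤ coeff j) ∨ ∀ j, coeff j ≤ 0
  coeff_smul_conj : ∀ j, coeff j • conj j = coeff j ^ 2 • chord j
  lowerConst_mul_le : ∀ ε w, 0 ≤ ε → lowerConst * orbitWeight coeff ε w ≤
    ‖(1 / 2 : ℝ) • vertex + ((ε + ∑ j, coeff j * w j ^ 2) / 2) • axis + ∑ j, w j • chord j‖ ^ 2

namespace ParaboloidFamily

variable {ι E W : Type*} [Fintype ι] [NormedAddCommGroup E] [NormedSpace ℝ E]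
  [NormedAddCommGroup W] [NormedSpace ℝ W] (P : ParaboloidFamily ι E)

/-- The point with coordinates `w` on the paraboloid with parameter `ε`. -/
noncomputable def point (ε : ℝ) (w : ι → ℝ) : E :=
  (1 / 2 : ℝ) • P.vertex + ((ε + ∑ j, P.coeff j * w j ^ 2) / 2) • P.axis + ∑ j, w j • P.chord j

/-- The partial derivative of the point with respect to `w_j`. -/
noncomputable def tangent (w : ι → ℝ) (j : ι) : E := P.chord j + (P.coeff j * w j) • P.axis

/-- The functions on `E ∖ {0}` to which the deformation argument applies: homogeneous of the degree
attached to `λ`, and annihilated by the second order operator adapted to the paraboloids. -/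
structure IsWaveFunction (lam : ℝ) (F : E → W) : Prop where
  contDiffAt : ∀ y, y ≠ 0 → ContDiffAt ℝ 2 F y
  homogeneous : IsHomogeneousNeg F (orbitDegree P.coeff lam)
  wave : ∀ y, y ≠ 0 → fderiv ℝ (fderiv ℝ F) y P.axis P.vertex =
    ∑ j, fderiv ℝ (fderiv ℝ F) y (P.chord j) (P.conj j)

section Bounds

lemma point_ne_zero {ε : ℝ} (hε : 0 ≤ ε) (w : ι → ℝ) : P.point ε w ≠ 0 := by
  intro h
  have hlower := P.lowerConst_mul_le ε w hε
  rw [← point, h, norm_zero, zero_pow two_ne_zero] at hlower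
  exact hlower.not_gt (mul_pos P.lowerConst_pos (orbitWeight_pos ε w))

lemma continuous_point (ε : ℝ) : Continuous (P.point ε) := by
  unfold point; fun_prop

lemma hasDerivAt_point_left (w : ι → ℝ) (ε : ℝ) :
    HasDerivAt (fun ε => P.point ε w) ((1 / 2 : ℝ) • P.axis) ε := by
  unfold point
  exact ((((hasDerivAt_id ε).add_const _).div_const 2).smul_const _).const_add _ |>.add_const _

lemma continuous_comp_point {X : Type*} [TopologicalSpace X] {G : E → X}
    (hG : ContinuousOn G {0}ᶜ) {ε : ℝ} (hε : 0 ≤ ε) : Continuous fun w => G (P.point ε w) :=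
  hG.comp_continuous (P.continuous_point ε) fun w => P.point_ne_zero hε w

lemma orbitWeight_rpow_le {ε M N : ℝ} (hN : 0 ≤ N) (hε : 0 ≤ ε) (hM : ε ≤ M) (w : ι → ℝ) :
    orbitWeight P.coeff ε w ^ (-(N / 2)) ≤
      (2 + 2 * M ^ 2) ^ (N / 2) * orbitWeight P.coeff 0 w ^ (-(N / 2)) :=
  rpow_neg_le_of_le (orbitWeight_pos _ _) (by positivity) (by positivity)
    (orbitWeight_zero_le hε hM w)

variable [FiniteDimensional ℝ E] {G : E → W}

lemma exists_bound_orbitWeight {N : ℝ} (hN : 0 ≤ N) (h : IsHomogeneousNeg G N)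
    (hc : ContinuousOn G {0}ᶜ) : ∃ C, 0 ≤ C ∧ ∀ ε w, 0 ≤ ε →
      ‖G (P.point ε w)‖ ≤ C * orbitWeight P.coeff ε w ^ (-(N / 2)) := by
  obtain ⟨C, hC, hbound⟩ := h.exists_bound hc
  have hpos := P.lowerConst_pos
  refine ⟨C * P.lowerConst⁻¹ ^ (N / 2), by positivity, fun ε w hε =>
    (hbound _ (P.point_ne_zero hε w)).trans ?_⟩
  have hsq : ‖P.point ε w‖ ^ (-N) = (‖P.point ε w‖ ^ 2) ^ (-(N / 2)) := by
    rw [← Real.rpow_natCast, ← Real.rpow_mul (norm_nonneg _)]; congr 1; push_cast; ring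
  rw [mul_assoc, hsq]
  gcongr
  refine rpow_neg_le_of_le (orbitWeight_pos ε w) (inv_pos.2 hpos) (by positivity) ?_
  rw [inv_mul_eq_div, le_div_iff₀ hpos, mul_comm]
  exact P.lowerConst_mul_le ε w hε

lemma exists_bound_mul_orbitWeight {N i : ℝ} (hN : 0 ≤ N) (hi : 0 ≤ i)
    (h : IsHomogeneousNeg G (N + i)) (hc : ContinuousOn G {0}ᶜ) (M : ℝ) :
    ∃ C, 0 ≤ C ∧ ∀ ε w, 0 ≤ ε → ε ≤ M → ‖G (P.point ε w)‖ * orbitWeight P.coeff ε w ^ (i / 2) ≤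
      C * orbitWeight P.coeff 0 w ^ (-(N / 2)) := by
  obtain ⟨C, hC, hbound⟩ := P.exists_bound_orbitWeight (add_nonneg hN hi) h hc
  refine ⟨C * (2 + 2 * M ^ 2) ^ (N / 2), by positivity, fun ε w hε hM => ?_⟩
  have hpos := orbitWeight_pos (e := P.coeff) ε w
  calc ‖G (P.point ε w)‖ * orbitWeight P.coeff ε w ^ (i / 2)
      ≤ C * orbitWeight P.coeff ε w ^ (-((N + i) / 2)) * orbitWeight P.coeff ε w ^ (i / 2) := by
        gcongr; exact hbound ε w hε
    _ = C * orbitWeight P.coeff ε w ^ (-(N / 2)) := by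
        rw [mul_assoc, ← Real.rpow_add hpos]; congr 2; ring
    _ ≤ C * (2 + 2 * M ^ 2) ^ (N / 2) * orbitWeight P.coeff 0 w ^ (-(N / 2)) := by
        rw [mul_assoc]; gcongr; exact P.orbitWeight_rpow_le hN hε hM w

lemma exists_bound_orbitWeight_zero {N i : ℝ} (hN : 0 ≤ N) (hi : 0 ≤ i)
    (h : IsHomogeneousNeg G (N + i)) (hc : ContinuousOn G {0}ᶜ) (M : ℝ) :
    ∃ C, ∀ ε w, 0 ≤ ε → ε ≤ M →
      ‖G (P.point ε w)‖ ≤ C * orbitWeight P.coeff 0 w ^ (-(N / 2)) := by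
  obtain ⟨C, -, hbound⟩ := P.exists_bound_mul_orbitWeight hN hi h hc M
  refine ⟨C, fun ε w hε hM => le_trans ?_ (hbound ε w hε hM)⟩
  exact le_mul_of_one_le_right (norm_nonneg _)
    (Real.one_le_rpow (one_le_orbitWeight ε w) (by positivity))

end Bounds

section Integrals

variable {lam : ℝ} [Nonempty ι]

lemma integrable_weight (hlam : 0 < lam) :
    Integrable fun w => orbitWeight P.coeff 0 w ^ (-(orbitDegree P.coeff lam / 2)) :=
  integrable_orbitWeight_rpow P.coeff_cube P.coeff_sign hlam

variable [FiniteDimensional ℝ E] {G : E → W} {i ε : ℝ}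

lemma integrable_comp_point (hlam : 0 < lam) (hi : 0 ≤ i)
    (h : IsHomogeneousNeg G (orbitDegree P.coeff lam + i)) (hc : ContinuousOn G {0}ᶜ)
    (hε : 0 ≤ ε) : Integrable fun w => G (P.point ε w) := by
  obtain ⟨C, hC⟩ := P.exists_bound_orbitWeight_zero (orbitDegree_nonneg P.coeff_cube hlam.le) hi h
    hc ε
  exact ((P.integrable_weight hlam).const_mul C).mono'
    (P.continuous_comp_point hc hε).aestronglyMeasurable
    (Eventually.of_forall fun w => hC ε w hε le_rfl)

lemma hasDerivAt_integral_point (hlam : 0 < lam) (hi : 0 ≤ i)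
    (h : IsHomogeneousNeg G (orbitDegree P.coeff lam + i))
    (hd : ∀ y, y ≠ 0 → ContDiffAt ℝ 1 G y) (hε : 0 < ε) :
    HasDerivAt (fun ε => ∫ w, G (P.point ε w))
      (∫ w, fderiv ℝ G (P.point ε w) ((1 / 2 : ℝ) • P.axis)) ε := by
  have hc : ContinuousOn G {0}ᶜ := fun y hy => (hd y hy).continuousAt.continuousWithinAt
  have hc' : ContinuousOn (fderiv ℝ G) {0}ᶜ := fun y hy =>
    ((hd y hy).fderiv_right (m := 0) (by norm_num)).continuousAt.continuousWithinAt
  have h' : IsHomogeneousNeg (fderiv ℝ G) (orbitDegree P.coeff lam + (i + 1)) := by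
    rw [← add_assoc]; exact isHomogeneousNeg_fderiv h
  obtain ⟨C, hC⟩ := P.exists_bound_orbitWeight_zero (orbitDegree_nonneg P.coeff_cube hlam.le)
    (by positivity) h' hc' (2 * ε)
  refine (hasDerivAt_integral_of_dominated_loc_of_deriv_le (s := Ioo 0 (2 * ε))
    (F' := fun ε w => fderiv ℝ G (P.point ε w) ((1 / 2 : ℝ) • P.axis))
    (Ioo_mem_nhds hε (by linarith)) ?_ (P.integrable_comp_point hlam hi h hc hε.le)
    ((P.continuous_comp_point hc' hε.le).clm_apply continuous_const).aestronglyMeasurable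
    (Eventually.of_forall fun w x hx => ?_)
    (((P.integrable_weight hlam).const_mul C).mul_const ‖(1 / 2 : ℝ) • P.axis‖)
    (Eventually.of_forall fun w x hx => ?_)).2
  · filter_upwards [lt_mem_nhds hε] with x hx
    exact (P.continuous_comp_point hc hx.le).aestronglyMeasurable
  · refine (ContinuousLinearMap.le_opNorm _ _).trans ?_
    gcongr
    exact hC x w hx.1.le hx.2.le
  · exact ((hd _ (P.point_ne_zero hx.1.le w)).differentiableAt
      one_ne_zero).hasFDerivAt.comp_hasDerivAt x (P.hasDerivAt_point_left w x)

end Integrals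

end ParaboloidFamily

/-! ### Independence of the deformation parameter -/

lemma eq_zero_of_hasDerivAt_of_bounded {W : Type*} [NormedAddCommGroup W] [NormedSpace ℝ W]
    {b b' : ℝ → W} {s K : ℝ} (hs : 0 < s) (hderiv : ∀ x, 0 < x → HasDerivAt b (b' x) x)
    (hode : ∀ x, 0 < x → s • b x + x • b' x = 0) (hbound : ∀ x, 0 < x → x ≤ 1 → ‖b x‖ ≤ K)
    {x : ℝ} (hx : 0 < x) : b x = 0 := by
  have hderiv_zero : ∀ y : ℝ, 0 < y → HasDerivAt (fun y : ℝ => y ^ s • b y) 0 y := fun y hy => by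
    refine ((Real.hasDerivAt_rpow_const (p := s) (Or.inl hy.ne')).smul (hderiv y hy)).congr_deriv ?_
    have hpow : y ^ s = y ^ (s - 1) * y := by rw [← Real.rpow_add_one hy.ne', sub_add_cancel]
    rw [hpow]
    linear_combination (norm := module) (y ^ (s - 1)) • hode y hy
  have hconst : ∀ y : ℝ, 0 < y → y ^ s • b y = x ^ s • b x := fun y hy =>
    isOpen_Ioi.is_const_of_deriv_eq_zero isPreconnected_Ioi
      (fun z hz => (hderiv_zero z hz).differentiableAt.differentiableWithinAt)
      (fun z hz => (hderiv_zero z hz).deriv) hy hx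
  have hlim : Tendsto (fun y : ℝ => y ^ s * K) (𝓝[>] 0) (𝓝 0) := by
    have hpow : Tendsto (fun y : ℝ => y ^ s) (𝓝 0) (𝓝 (0 ^ s)) :=
      (Real.continuousAt_rpow_const 0 s (Or.inr hs.le)).tendsto
    rw [Real.zero_rpow hs.ne'] at hpow
    simpa using (hpow.mono_left nhdsWithin_le_nhds).mul_const K
  have hle : ‖x ^ s • b x‖ ≤ 0 := by
    refine ge_of_tendsto hlim ?_
    filter_upwards [Ioc_mem_nhdsGT (zero_lt_one' ℝ)] with y hy
    have hy0 := Real.rpow_nonneg hy.1.le s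
    rw [← hconst y hy.1, norm_smul, Real.norm_of_nonneg hy0]
    gcongr
    exact hbound y hy.1 hy.2
  exact (smul_eq_zero.1 (norm_le_zero_iff.1 hle)).resolve_left (Real.rpow_pos_of_pos hx _).ne'

namespace ParaboloidFamily

variable {ι E W : Type*} [Fintype ι] [NormedAddCommGroup E] [NormedSpace ℝ E]
  [NormedAddCommGroup W] [NormedSpace ℝ W] (P : ParaboloidFamily ι E)

lemma bilinear_point_axis (B : E →L[ℝ] E →L[ℝ] W) (hsymm : ∀ a b, B a b = B b a)
    (hwave : B P.axis P.vertex = ∑ j, B (P.chord j) (P.conj j)) (ε : ℝ) (w : ι → ℝ) :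
    B (P.point ε w) P.axis = (ε / 2) • B P.axis P.axis +
      ∑ j, ((1 / 2 : ℝ) • B (P.tangent w j) (P.conj j) +
        (1 - P.coeff j ^ 2 / 2) • w j • B (P.tangent w j) P.axis) := by
  have hterm : ∀ j, (1 / 2 : ℝ) • B (P.tangent w j) (P.conj j) +
      (1 - P.coeff j ^ 2 / 2) • w j • B (P.tangent w j) P.axis =
      (1 / 2 : ℝ) • B (P.chord j) (P.conj j) + w j • B (P.chord j) P.axis +
        (P.coeff j * w j ^ 2) • (1 / 2 : ℝ) • B P.axis P.axis := fun j => by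
    have hconj : P.coeff j • B P.axis (P.conj j) = P.coeff j ^ 2 • B (P.chord j) P.axis := by
      rw [hsymm (P.chord j), ← map_smul, P.coeff_smul_conj, map_smul]
    have hcube : P.coeff j ^ 3 • B P.axis P.axis = P.coeff j • B P.axis P.axis := by
      rw [P.coeff_cube]
    simp only [tangent, map_add, map_smul, _root_.add_apply, _root_.smul_apply]
    linear_combination (norm := module) (w j / 2) • hconj - (w j ^ 2 / 2) • hcube
  rw [Finset.sum_congr rfl fun j _ => hterm j, Finset.sum_add_distrib, Finset.sum_add_distrib,
    ← Finset.smul_sum, ← Finset.sum_smul, ← hwave, hsymm P.axis P.vertex, point]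
  simp only [map_add, map_smul, map_sum, _root_.add_apply, _root_.smul_apply, _root_.sum_apply]
  module

section Tangent

lemma hasDerivAt_point_line [DecidableEq ι] (ε : ℝ) (w : ι → ℝ) (j : ι) :
    HasDerivAt (fun t : ℝ => P.point ε (w + t • Pi.single j 1)) (P.tangent w j) 0 := by
  have hcoord : ∀ i, HasDerivAt (fun t : ℝ => (w + t • (Pi.single j 1 : ι → ℝ)) i)
      ((Pi.single j 1 : ι → ℝ) i) 0 := fun i => by
    simpa using ((hasDerivAt_id (0 : ℝ)).mul_const ((Pi.single j 1 : ι → ℝ) i)).const_add (w i)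
  have hquad := HasDerivAt.fun_sum fun i (_ : i ∈ Finset.univ) =>
    ((hcoord i).pow 2).const_mul (P.coeff i)
  have hlin := HasDerivAt.fun_sum fun i (_ : i ∈ Finset.univ) =>
    (hcoord i).smul_const (P.chord i)
  refine ((((hquad.const_add ε).div_const 2).smul_const P.axis).const_add
    ((1 / 2 : ℝ) • P.vertex) |>.add hlin).congr_deriv ?_
  simp [Pi.single_apply, tangent, add_comm]
  ring_nf

lemma abs_coord_le_sqrt (ε : ℝ) (w : ι → ℝ) (j : ι) :
    |w j| ≤ √(orbitWeight P.coeff ε w) :=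
  Real.abs_le_sqrt ((le_add_of_nonneg_left zero_le_one).trans (one_add_sq_le_orbitWeight ε w j))

lemma norm_tangent_le (ε : ℝ) (w : ι → ℝ) (j : ι) :
    ‖P.tangent w j‖ ≤ (‖P.chord j‖ + |P.coeff j| * ‖P.axis‖) * √(orbitWeight P.coeff ε w) := by
  have hone : 1 ≤ √(orbitWeight P.coeff ε w) := Real.one_le_sqrt.2 (one_le_orbitWeight ε w)
  calc ‖P.tangent w j‖ ≤ ‖P.chord j‖ * 1 + |P.coeff j| * |w j| * ‖P.axis‖ := by
        rw [mul_one, ← abs_mul, ← Real.norm_eq_abs, ← norm_smul]; exact norm_add_le _ _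
    _ ≤ ‖P.chord j‖ * √(orbitWeight P.coeff ε w) +
        |P.coeff j| * √(orbitWeight P.coeff ε w) * ‖P.axis‖ := by
      gcongr; exact P.abs_coord_le_sqrt ε w j
    _ = (‖P.chord j‖ + |P.coeff j| * ‖P.axis‖) * √(orbitWeight P.coeff ε w) := by ring

end Tangent

namespace IsWaveFunction

variable {P} {lam : ℝ} {F : E → W} (hF : P.IsWaveFunction lam F)
include hF

lemma continuousOn : ContinuousOn F {0}ᶜ :=
  fun y hy => (hF.contDiffAt y hy).continuousAt.continuousWithinAt

lemma contDiffAt_fderiv {y : E} (hy : y ≠ 0) : ContDiffAt ℝ 1 (fderiv ℝ F) y :=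
  (hF.contDiffAt y hy).fderiv_right (by norm_num)

lemma continuousOn_fderiv : ContinuousOn (fderiv ℝ F) {0}ᶜ :=
  fun _ hy => (hF.contDiffAt_fderiv hy).continuousAt.continuousWithinAt

lemma continuousOn_fderiv_fderiv : ContinuousOn (fderiv ℝ (fderiv ℝ F)) {0}ᶜ :=
  fun _ hy => ((hF.contDiffAt_fderiv hy).fderiv_right (m := 0)
    (by norm_num)).continuousAt.continuousWithinAt

lemma homogeneous_fderiv : IsHomogeneousNeg (fderiv ℝ F) (orbitDegree P.coeff lam + 1) :=
  isHomogeneousNeg_fderiv hF.homogeneous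

lemma homogeneous_fderiv_fderiv :
    IsHomogeneousNeg (fderiv ℝ (fderiv ℝ F)) (orbitDegree P.coeff lam + 2) := by
  rw [← one_add_one_eq_two, ← add_assoc]
  exact isHomogeneousNeg_fderiv hF.homogeneous_fderiv

lemma fderiv_axis_eq {ε : ℝ} (hε : 0 ≤ ε) (w : ι → ℝ) :
    -(orbitDegree P.coeff lam + 1) • fderiv ℝ F (P.point ε w) P.axis =
      (ε / 2) • fderiv ℝ (fderiv ℝ F) (P.point ε w) P.axis P.axis +
      ∑ j, ((1 / 2 : ℝ) • fderiv ℝ (fderiv ℝ F) (P.point ε w) (P.tangent w j) (P.conj j) +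
        (1 - P.coeff j ^ 2 / 2) •
          w j • fderiv ℝ (fderiv ℝ F) (P.point ε w) (P.tangent w j) P.axis) := by
  have hy := P.point_ne_zero hε w
  rw [← P.bilinear_point_axis _ ((hF.contDiffAt _ hy).isSymmSndFDerivAt (by simp)) (hF.wave _ hy),
    hF.homogeneous_fderiv.euler hy ((hF.contDiffAt_fderiv hy).differentiableAt one_ne_zero),
    _root_.smul_apply]

lemma hasLineDerivAt_fderiv [DecidableEq ι] {ε : ℝ} (hε : 0 ≤ ε) (a : E) (w : ι → ℝ) (j : ι) :
    HasLineDerivAt ℝ (fun w => fderiv ℝ F (P.point ε w) a)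
      (fderiv ℝ (fderiv ℝ F) (P.point ε w) (P.tangent w j) a) w (Pi.single j 1) := by
  have hF' : HasFDerivAt (fderiv ℝ F) (fderiv ℝ (fderiv ℝ F) (P.point ε w))
      (P.point ε (w + (0 : ℝ) • Pi.single j 1)) := by
    rw [zero_smul, add_zero]
    exact ((hF.contDiffAt_fderiv (P.point_ne_zero hε w)).differentiableAt one_ne_zero).hasFDerivAt
  have hpath := hF'.comp_hasDerivAt (0 : ℝ) (P.hasDerivAt_point_line ε w j)
  exact hpath.clm_apply (hasDerivAt_const _ a) |>.congr_deriv (by simp)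

variable [FiniteDimensional ℝ E] [Nonempty ι] (hlam : 0 < lam) {ε : ℝ}
include hlam

lemma integrable_fderiv (hε : 0 ≤ ε) : Integrable fun w => fderiv ℝ F (P.point ε w) :=
  P.integrable_comp_point hlam zero_le_one hF.homogeneous_fderiv hF.continuousOn_fderiv hε

lemma integrable_fderiv_fderiv (hε : 0 ≤ ε) (a : E) :
    Integrable fun w => fderiv ℝ (fderiv ℝ F) (P.point ε w) a :=
  (P.integrable_comp_point hlam zero_le_two hF.homogeneous_fderiv_fderiv
    hF.continuousOn_fderiv_fderiv hε).apply_continuousLinearMap a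

lemma integrable_smul_fderiv (hε : 0 ≤ ε) {φ : (ι → ℝ) → ℝ} (hφ : Continuous φ)
    (hle : ∀ w, |φ w| ≤ √(orbitWeight P.coeff ε w)) (a : E) :
    Integrable fun w => φ w • fderiv ℝ F (P.point ε w) a := by
  obtain ⟨C, -, hC⟩ := P.exists_bound_mul_orbitWeight (orbitDegree_nonneg P.coeff_cube hlam.le)
    zero_le_one hF.homogeneous_fderiv hF.continuousOn_fderiv ε
  refine (((P.integrable_weight hlam).const_mul C).mul_const ‖a‖).mono'
    (hφ.smul ((P.continuous_comp_point hF.continuousOn_fderiv hε).clm_apply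
      continuous_const)).aestronglyMeasurable (Eventually.of_forall fun w => ?_)
  have hbound := hC ε w hε le_rfl
  rw [← Real.sqrt_eq_rpow] at hbound
  rw [norm_smul, Real.norm_eq_abs]
  calc |φ w| * ‖fderiv ℝ F (P.point ε w) a‖
      ≤ √(orbitWeight P.coeff ε w) * (‖fderiv ℝ F (P.point ε w)‖ * ‖a‖) := by
        gcongr
        exacts [hle w, ContinuousLinearMap.le_opNorm _ _]
    _ = ‖fderiv ℝ F (P.point ε w)‖ * √(orbitWeight P.coeff ε w) * ‖a‖ := by ring
    _ ≤ C * orbitWeight P.coeff 0 w ^ (-(orbitDegree P.coeff lam / 2)) * ‖a‖ := by gcongr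

lemma integrable_smul_fderiv_tangent (hε : 0 ≤ ε) {φ : (ι → ℝ) → ℝ} (hφ : Continuous φ)
    (hle : ∀ w, |φ w| ≤ √(orbitWeight P.coeff ε w)) (a : E) (j : ι) :
    Integrable fun w => φ w • fderiv ℝ (fderiv ℝ F) (P.point ε w) (P.tangent w j) a := by
  obtain ⟨C, -, hC⟩ := P.exists_bound_mul_orbitWeight (orbitDegree_nonneg P.coeff_cube hlam.le)
    zero_le_two hF.homogeneous_fderiv_fderiv hF.continuousOn_fderiv_fderiv ε
  set K := ‖P.chord j‖ + |P.coeff j| * ‖P.axis‖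
  have hcont : Continuous fun w => P.tangent w j := by unfold tangent; fun_prop
  refine (((P.integrable_weight hlam).const_mul C).mul_const (K * ‖a‖)).mono'
    (hφ.smul (((P.continuous_comp_point hF.continuousOn_fderiv_fderiv hε).clm_apply
      hcont).clm_apply continuous_const)).aestronglyMeasurable (Eventually.of_forall fun w => ?_)
  have hbound := hC ε w hε le_rfl
  rw [div_self two_ne_zero, Real.rpow_one] at hbound
  set D := ‖fderiv ℝ (fderiv ℝ F) (P.point ε w)‖
  have hsqrt := Real.mul_self_sqrt (orbitWeight_pos (e := P.coeff) ε w).le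
  set S := √(orbitWeight P.coeff ε w)
  rw [norm_smul, Real.norm_eq_abs]
  calc |φ w| * ‖fderiv ℝ (fderiv ℝ F) (P.point ε w) (P.tangent w j) a‖
      ≤ S * (D * (K * S) * ‖a‖) := by
        gcongr
        · exact hle w
        · refine (ContinuousLinearMap.le_opNorm₂ _ _ _).trans ?_
          gcongr
          exact P.norm_tangent_le ε w j
    _ = D * orbitWeight P.coeff ε w * (K * ‖a‖) := by rw [← hsqrt]; ring
    _ ≤ C * orbitWeight P.coeff 0 w ^ (-(orbitDegree P.coeff lam / 2)) * (K * ‖a‖) := by gcongr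

lemma integral_smul_fderiv_tangent [DecidableEq ι] (hε : 0 ≤ ε) {φ : (ι → ℝ) → ℝ}
    (hφ : Continuous φ) (hle : ∀ w, |φ w| ≤ √(orbitWeight P.coeff ε w)) {c : ℝ} {j : ι}
    (hderiv : ∀ w, HasLineDerivAt ℝ φ c w (Pi.single j 1)) (a : E) :
    ∫ w, φ w • fderiv ℝ (fderiv ℝ F) (P.point ε w) (P.tangent w j) a =
      -(c • ∫ w, fderiv ℝ F (P.point ε w) a) := by
  rw [← integral_smul]
  exact integral_bilinear_hasLineDerivAt_right_eq_neg_left_of_integrable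
    (μ := (volume : Measure (ι → ℝ))) (B := ContinuousLinearMap.lsmul ℝ ℝ) (f' := fun _ => c)
    (((hF.integrable_fderiv hlam hε).apply_continuousLinearMap a).smul c)
    (hF.integrable_smul_fderiv_tangent hlam hε hφ hle a j)
    (hF.integrable_smul_fderiv hlam hε hφ hle a)
    (fun w _ => hderiv w) (fun w _ => hF.hasLineDerivAt_fderiv hε a w j)

lemma integral_tangent_terms (hε : 0 ≤ ε) (j : ι) :
    Integrable (fun w => (1 / 2 : ℝ) •
        fderiv ℝ (fderiv ℝ F) (P.point ε w) (P.tangent w j) (P.conj j) +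
      (1 - P.coeff j ^ 2 / 2) •
        w j • fderiv ℝ (fderiv ℝ F) (P.point ε w) (P.tangent w j) P.axis) ∧
    ∫ w, ((1 / 2 : ℝ) • fderiv ℝ (fderiv ℝ F) (P.point ε w) (P.tangent w j) (P.conj j) +
      (1 - P.coeff j ^ 2 / 2) •
        w j • fderiv ℝ (fderiv ℝ F) (P.point ε w) (P.tangent w j) P.axis) =
      -(1 - P.coeff j ^ 2 / 2) • ∫ w, fderiv ℝ F (P.point ε w) P.axis := by
  classical
  have hone : ∀ w, |(1 : ℝ)| ≤ √(orbitWeight P.coeff ε w) := fun w =>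
    abs_one.trans_le (Real.one_le_sqrt.2 (one_le_orbitWeight ε w))
  have hcoord := fun w => P.abs_coord_le_sqrt ε w j
  have hint_conj := hF.integrable_smul_fderiv_tangent hlam hε continuous_const hone (P.conj j) j
  have hint_axis :=
    hF.integrable_smul_fderiv_tangent hlam hε (continuous_apply j) hcoord P.axis j
  have hconj := hF.integral_smul_fderiv_tangent hlam hε continuous_const hone (c := 0)
    (j := j) (fun _ => hasDerivAt_const _ _) (P.conj j)
  have haxis := hF.integral_smul_fderiv_tangent hlam hε (continuous_apply j) hcoord (c := 1)
    (j := j)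
    (fun w => by simpa [HasLineDerivAt] using (hasDerivAt_id (0 : ℝ)).const_add (w j)) P.axis
  simp only [one_smul, zero_smul, neg_zero] at hint_conj hconj haxis
  refine ⟨(hint_conj.smul _).add (hint_axis.smul _), ?_⟩
  rw [integral_add (by exact hint_conj.smul _) (by exact hint_axis.smul _), integral_smul,
    integral_smul, hconj, haxis, smul_zero, zero_add, smul_neg, neg_smul]

lemma integral_fderiv_axis_ode (hε : 0 ≤ ε) :
    (lam + 1) • (∫ w, fderiv ℝ F (P.point ε w) P.axis) +
      ε • (1 / 2 : ℝ) • ∫ w, fderiv ℝ (fderiv ℝ F) (P.point ε w) P.axis P.axis = 0 := by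
  have hint := (hF.integrable_fderiv_fderiv hlam hε P.axis).apply_continuousLinearMap P.axis
  have hterms := hF.integral_tangent_terms hlam hε
  have hidentity := congrArg (fun f : (ι → ℝ) → W => ∫ w, f w)
    (funext fun w => hF.fderiv_axis_eq hε w)
  rw [integral_add (by exact hint.smul _) (integrable_finsetSum _ fun j _ => (hterms j).1),
    integral_finsetSum _ fun j _ => (hterms j).1, integral_smul, integral_smul,
    Finset.sum_congr rfl fun j _ => (hterms j).2, ← Finset.sum_smul, Finset.sum_neg_distrib,
    orbitDegree] at hidentity
  linear_combination (norm := module) -hidentity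

lemma hasDerivAt_integral_fderiv_axis (hε : 0 < ε) :
    HasDerivAt (fun ε => ∫ w, fderiv ℝ F (P.point ε w) P.axis)
      ((1 / 2 : ℝ) • ∫ w, fderiv ℝ (fderiv ℝ F) (P.point ε w) P.axis P.axis) ε := by
  have hderiv := (P.hasDerivAt_integral_point hlam zero_le_one hF.homogeneous_fderiv
    (fun y hy => hF.contDiffAt_fderiv hy) hε).clm_apply (hasDerivAt_const ε P.axis)
  simp only [map_zero, add_zero, map_smul, integral_smul, _root_.smul_apply,
    ContinuousLinearMap.integral_apply (hF.integrable_fderiv_fderiv hlam hε.le P.axis)] at hderiv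
  refine hderiv.congr_of_eventuallyEq ?_
  filter_upwards [lt_mem_nhds hε] with x hx
  exact (ContinuousLinearMap.integral_apply (hF.integrable_fderiv hlam hx.le) P.axis).symm

lemma integral_fderiv_axis_eq_zero (hε : 0 < ε) : ∫ w, fderiv ℝ F (P.point ε w) P.axis = 0 := by
  obtain ⟨C, hC⟩ := P.exists_bound_orbitWeight_zero (orbitDegree_nonneg P.coeff_cube hlam.le)
    zero_le_one hF.homogeneous_fderiv hF.continuousOn_fderiv 1
  refine eq_zero_of_hasDerivAt_of_bounded (s := lam + 1) (by positivity)
   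
    (fun x hx => hF.hasDerivAt_integral_fderiv_axis hlam hx)
    (fun x hx => hF.integral_fderiv_axis_ode hlam hx.le) (fun x hx hx1 =>
      norm_integral_le_of_norm_le (((P.integrable_weight hlam).const_mul C).mul_const ‖P.axis‖)
        (Eventually.of_forall fun w => (ContinuousLinearMap.le_opNorm _ _).trans ?_)) hε
  gcongr
  exact hC x w hx.le hx1

lemma integrable (hε : 0 ≤ ε) : Integrable fun w => F (P.point ε w) :=
  P.integrable_comp_point hlam le_rfl (by simpa using hF.homogeneous) hF.continuousOn hε

theorem integral_eq {ε ε' : ℝ} (hε : 0 < ε) (hε' : 0 < ε') :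
    ∫ w, F (P.point ε w) = ∫ w, F (P.point ε' w) := by
  have hderiv : ∀ x : ℝ, 0 < x → HasDerivAt (fun x => ∫ w, F (P.point x w)) 0 x := fun x hx => by
    refine (P.hasDerivAt_integral_point hlam le_rfl (by simpa using hF.homogeneous)
      (fun y hy => (hF.contDiffAt y hy).of_le one_le_two) hx).congr_deriv ?_
    simp only [map_smul, integral_smul, hF.integral_fderiv_axis_eq_zero hlam hx, smul_zero]
  exact isOpen_Ioi.is_const_of_deriv_eq_zero isPreconnected_Ioi
    (fun y hy => (hderiv y hy).differentiableAt.differentiableWithinAt)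
    (fun y hy => (hderiv y hy).deriv) hε hε'

end IsWaveFunction

end ParaboloidFamily

/-! ### Large deformation parameters -/

section Split

variable {ι : Type*} [Fintype ι] (p : ι → Prop) [DecidablePred p]

/-- The splitting of the coordinates into those with `p` and those without, as vectors of two
Euclidean spaces. -/
noncomputable def splitEquiv :
    (ι → ℝ) ≃ᵐ EuclideanSpace ℝ {i // p i} × EuclideanSpace ℝ {i // ¬p i} :=
  (MeasurableEquiv.piEquivPiSubtypeProd (fun _ => ℝ) p).trans
    (MeasurableEquiv.prodCongr (MeasurableEquiv.toLp 2 _) (MeasurableEquiv.toLp 2 _))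

lemma measurePreserving_splitEquiv : MeasurePreserving (splitEquiv p) := by
  refine MeasurePreserving.trans (volume_preserving_piEquivPiSubtypeProd (fun _ : ι => ℝ) p) ?_
  exact (EuclideanSpace.volume_preserving_symm_measurableEquiv_toLp _).symm.prod
    (EuclideanSpace.volume_preserving_symm_measurableEquiv_toLp _).symm

lemma norm_splitEquiv_fst (w : ι → ℝ) : ‖(splitEquiv p w).1‖ ^ 2 = ∑ i : {i // p i}, w i ^ 2 := by
  rw [EuclideanSpace.norm_sq_eq]
  simp [splitEquiv, MeasurableEquiv.prodCongr, MeasurableEquiv.piEquivPiSubtypeProd]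

lemma norm_splitEquiv_snd (w : ι → ℝ) : ‖(splitEquiv p w).2‖ ^ 2 = ∑ i : {i // ¬p i}, w i ^ 2 := by
  rw [EuclideanSpace.norm_sq_eq]
  simp [splitEquiv, MeasurableEquiv.prodCongr, MeasurableEquiv.piEquivPiSubtypeProd]

end Split

/-- The contribution to the orbit weight, at the parameter `ε = T²`, of the coordinates with
coefficient `-1`, as a function of their Euclidean norm. -/
noncomputable def radialWeight (T r : ℝ) : ℝ := 1 + r ^ 2 + (T ^ 2 - r ^ 2) ^ 2

lemma radialWeight_pos (T r : ℝ) : 0 < radialWeight T r := by unfold radialWeight; positivity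

lemma continuous_radialWeight_rpow (T s : ℝ) : Continuous fun r => radialWeight T r ^ s := by
  refine Continuous.rpow_const ?_ fun r => Or.inl (radialWeight_pos T r).ne'
  unfold radialWeight; fun_prop

lemma sub_sq_mul_le_radialWeight {r T c : ℝ} (hc : |c| ≤ r + T) :
    (r - T) ^ 2 * c ^ 2 ≤ (T ^ 2 - r ^ 2) ^ 2 := by
  have hfactor : (T ^ 2 - r ^ 2) ^ 2 = (r - T) ^ 2 * (r + T) ^ 2 := by ring
  rw [hfactor]
  exact mul_le_mul_of_nonneg_left (sq_le_sq.2 (hc.trans (le_abs_self _))) (sq_nonneg _)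

lemma mul_le_radialWeight {r T : ℝ} (hr : 0 ≤ r) (hT : 0 ≤ T) :
    (1 + r ^ 2) * (1 + (r - T) ^ 2) ≤ 3 * radialWeight T r := by
  have hr_sq := sub_sq_mul_le_radialWeight (r := r) (T := T) (c := r)
    (by rw [abs_of_nonneg hr]; linarith)
  have hsub_sq := sub_sq_mul_le_radialWeight (r := r) (T := T) (c := r - T)
    (abs_le.2 ⟨by linarith, by linarith⟩)
  unfold radialWeight
  nlinarith [sq_nonneg ((r - T) ^ 2 - 1), sq_nonneg r]

lemma sq_le_radialWeight {r T : ℝ} (hr : 0 ≤ r) (hT : 0 ≤ T) :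
    (1 + (r - T) ^ 2) ^ 2 ≤ 2 * radialWeight T r := by
  have hsub_sq := sub_sq_mul_le_radialWeight (r := r) (T := T) (c := r - T)
    (abs_le.2 ⟨by linarith, by linarith⟩)
  unfold radialWeight
  nlinarith [sq_nonneg ((r - T) ^ 2 - 1), sq_nonneg r]

lemma radialWeight_rpow_le {x y r T : ℝ} (hx : 0 ≤ x) (hy : 0 ≤ y) (hr : 0 ≤ r) (hT : 0 ≤ T) :
    radialWeight T r ^ (-((x + y) / 2)) ≤ 3 ^ (x / 2) * 2 ^ (y / 2) *
      ((1 + r ^ 2) ^ (-(x / 2)) * (1 + (r - T) ^ 2) ^ (-(x / 2 + y))) := by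
  have hpos := radialWeight_pos T r
  have hprod := rpow_neg_le_of_le (r := x / 2) (by positivity) three_pos (by positivity)
    (mul_le_radialWeight hr hT)
  have hsq := rpow_neg_le_of_le (r := y / 2) (by positivity) two_pos (by positivity)
    (sq_le_radialWeight hr hT)
  rw [Real.mul_rpow (by positivity) (by positivity)] at hprod
  rw [← Real.rpow_natCast, ← Real.rpow_mul (by positivity)] at hsq
  calc radialWeight T r ^ (-((x + y) / 2))
      = radialWeight T r ^ (-(x / 2)) * radialWeight T r ^ (-(y / 2)) := by
        rw [← Real.rpow_add hpos]; congr 1; ring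
    _ ≤ 3 ^ (x / 2) * ((1 + r ^ 2) ^ (-(x / 2)) * (1 + (r - T) ^ 2) ^ (-(x / 2))) *
          (2 ^ (y / 2) * (1 + (r - T) ^ 2) ^ (((2 : ℕ) : ℝ) * -(y / 2))) := by gcongr
    _ = 3 ^ (x / 2) * 2 ^ (y / 2) * ((1 + r ^ 2) ^ (-(x / 2)) *
          ((1 + (r - T) ^ 2) ^ (-(x / 2)) * (1 + (r - T) ^ 2) ^ (((2 : ℕ) : ℝ) * -(y / 2)))) := by
        ring
    _ = 3 ^ (x / 2) * 2 ^ (y / 2) *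
          ((1 + r ^ 2) ^ (-(x / 2)) * (1 + (r - T) ^ 2) ^ (-(x / 2 + y))) := by
        rw [← Real.rpow_add (by positivity)]; congr 4; push_cast; ring

lemma pow_le_one_add_sq_rpow (n : ℕ) {r : ℝ} (hr : 0 ≤ r) : r ^ n ≤ (1 + r ^ 2) ^ ((n : ℝ) / 2) :=
  calc r ^ n = (r ^ 2) ^ ((n : ℝ) / 2) := by
        rw [← Real.rpow_natCast, ← Real.rpow_natCast, ← Real.rpow_mul hr]
        congr 1; push_cast; ring
    _ ≤ (1 + r ^ 2) ^ ((n : ℝ) / 2) := by gcongr; linarith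

lemma exists_bound_radial_integrand {n : ℕ} {β : ℝ} (hn : (n : ℝ) < β) (hn' : n + 1 < 2 * β) :
    ∃ C η s : ℝ, 0 ≤ C ∧ 0 < η ∧ 1 < s ∧ ∀ r T, 0 ≤ r → 0 ≤ T →
      r ^ n * radialWeight T r ^ (-(β / 2)) ≤
        C * ((1 + r ^ 2) ^ (-(η / 2)) * (1 + (r - T) ^ 2) ^ (-s / 2)) := by
  obtain ⟨η, hη, hη'⟩ : ∃ η, 0 < η ∧ η < min (β - n) (2 * β - n - 1) :=
    exists_between (lt_min (by linarith) (by linarith))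
  obtain ⟨hηβ, hηs⟩ := lt_min_iff.1 hη'
  refine ⟨3 ^ ((n + η) / 2) * 2 ^ ((β - n - η) / 2), η, 2 * β - n - η, by positivity, hη,
    by linarith, fun r T hr hT => ?_⟩
  calc r ^ n * radialWeight T r ^ (-(β / 2))
      ≤ (1 + r ^ 2) ^ ((n : ℝ) / 2) * (3 ^ ((n + η) / 2) * 2 ^ ((β - n - η) / 2) *
          ((1 + r ^ 2) ^ (-((n + η) / 2)) *
            (1 + (r - T) ^ 2) ^ (-((n + η) / 2 + (β - n - η))))) := by
        refine mul_le_mul (pow_le_one_add_sq_rpow n hr) ?_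
          (Real.rpow_nonneg (radialWeight_pos T r).le _) (by positivity)
        have hle := radialWeight_rpow_le (x := n + η) (y := β - n - η) (by positivity)
          (by linarith) hr hT
        rwa [show (n : ℝ) + η + (β - n - η) = β by ring] at hle
    _ = 3 ^ ((n + η) / 2) * 2 ^ ((β - n - η) / 2) *
          ((1 + r ^ 2) ^ ((n : ℝ) / 2) * (1 + r ^ 2) ^ (-((n + η) / 2)) *
            (1 + (r - T) ^ 2) ^ (-((n + η) / 2 + (β - n - η)))) := by ring
    _ = 3 ^ ((n + η) / 2) * 2 ^ ((β - n - η) / 2) *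
          ((1 + r ^ 2) ^ (-(η / 2)) * (1 + (r - T) ^ 2) ^ (-(2 * β - n - η) / 2)) := by
        rw [← Real.rpow_add (by positivity)]
        ring_nf

lemma tendsto_integral_of_translated_bound {g : ℝ → ℝ → ℝ} {C η s : ℝ} (hC : 0 ≤ C) (hη : 0 < η)
    (hs : 1 < s) (hg : ∀ T, Measurable (g T)) (hbound : ∀ r T, 0 ≤ T →
      ‖g T r‖ ≤ C * ((1 + r ^ 2) ^ (-(η / 2)) * (1 + (r - T) ^ 2) ^ (-s / 2))) :
    Tendsto (fun T => ∫ r, g T r) atTop (𝓝 0) := by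
  have hshift : ∀ t T : ℝ, 0 ≤ T → ‖g T (t + T)‖ ≤
      C * ((1 + (t + T) ^ 2) ^ (-(η / 2)) * (1 + t ^ 2) ^ (-s / 2)) := fun t T hT => by
    simpa only [add_sub_cancel_right] using hbound (t + T) T hT
  have hlim : ∀ t : ℝ, Tendsto (fun T : ℝ =>
      C * ((1 + (t + T) ^ 2) ^ (-(η / 2)) * (1 + t ^ 2) ^ (-s / 2))) atTop (𝓝 0) := fun t => by
    have hbase : Tendsto (fun T : ℝ => 1 + (t + T) ^ 2) atTop atTop :=
      tendsto_atTop_add_const_left _ _ ((tendsto_pow_atTop two_ne_zero).comp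
        (tendsto_atTop_add_const_left _ _ tendsto_id))
    simpa using ((((tendsto_rpow_neg_atTop (half_pos hη)).comp hbase).mul_const
      ((1 + t ^ 2) ^ (-s / 2))).const_mul C)
  have hdom := tendsto_integral_filter_of_dominated_convergence (l := (atTop : Filter ℝ))
    (μ := volume) (F := fun T t => g T (t + T)) (f := fun _ => (0 : ℝ))
    (fun t : ℝ => C * (1 + t ^ 2) ^ (-s / 2))
    (Eventually.of_forall fun T => ((hg T).comp (measurable_add_const T)).aestronglyMeasurable)
    ?_ ((integrable_one_add_sq_rpow hs).const_mul C)
    (Eventually.of_forall fun t => squeeze_zero_norm' ?_ (hlim t))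
  · simpa only [integral_add_right_eq_self, integral_zero] using hdom
  · filter_upwards [eventually_ge_atTop 0] with T hT
    refine Eventually.of_forall fun t => (hshift t T hT).trans ?_
    gcongr
    exact mul_le_of_le_one_left (by positivity) (Real.rpow_le_one_of_one_le_of_nonpos
      (le_add_of_nonneg_right (sq_nonneg _)) (by linarith))
  · filter_upwards [eventually_ge_atTop 0] with T hT using hshift t T hT

lemma tendsto_radial_integral {n : ℕ} {β : ℝ} (hn : (n : ℝ) < β) (hn' : n + 1 < 2 * β) :
    Tendsto (fun T : ℝ => ∫ r in Ioi (0 : ℝ), r ^ n • radialWeight T r ^ (-(β / 2)))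
      atTop (𝓝 0) := by
  obtain ⟨C, η, s, hC, hη, hs, hbound⟩ := exists_bound_radial_integrand hn hn'
  simp only [← integral_indicator measurableSet_Ioi]
  refine tendsto_integral_of_translated_bound hC hη hs (fun T =>
    ((continuous_pow n).smul (continuous_radialWeight_rpow T _)).measurable.indicator
      measurableSet_Ioi) fun r T hT => ?_
  rw [norm_indicator_eq_indicator_norm]
  refine indicator_apply_le' (fun hr => ?_) fun _ => ?_
  · have hr0 : (0 : ℝ) < r := hr
    have hpos := radialWeight_pos T r
    rw [smul_eq_mul, Real.norm_of_nonneg (by positivity)]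
    exact hbound r T hr0.le hT
  · positivity

lemma integrable_radialWeight_rpow {V : Type*} [NormedAddCommGroup V] [NormedSpace ℝ V]
    [FiniteDimensional ℝ V] [MeasurableSpace V] [BorelSpace V] {μ : Measure V}
    [μ.IsAddHaarMeasure] {β : ℝ} (hβ : (Module.finrank ℝ V : ℝ) < 2 * β) (T : ℝ) :
    Integrable (fun y : V => radialWeight T ‖y‖ ^ (-(β / 2))) μ := by
  have hβ0 : 0 ≤ β := by linarith [(Module.finrank ℝ V).cast_nonneg (α := ℝ)]
  refine ((integrable_rpow_neg_one_add_norm_sq (μ := μ) hβ).const_mul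
    ((4 + 4 * (T ^ 2) ^ 2) ^ (β / 2))).mono'
    ((continuous_radialWeight_rpow T _).comp continuous_norm).aestronglyMeasurable
    (Eventually.of_forall fun y => ?_)
  rw [Real.norm_of_nonneg (Real.rpow_nonneg (radialWeight_pos _ _).le _)]
  have hle : (1 + ‖y‖ ^ 2) ^ 2 ≤ (4 + 4 * (T ^ 2) ^ 2) * radialWeight T ‖y‖ := by
    unfold radialWeight
    nlinarith [sq_nonneg (‖y‖ ^ 2 - 2 * T ^ 2), sq_nonneg (‖y‖ ^ 2 - 1), sq_nonneg ‖y‖,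
      mul_nonneg (sq_nonneg (T ^ 2)) (sq_nonneg ‖y‖),
      mul_nonneg (sq_nonneg (T ^ 2)) (sq_nonneg (T ^ 2 - ‖y‖ ^ 2))]
  refine (rpow_neg_le_of_le (r := β / 2) (by positivity) (by positivity) (by positivity)
    hle).trans_eq ?_
  rw [← Real.rpow_natCast (1 + ‖y‖ ^ 2), ← Real.rpow_mul (by positivity)]
  congr 2
  push_cast; ring

section Decay

variable {ι : Type*} [Fintype ι] {e : ι → ℝ}

lemma sum_sq_eq_card (he : ∀ j, e j ^ 3 = e j) [DecidablePred fun j => e j = 0] :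
    ∑ j, e j ^ 2 = Fintype.card {j // ¬e j = 0} := by
  rw [← Fintype.sum_subtype_add_sum_subtype (fun j => e j = 0),
    Finset.sum_eq_zero fun j _ => by rw [j.2]; norm_num, zero_add,
    Finset.sum_congr rfl fun j _ => (eq_zero_or_sq_eq_one (he j.1)).resolve_left j.2]
  simp

lemma orbitDegree_eq_card (he : ∀ j, e j ^ 3 = e j) [DecidablePred fun j => e j = 0] (lam : ℝ) :
    orbitDegree e lam =
      lam + ((Fintype.card {j // e j = 0} : ℝ) + (Fintype.card {j // ¬e j = 0} : ℝ) / 2) := by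
  have hcard : (Fintype.card ι : ℝ) =
      (Fintype.card {j // e j = 0} : ℝ) + (Fintype.card {j // ¬e j = 0} : ℝ) := by
    rw [← Nat.cast_add, Fintype.card_subtype_compl,
      Nat.add_sub_cancel' (Fintype.card_subtype_le _)]
  rw [orbitDegree, Finset.sum_sub_distrib, ← Finset.sum_div, sum_sq_eq_card he]
  simp only [Finset.sum_const, Finset.card_univ, nsmul_eq_mul, mul_one, hcard]
  ring

lemma orbitWeight_eq_split (he : ∀ j, e j ^ 3 = e j) (hs : ∀ j, e j ≤ 0)
    [DecidablePred fun j => e j = 0] (T : ℝ) (w : ι → ℝ) :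
    orbitWeight e (T ^ 2) w = ‖(splitEquiv (fun j => e j = 0) w).1‖ ^ 2 +
      radialWeight T ‖(splitEquiv (fun j => e j = 0) w).2‖ := by
  have hneg : ∀ j : {j // ¬e j = 0}, e j * w j ^ 2 = -w j ^ 2 := fun j => by
    have hsq := (eq_zero_or_sq_eq_one (he j.1)).resolve_left j.2
    have hone : e j = -1 := by nlinarith [hs j.1]
    rw [hone, neg_one_mul]
  rw [radialWeight, norm_splitEquiv_fst, norm_splitEquiv_snd, orbitWeight,
    ← Fintype.sum_subtype_add_sum_subtype (fun j => e j = 0) fun j => w j ^ 2,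
    ← Fintype.sum_subtype_add_sum_subtype (fun j => e j = 0) fun j => e j * w j ^ 2,
    Finset.sum_eq_zero (s := (Finset.univ : Finset {j // e j = 0})) (f := fun j => e j * w j ^ 2)
      fun j _ => by rw [j.2, zero_mul],
    zero_add, Finset.sum_congr rfl fun j _ => hneg j, Finset.sum_neg_distrib]
  ring

lemma orbitWeight_rpow_le_mul (he : ∀ j, e j ^ 3 = e j) (hs : ∀ j, e j ≤ 0)
    [DecidablePred fun j => e j = 0] {α β : ℝ} (hα : 0 ≤ α) (hβ : 0 ≤ β) (T : ℝ) (w : ι → ℝ) :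
    orbitWeight e (T ^ 2) w ^ (-((α + β) / 2)) ≤
      (1 + ‖(splitEquiv (fun j => e j = 0) w).1‖ ^ 2) ^ (-α / 2) *
        radialWeight T ‖(splitEquiv (fun j => e j = 0) w).2‖ ^ (-(β / 2)) := by
  have hexp : -((α + β) / 2) = -α / 2 + -(β / 2) := by ring
  rw [hexp, Real.rpow_add (orbitWeight_pos _ w), orbitWeight_eq_split he hs]
  set r := ‖(splitEquiv (fun j => e j = 0) w).2‖
  have hpos := radialWeight_pos T r
  have hone : 1 ≤ radialWeight T r := by
    unfold radialWeight; linarith [sq_nonneg r, sq_nonneg (T ^ 2 - r ^ 2)]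
  refine mul_le_mul ?_ ?_ (by positivity) (by positivity)
  · exact Real.rpow_le_rpow_of_nonpos (by positivity) (by linarith) (by linarith)
  · exact Real.rpow_le_rpow_of_nonpos hpos (le_add_of_nonneg_left (sq_nonneg _)) (by linarith)

lemma integral_orbitWeight_rpow_le (he : ∀ j, e j ^ 3 = e j) (hs : ∀ j, e j ≤ 0)
    [DecidablePred fun j => e j = 0] {α β : ℝ} (hα : (Fintype.card {j // e j = 0} : ℝ) < α)
    (hβ : (Fintype.card {j // ¬e j = 0} : ℝ) < 2 * β) (T : ℝ) :
    ∫ w, orbitWeight e (T ^ 2) w ^ (-((α + β) / 2)) ≤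
      (∫ x : EuclideanSpace ℝ {j // e j = 0}, (1 + ‖x‖ ^ 2) ^ (-α / 2)) *
        ∫ y : EuclideanSpace ℝ {j // ¬e j = 0}, radialWeight T ‖y‖ ^ (-(β / 2)) := by
  have hα0 : 0 ≤ α := (Nat.cast_nonneg _).trans hα.le
  have hβ0 : 0 ≤ β := by linarith [(Fintype.card {j // ¬e j = 0}).cast_nonneg (α := ℝ)]
  have hint : Integrable fun z :
      EuclideanSpace ℝ {j // e j = 0} × EuclideanSpace ℝ {j // ¬e j = 0} =>
      (1 + ‖z.1‖ ^ 2) ^ (-α / 2) * radialWeight T ‖z.2‖ ^ (-(β / 2)) :=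
    (integrable_rpow_neg_one_add_norm_sq (by rwa [finrank_euclideanSpace])).mul_prod
      (integrable_radialWeight_rpow (by rwa [finrank_euclideanSpace]) T)
  have hpres := measurePreserving_splitEquiv fun j => e j = 0
  rw [← integral_prod_mul, ← Measure.volume_eq_prod, ← hpres.integral_comp'
    (g := fun z => (1 + ‖z.1‖ ^ 2) ^ (-α / 2) * radialWeight T ‖z.2‖ ^ (-(β / 2)))]
  exact integral_mono_of_nonneg
    (Eventually.of_forall fun w => Real.rpow_nonneg (orbitWeight_pos _ _).le _)
    ((hpres.integrable_comp_emb (splitEquiv _).measurableEmbedding).2 hint)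
    (Eventually.of_forall fun w => orbitWeight_rpow_le_mul he hs hα0 hβ0 T w)

lemma tendsto_integral_radialWeight_norm {κ : Type*} [Fintype κ] [Nonempty κ] {β : ℝ}
    (hβ : (Fintype.card κ : ℝ) < 2 * β) (hβ' : (Fintype.card κ : ℝ) - 1 < β) :
    Tendsto (fun T => ∫ y : EuclideanSpace ℝ κ, radialWeight T ‖y‖ ^ (-(β / 2))) atTop (𝓝 0) := by
  have hcard : ((Fintype.card κ - 1 : ℕ) : ℝ) = Fintype.card κ - 1 := by
    rw [Nat.cast_sub Fintype.card_pos, Nat.cast_one]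
  simp_rw [fun T => integral_fun_norm_addHaar (volume : Measure (EuclideanSpace ℝ κ))
    fun r => radialWeight T r ^ (-(β / 2)), finrank_euclideanSpace]
  simpa only [smul_zero] using ((tendsto_radial_integral (by rwa [hcard]) (by rw [hcard]; linarith)
    ).const_smul ((volume : Measure (EuclideanSpace ℝ κ)).real (Metric.ball 0 1))).const_smul
      (Fintype.card κ)

lemma tendsto_integral_orbitWeight_of_nonpos (he : ∀ j, e j ^ 3 = e j) (hs : ∀ j, e j ≤ 0)
    (hne : ∃ j, e j ≠ 0) {lam : ℝ} (hlam : 0 < lam) (hmu : 0 < lam + 1 - (∑ j, e j ^ 2) / 2) :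
    Tendsto (fun T : ℝ => ∫ w, orbitWeight e (T ^ 2) w ^ (-(orbitDegree e lam / 2)))
      atTop (𝓝 0) := by
  classical
  obtain ⟨j, hj⟩ := hne
  have : Nonempty {j // ¬e j = 0} := ⟨⟨j, hj⟩⟩
  rw [sum_sq_eq_card he] at hmu
  set k := Fintype.card {j // ¬e j = 0}
  set l := Fintype.card {j // e j = 0}
  obtain ⟨δ, hδ, hδ'⟩ := exists_between (lt_min hlam hmu)
  obtain ⟨hδlam, hδmu⟩ := lt_min_iff.1 hδ'
  have hdegree : orbitDegree e lam = l + δ + (lam + k / 2 - δ) := by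
    rw [orbitDegree_eq_card he]; ring
  have hβ : (k : ℝ) < 2 * (lam + k / 2 - δ) := by linarith
  rw [hdegree]
  refine squeeze_zero
    (fun T => integral_nonneg fun w => Real.rpow_nonneg (orbitWeight_pos _ _).le _)
    (fun T => integral_orbitWeight_rpow_le he hs (lt_add_of_pos_right _ hδ) hβ T) ?_
  simpa only [mul_zero] using
    (tendsto_integral_radialWeight_norm hβ (by linarith)).const_mul _

lemma tendsto_integral_orbitWeight_of_nonneg [Nonempty ι] (he : ∀ j, e j ^ 3 = e j)
    (hs : ∀ j, 0 ≤ e j) {lam : ℝ} (hlam : 0 < lam) :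
    Tendsto (fun T : ℝ => ∫ w, orbitWeight e (T ^ 2) w ^ (-(orbitDegree e lam / 2)))
      atTop (𝓝 0) := by
  have hdegree : 0 < orbitDegree e lam := by
    have hzero := orbitDegree_nonneg he le_rfl
    unfold orbitDegree at hzero ⊢
    linarith
  have hnonneg : ∀ w : ι → ℝ, 0 ≤ ∑ j, e j * w j ^ 2 := fun w =>
    Finset.sum_nonneg fun j _ => mul_nonneg (hs j) (sq_nonneg _)
  have hmono : ∀ (T : ℝ) w, orbitWeight e 0 w ≤ orbitWeight e (T ^ 2) w := fun T w => by
    have hsum := hnonneg w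
    unfold orbitWeight
    gcongr
    positivity
  have hlarge : ∀ (w : ι → ℝ) (T : ℝ), T ^ 2 ≤ orbitWeight e (T ^ 2) w := fun w T => by
    unfold orbitWeight
    nlinarith [hnonneg w, sum_sq_nonneg w, sq_nonneg T,
      sq_nonneg (T ^ 2 + ∑ j, e j * w j ^ 2 - 1)]
  rw [← integral_zero (ι → ℝ) ℝ]
  refine tendsto_integral_filter_of_dominated_convergence
    (fun w => orbitWeight e 0 w ^ (-(orbitDegree e lam / 2)))
    (Eventually.of_forall fun T => (continuous_orbitWeight_rpow _ _).aestronglyMeasurable)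
    (Eventually.of_forall fun T => Eventually.of_forall fun w => ?_)
    (integrable_orbitWeight_rpow he (Or.inl hs) hlam) (Eventually.of_forall fun w => ?_)
  · rw [Real.norm_of_nonneg (Real.rpow_nonneg (orbitWeight_pos _ _).le _)]
    exact Real.rpow_le_rpow_of_nonpos (orbitWeight_pos _ _) (hmono T w) (by linarith)
  · exact (tendsto_rpow_neg_atTop (half_pos hdegree)).comp
      (tendsto_atTop_mono (hlarge w) (tendsto_pow_atTop two_ne_zero))

end Decay

namespace ParaboloidFamily

variable {ι E W : Type*} [Fintype ι] [Nonempty ι] [NormedAddCommGroup E] [NormedSpace ℝ E]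
  [NormedAddCommGroup W] [NormedSpace ℝ W] (P : ParaboloidFamily ι E) {lam : ℝ}

/-- The condition under which the integrals over the paraboloids tend to `0` as `ε → ∞`. For
nonpositive coefficients it corresponds to `μ_λ > 0`. -/
def IsDecaying (lam : ℝ) : Prop :=
  (∀ j, 0 ≤ P.coeff j) ∨ (∀ j, P.coeff j ≤ 0) ∧ 0 < lam + 1 - (∑ j, P.coeff j ^ 2) / 2

variable {P}

lemma IsDecaying.tendsto_integral_orbitWeight (h : P.IsDecaying lam) (hlam : 0 < lam) :
    Tendsto (fun T : ℝ => ∫ w, orbitWeight P.coeff (T ^ 2) w ^ (-(orbitDegree P.coeff lam / 2)))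
      atTop (𝓝 0) := by
  rcases h with hnonneg | ⟨hnonpos, hmu⟩
  · exact tendsto_integral_orbitWeight_of_nonneg P.coeff_cube hnonneg hlam
  · by_cases hne : ∃ j, P.coeff j ≠ 0
    · exact tendsto_integral_orbitWeight_of_nonpos P.coeff_cube hnonpos hne hlam hmu
    · push Not at hne
      exact tendsto_integral_orbitWeight_of_nonneg P.coeff_cube (fun j => (hne j).ge) hlam

theorem IsWaveFunction.integral_eq_zero [FiniteDimensional ℝ E] {F : E → W}
    (hF : P.IsWaveFunction lam F) (hlam : 0 < lam) (h : P.IsDecaying lam) {ε : ℝ} (hε : 0 < ε) :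
    ∫ w, F (P.point ε w) = 0 := by
  have hdegree := orbitDegree_nonneg P.coeff_cube hlam.le
  obtain ⟨C, -, hC⟩ := P.exists_bound_orbitWeight hdegree hF.homogeneous hF.continuousOn
  have hint : ∀ T : ℝ, Integrable fun w =>
      orbitWeight P.coeff (T ^ 2) w ^ (-(orbitDegree P.coeff lam / 2)) := fun T => by
    refine ((P.integrable_weight hlam).const_mul
      ((2 + 2 * (T ^ 2) ^ 2) ^ (orbitDegree P.coeff lam / 2))).mono'
      (continuous_orbitWeight_rpow _ _).aestronglyMeasurable (Eventually.of_forall fun w => ?_)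
    rw [Real.norm_of_nonneg (Real.rpow_nonneg (orbitWeight_pos _ _).le _)]
    exact P.orbitWeight_rpow_le hdegree (sq_nonneg T) le_rfl w
  have hlim := (h.tendsto_integral_orbitWeight hlam).const_mul C
  rw [mul_zero] at hlim
  refine norm_le_zero_iff.1 (ge_of_tendsto hlim ?_)
  filter_upwards [eventually_gt_atTop 0] with T hT
  rw [hF.integral_eq hlam hε (by positivity : 0 < T ^ 2), ← integral_const_mul]
  exact norm_integral_le_of_norm_le ((hint T).const_mul C)
    (Eventually.of_forall fun w => hC _ w (sq_nonneg T))

end ParaboloidFamily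

/-! ### Coordinates on the orbits of `N^*` -/

section Coordinates

lemma sum_ite_lt_eq_sum_castLE {M : Type*} [AddCommMonoid M] {n m : ℕ} (h : n ≤ m)
    (f : Fin m → M) :
    ∑ j : Fin m, (if (j : ℕ) < n then f j else 0) = ∑ i : Fin n, f (Fin.castLE h i) := by
  rw [← Finset.sum_filter]
  symm
  refine Finset.sum_bij (fun i _ => Fin.castLE h i) ?_ ?_ ?_ ?_
  · intro i _; simp
  · intro i _ j _ hij; exact Fin.castLE_injective h hij
  · intro j hj
    exact ⟨⟨j, (Finset.mem_filter.1 hj).2⟩, Finset.mem_univ _, rfl⟩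
  · intro i _; rfl

variable (p q : ℕ)

lemma sum_uPart {M : Type*} [AddCommMonoid M] (f : ℝ → M) (w : Fin (max (p - 1) q) → ℝ) :
    ∑ i, f (uPart p q w i) =
      ∑ j : Fin (max (p - 1) q), if (j : ℕ) < p - 1 then f (w j) else 0 :=
  (sum_ite_lt_eq_sum_castLE (le_max_left _ _) fun j => f (w j)).symm

lemma sum_vPart {M : Type*} [AddCommMonoid M] (f : ℝ → M) (w : Fin (max (p - 1) q) → ℝ) :
    ∑ i, f (vPart p q w i) =
      ∑ j : Fin (max (p - 1) q), if (j : ℕ) < q then f (w j) else 0 := by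
  rw [sum_ite_lt_eq_sum_castLE (le_max_right _ _) fun j => f (w j)]
  exact Equiv.sum_comp Fin.revPerm fun k => f (w (Fin.castLE (le_max_right _ _) k))

/-- The coefficient of `w_j²` in `|u|² - |v|²`, which is `1`, `0` or `-1`. -/
def signCoef (j : Fin (max (p - 1) q)) : ℝ :=
  (if (j : ℕ) < p - 1 then 1 else 0) - if (j : ℕ) < q then 1 else 0

lemma sum_sq_uPart_sub (w : Fin (max (p - 1) q) → ℝ) :
    ∑ i, uPart p q w i ^ 2 - ∑ k, vPart p q w k ^ 2 = ∑ j, signCoef p q j * w j ^ 2 := by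
  rw [sum_uPart p q (· ^ 2), sum_vPart p q (· ^ 2), ← Finset.sum_sub_distrib]
  refine Finset.sum_congr rfl fun j _ => ?_
  unfold signCoef
  split_ifs <;> ring

lemma sum_sq_le_sum_sq_uPart_add (w : Fin (max (p - 1) q) → ℝ) :
    ∑ j, w j ^ 2 ≤ ∑ i, uPart p q w i ^ 2 + ∑ k, vPart p q w k ^ 2 := by
  rw [sum_uPart p q (· ^ 2), sum_vPart p q (· ^ 2), ← Finset.sum_add_distrib]
  refine Finset.sum_le_sum fun j _ => ?_
  have hw := sq_nonneg (w j)
  rcases lt_max_iff.1 j.2 with h | h <;> simp only [h, if_true] <;> split_ifs <;> linarith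

lemma signCoef_cube (j : Fin (max (p - 1) q)) : signCoef p q j ^ 3 = signCoef p q j := by
  unfold signCoef; split_ifs <;> norm_num

lemma signCoef_sign : (∀ j, 0 ≤ signCoef p q j) ∨ ∀ j, signCoef p q j ≤ 0 := by
  rcases le_total q (p - 1) with h | h
  · left; intro j; unfold signCoef; split_ifs <;> first | omega | norm_num
  · right; intro j; unfold signCoef; split_ifs <;> first | omega | norm_num

lemma one_sub_signCoef_sq (j : Fin (max (p - 1) q)) : 1 - signCoef p q j ^ 2 / 2 =
    (if (j : ℕ) < p - 1 then 1 / 2 else 0) + if (j : ℕ) < q then 1 / 2 else 0 := by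
  unfold signCoef
  rcases lt_max_iff.1 j.2 with h | h <;> simp only [h, if_true] <;> split_ifs <;> norm_num

lemma sum_one_sub_signCoef_sq (hp : 1 ≤ p) :
    ∑ j, (1 - signCoef p q j ^ 2 / 2) = rho p q := by
  rw [Finset.sum_congr rfl fun j _ => one_sub_signCoef_sq p q j, Finset.sum_add_distrib,
    sum_ite_lt_eq_sum_castLE (le_max_left _ _) fun _ => (1 / 2 : ℝ),
    sum_ite_lt_eq_sum_castLE (le_max_right _ _) fun _ => (1 / 2 : ℝ)]
  simp only [Finset.sum_const, Finset.card_univ, Fintype.card_fin, nsmul_eq_mul, Nat.cast_sub hp,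
    Nat.cast_one, rho]
  ring

lemma sum_signCoef_sq (hp : 1 ≤ p) :
    (∑ j, signCoef p q j ^ 2) / 2 = ((max (p - 1) q : ℕ) : ℝ) - rho p q := by
  rw [← sum_one_sub_signCoef_sq p q hp, Finset.sum_sub_distrib, ← Finset.sum_div]
  simp

/-- The point of the orbit of `N^*` with coordinates `w`, for the value `-ε` of the form. -/
noncomputable def orbitPoint (ε : ℝ) (w : Fin (max (p - 1) q) → ℝ) : Idx p q → ℝ :=
  Sum.elim (Sum.elim (fun _ => (ε + ∑ j, signCoef p q j * w j ^ 2 - 1) / 2) (uPart p q w))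
    (Sum.elim (-vPart p q w) fun _ => (ε + ∑ j, signCoef p q j * w j ^ 2 + 1) / 2)

lemma nilElt_mulVec (u : Fin (p - 1) → ℝ) (v : Fin q → ℝ) (a b : ℝ) (x : Fin (p - 1) → ℝ)
    (y : Fin q → ℝ) :
    nilElt p q u v *ᵥ (Sum.elim (Sum.elim (fun _ => a) x) (Sum.elim y fun _ => b)) =
      Sum.elim (Sum.elim (fun _ => u ⬝ᵥ x + v ⬝ᵥ y) ((b - a) • u))
        (Sum.elim (-((b - a) • v)) fun _ => u ⬝ᵥ x + v ⬝ᵥ y) := by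
  ext ((i | i) | (i | i)) <;>
    simp [nilElt, Matrix.mulVec, dotProduct, Fintype.sum_sum_type, Matrix.fromBlocks] <;> ring

lemma nilElt_pow_three (u : Fin (p - 1) → ℝ) (v : Fin q → ℝ) : nilElt p q u v ^ 3 = 0 := by
  have mulVec_eq_zero (x : Idx p q → ℝ) : nilElt p q u v ^ 3 *ᵥ x = 0 := by
    have hx : x = Sum.elim (Sum.elim (fun _ => x (Sum.inl (Sum.inl ())))
        fun i => x (Sum.inl (Sum.inr i))) (Sum.elim (fun i => x (Sum.inr (Sum.inl i)))
        fun _ => x (Sum.inr (Sum.inr ()))) := by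
      ext ((i | i) | (i | i)) <;> rfl
    rw [hx, pow_succ, pow_two, ← Matrix.mulVec_mulVec, ← Matrix.mulVec_mulVec, nilElt_mulVec,
      nilElt_mulVec, nilElt_mulVec]
    ext ((i | i) | (i | i)) <;> simp
  exact Matrix.ext_of_mulVec_single fun i => by rw [mulVec_eq_zero, Matrix.zero_mulVec]

lemma unip_eq (u : Fin (p - 1) → ℝ) (v : Fin q → ℝ) :
    unip p q u v = 1 + nilElt p q u v + (1 / 2 : ℝ) • nilElt p q u v ^ 2 := by
  rw [unip, NormedSpace.exp_eq_tsum ℝ]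
  simp only
  rw [tsum_eq_sum (s := Finset.range 3)]
  · simp [Finset.sum_range_succ]
  · intro n hn
    have three_le : 3 ≤ n := by simpa using hn
    rw [← Nat.add_sub_cancel' three_le, pow_add, nilElt_pow_three, zero_mul, smul_zero]

lemma nStar_mulVec_basePoint (w : Fin (max (p - 1) q) → ℝ) :
    nStar p q w *ᵥ basePoint p q = orbitPoint p q 1 w := by
  have hx : basePoint p q = Sum.elim (Sum.elim (fun _ => 0) 0) (Sum.elim 0 fun _ => 1) := by
    ext ((i | i) | (i | i)) <;> simp [basePoint]
  rw [nStar, unip_eq, Matrix.add_mulVec, Matrix.add_mulVec, Matrix.one_mulVec,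
    Matrix.smul_mulVec, pow_two, ← Matrix.mulVec_mulVec, hx, nilElt_mulVec, nilElt_mulVec,
    orbitPoint, ← sum_sq_uPart_sub]
  ext ((i | i) | (i | i)) <;> simp [dotProduct, ← pow_two] <;> ring

lemma mul_nStar_mulVec_basePoint (g : Mat p q) (w : Fin (max (p - 1) q) → ℝ) :
    (g * nStar p q w) *ᵥ basePoint p q = g *ᵥ orbitPoint p q 1 w := by
  rw [← Matrix.mulVec_mulVec, nStar_mulVec_basePoint]

/-- The diagonal entries of the matrix `form p q`. -/
def formSign : Idx p q → ℝ := Sum.elim (fun _ => 1) fun _ => -1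

lemma form_eq : form p q = Matrix.diagonal (formSign p q) := rfl

lemma form_mul_form : form p q * form p q = 1 := by
  rw [form_eq, Matrix.diagonal_mul_diagonal, ← Matrix.diagonal_one]
  congr 1
  ext (i | i) <;> simp [formSign]

variable {p q} in
lemma form_mul_transpose_mul_form_mul {g : Mat p q} (hg : gᵀ * form p q * g = form p q) :
    (form p q * gᵀ * form p q) * g = 1 := by
  rw [mul_assoc (form p q), mul_assoc (form p q), hg, form_mul_form]

variable {p q} in
lemma mul_form_mul_transpose {g : Mat p q} (hg : gᵀ * form p q * g = form p q) :
    g * form p q * gᵀ = form p q := by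
  have right_inverse : g * (form p q * gᵀ * form p q) = 1 :=
    mul_eq_one_comm.1 (form_mul_transpose_mul_form_mul hg)
  simpa only [one_mul, mul_assoc, form_mul_form, mul_one] using
    congrArg (· * form p q) right_inverse

lemma sum_formSign_mul_sq_eq (x : Idx p q → ℝ) :
    ∑ b, formSign p q b * x b ^ 2 = x ⬝ᵥ form p q *ᵥ x := by
  rw [form_eq]
  refine Finset.sum_congr rfl fun b _ => ?_
  rw [Matrix.mulVec_diagonal]
  ring

variable {p q} in
lemma sum_formSign_mulVec {g : Mat p q} (hg : gᵀ * form p q * g = form p q) (x : Idx p q → ℝ) :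
    ∑ b, formSign p q b * (g *ᵥ x) b ^ 2 = ∑ b, formSign p q b * x b ^ 2 := by
  rw [sum_formSign_mul_sq_eq, sum_formSign_mul_sq_eq, Matrix.mulVec_mulVec,
    ← Matrix.vecMul_transpose, ← Matrix.dotProduct_mulVec, Matrix.mulVec_mulVec, ← mul_assoc, hg]

lemma sum_formSign_orbitPoint (ε : ℝ) (w : Fin (max (p - 1) q) → ℝ) :
    ∑ b, formSign p q b * orbitPoint p q ε w b ^ 2 = -ε := by
  simp only [Fintype.sum_sum_type, formSign, orbitPoint, Sum.elim_inl, Sum.elim_inr, one_mul,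
    neg_one_mul, Finset.univ_unique, Finset.sum_singleton, Finset.sum_neg_distrib, Pi.neg_apply,
    neg_sq]
  linear_combination sum_sq_uPart_sub p q w

lemma orbitWeight_le_sum_sq_orbitPoint (ε : ℝ) (w : Fin (max (p - 1) q) → ℝ) :
    orbitWeight (signCoef p q) ε w ≤ 2 * ∑ b, orbitPoint p q ε w b ^ 2 := by
  have sum_le := sum_sq_le_sum_sq_uPart_add p q w
  have sum_nonneg := sum_sq_nonneg w
  simp only [Fintype.sum_sum_type, orbitPoint, Sum.elim_inl, Sum.elim_inr,
    Finset.univ_unique, Finset.sum_singleton, Pi.neg_apply, neg_sq, orbitWeight]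
  nlinarith

lemma sum_sq_mulVec_le {n : Type*} [Fintype n] (A : Matrix n n ℝ) (x : n → ℝ) :
    ∑ b, (A *ᵥ x) b ^ 2 ≤ (∑ b, ∑ c, A b c ^ 2) * ∑ c, x c ^ 2 := by
  rw [Finset.sum_mul]
  exact Finset.sum_le_sum fun b _ => Finset.sum_mul_sq_le_sq_mul_sq _ _ _

/-- The projection of `ℝ^{p+q+1}` to its last `q + 1` coordinates. -/
noncomputable def negPart : (Idx p q → ℝ) →ₗ[ℝ] EuclideanSpace ℝ (Fin q ⊕ Unit) where
  toFun x := WithLp.toLp 2 fun k => x (Sum.inr k)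
  map_add' _ _ := rfl
  map_smul' _ _ := rfl

lemma norm_negPart_sq (x : Idx p q → ℝ) : ‖negPart p q x‖ ^ 2 = ∑ k, x (Sum.inr k) ^ 2 := by
  rw [EuclideanSpace.norm_sq_eq]
  exact Finset.sum_congr rfl fun k _ => sq_abs _

lemma norm_negPart (x : Idx p q → ℝ) : ‖negPart p q x‖ = coshPart p q x := by
  rw [coshPart, ← norm_negPart_sq, Real.sqrt_sq (norm_nonneg _)]

variable {p q} in
lemma exists_sum_sq_le_mul_sum_sq_mulVec {g : Mat p q} (hg : gᵀ * form p q * g = form p q) :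
    ∃ K : ℝ, 0 < K ∧ ∀ x, ∑ b, x b ^ 2 ≤ K * ∑ b, (g *ᵥ x) b ^ 2 := by
  set A := form p q * gᵀ * form p q
  have entries_nonneg : 0 ≤ ∑ b, ∑ c, A b c ^ 2 :=
    Finset.sum_nonneg fun b _ => Finset.sum_nonneg fun c _ => sq_nonneg _
  refine ⟨(∑ b, ∑ c, A b c ^ 2) + 1, by linarith, fun x => ?_⟩
  have le_entries := sum_sq_mulVec_le A (g *ᵥ x)
  rw [Matrix.mulVec_mulVec, form_mul_transpose_mul_form_mul hg, Matrix.one_mulVec] at le_entries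
  linarith [sum_sq_nonneg (g *ᵥ x)]

variable {p q} in
lemma exists_mul_orbitWeight_le_norm_negPart {g : Mat p q}
    (hg : gᵀ * form p q * g = form p q) :
    ∃ c : ℝ, 0 < c ∧ ∀ ε w, 0 ≤ ε → c * orbitWeight (signCoef p q) ε w ≤
      ‖negPart p q (g *ᵥ orbitPoint p q ε w)‖ ^ 2 := by
  obtain ⟨K, hK, sum_sq_le⟩ := exists_sum_sq_le_mul_sum_sq_mulVec hg
  refine ⟨(4 * K)⁻¹, by positivity, fun ε w hε => ?_⟩
  set x := orbitPoint p q ε w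
  have weight_le := orbitWeight_le_sum_sq_orbitPoint p q ε w
  have norm_le := sum_sq_le x
  have form_eq_neg := sum_formSign_mulVec hg x
  rw [sum_formSign_orbitPoint, Fintype.sum_sum_type] at form_eq_neg
  simp only [formSign, Sum.elim_inl, Sum.elim_inr, one_mul, neg_one_mul,
    Finset.sum_neg_distrib] at form_eq_neg
  rw [Fintype.sum_sum_type (fun b => (g *ᵥ x) b ^ 2)] at norm_le
  rw [norm_negPart_sq, inv_mul_le_iff₀ (by positivity)]
  have pos_le_neg : K * (∑ a, (g *ᵥ x) (Sum.inl a) ^ 2 + ∑ k, (g *ᵥ x) (Sum.inr k) ^ 2) ≤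
      K * (2 * ∑ k, (g *ᵥ x) (Sum.inr k) ^ 2) := by
    gcongr
    linarith
  linarith

end Coordinates

/-! ### Harmonic functions -/

section Harmonic

variable {E W : Type*} [NormedAddCommGroup E]

lemma eventually_ne_zero {y : E} (hy : y ≠ 0) : ∀ᶠ x in 𝓝 y, x ≠ 0 := isOpen_ne.mem_nhds hy

lemma eventually_add_norm_sq_ne_zero {y : E} {c : ℝ} (hy : c + ‖y‖ ^ 2 ≠ 0) :
    ∀ᶠ x : E in 𝓝 y, c + ‖x‖ ^ 2 ≠ 0 :=
  (show Continuous fun x : E => c + ‖x‖ ^ 2 by fun_prop).continuousAt.eventually_ne hy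

section SecondDerivative

variable [NormedSpace ℝ E] [NormedAddCommGroup W] [NormedSpace ℝ W] {G : E → W} {y : E}

lemma fderiv_fderiv_apply (h : ContDiffAt ℝ 2 G y) (a b : E) :
    fderiv ℝ (fun x => fderiv ℝ G x b) y a = fderiv ℝ (fderiv ℝ G) y a b := by
  have differentiable_fderiv : DifferentiableAt ℝ (fderiv ℝ G) y :=
    (h.fderiv_right (m := 1) (by norm_num)).differentiableAt (by norm_num)
  rw [fderiv_clm_apply differentiable_fderiv (differentiableAt_const b)]
  simp

lemma fderiv_fderiv_apply_comm (h : ContDiffAt ℝ 2 G y) (a b : E) :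
    fderiv ℝ (fun x => fderiv ℝ G x b) y a = fderiv ℝ (fun x => fderiv ℝ G x a) y b := by
  rw [fderiv_fderiv_apply h, fderiv_fderiv_apply h]
  exact h.isSymmSndFDerivAt (by simp) a b

lemma isHomogeneousNeg_clm_zpow (L : E →L[ℝ] ℂ) {m : ℤ} {N : ℝ} (hm : (m : ℝ) = -N) :
    IsHomogeneousNeg (fun y => L y ^ m) N := by
  intro r _ y _
  change L (r • y) ^ m = r ^ (-N) • L y ^ m
  rw [map_smul, Complex.real_smul, mul_zpow, Complex.real_smul, ← hm, Real.rpow_intCast,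
    Complex.ofReal_zpow]

lemma hasFDerivAt_clm_zpow (L : E →L[ℝ] ℂ) (m : ℤ) {y : E} (hy : L y ≠ 0) :
    HasFDerivAt (fun y => L y ^ m) ((m * L y ^ (m - 1)) • L) y := by
  refine (((hasDerivAt_zpow m (L y) (Or.inl hy)).hasFDerivAt.restrictScalars ℝ).comp y
    L.hasFDerivAt).congr_fderiv ?_
  ext v
  simp [mul_comm]

end SecondDerivative

variable [InnerProductSpace ℝ E]

lemma hasFDerivAt_add_norm_sq_rpow {y : E} (c a : ℝ) (hy : c + ‖y‖ ^ 2 ≠ 0) :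
    HasFDerivAt (fun x : E => (c + ‖x‖ ^ 2) ^ a)
      ((2 * a * (c + ‖y‖ ^ 2) ^ (a - 1)) • innerSL ℝ y) y := by
  refine (((hasStrictFDerivAt_norm_sq y).hasFDerivAt.const_add c).rpow_const (p := a)
    (Or.inl hy)).congr_fderiv ?_
  ext v
  simp
  ring

variable [FiniteDimensional ℝ E] [NormedAddCommGroup W] [NormedSpace ℝ W]

lemma laplacian_eq_sum_fderiv_fderiv {ι : Type*} [Fintype ι] (v : OrthonormalBasis ι ℝ E)
    (G : E → W) (y : E) : Δ G y = ∑ i, fderiv ℝ (fderiv ℝ G) y (v i) (v i) := by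
  simp [laplacian_eq_iteratedFDeriv_orthonormalBasis G v, iteratedFDeriv_two_apply]

lemma laplacian_fderiv_apply {G : E → W} {y : E} (h : ContDiffAt ℝ 3 G y) (a : E) :
    Δ (fun x => fderiv ℝ G x a) y = fderiv ℝ (Δ G) y a := by
  set v := stdOrthonormalBasis ℝ E
  have contDiffAt_two : ∀ᶠ x in 𝓝 y, ContDiffAt ℝ 2 G x :=
    (h.eventually (by simp)).mono fun x hx => hx.of_le (by norm_num)
  have contDiffAt_fderiv (b : E) : ContDiffAt ℝ 2 (fun x => fderiv ℝ G x b) y :=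
    (h.fderiv_right (m := 2) (by norm_num)).clm_apply contDiffAt_const
  have commute (b : E) : fderiv ℝ (fderiv ℝ fun x => fderiv ℝ G x a) y b b =
      fderiv ℝ (fun x => fderiv ℝ (fun z => fderiv ℝ G z b) x b) y a := by
    have eventually_comm : (fun x => fderiv ℝ (fun z => fderiv ℝ G z a) x b) =ᶠ[𝓝 y]
        fun x => fderiv ℝ (fun z => fderiv ℝ G z b) x a :=
      contDiffAt_two.mono fun x hx => fderiv_fderiv_apply_comm hx b a
    rw [← fderiv_fderiv_apply (contDiffAt_fderiv a), eventually_comm.fderiv_eq,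
      fderiv_fderiv_apply_comm (contDiffAt_fderiv b)]
  have laplacian_eq : Δ G =ᶠ[𝓝 y]
      fun x => ∑ i, fderiv ℝ (fun z => fderiv ℝ G z (v i)) x (v i) := by
    filter_upwards [contDiffAt_two] with x hx
    rw [laplacian_eq_sum_fderiv_fderiv v]
    exact Finset.sum_congr rfl fun i _ => (fderiv_fderiv_apply hx _ _).symm
  rw [laplacian_eq_sum_fderiv_fderiv v, laplacian_eq.fderiv_eq, fderiv_fun_sum fun i _ =>
    (((contDiffAt_fderiv (v i)).fderiv_right (m := 1) (by norm_num)).clm_apply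
      contDiffAt_const).differentiableAt (by norm_num), sum_apply]
  exact Finset.sum_congr rfl fun i _ => commute (v i)

lemma harmonicAt_fderiv_apply {G : E → W} {y : E} (h : HarmonicAt G y) (hG : ContDiffAt ℝ 3 G y)
    (a : E) : HarmonicAt (fun x => fderiv ℝ G x a) y := by
  refine ⟨(hG.fderiv_right (m := 2) (by norm_num)).clm_apply contDiffAt_const, ?_⟩
  filter_upwards [h.2.eventually_nhds, hG.eventually (by simp)] with x hx hGx
  rw [laplacian_fderiv_apply hGx, EventuallyEq.fderiv_eq hx]
  simp

lemma laplacian_add_norm_sq_rpow (c a : ℝ) {y : E} (hy : c + ‖y‖ ^ 2 ≠ 0) :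
    Δ (fun x : E => (c + ‖x‖ ^ 2) ^ a) y =
      2 * a * Module.finrank ℝ E * (c + ‖y‖ ^ 2) ^ (a - 1) +
        4 * a * (a - 1) * ‖y‖ ^ 2 * (c + ‖y‖ ^ 2) ^ (a - 2) := by
  have fderiv_eq : fderiv ℝ (fun x : E => (c + ‖x‖ ^ 2) ^ a) =ᶠ[𝓝 y]
      fun x => (2 * a * (c + ‖x‖ ^ 2) ^ (a - 1)) • innerSL ℝ x := by
    filter_upwards [eventually_add_norm_sq_ne_zero hy] with x hx
      using (hasFDerivAt_add_norm_sq_rpow c a hx).fderiv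
  have hasFDerivAt_fderiv :=
    ((hasFDerivAt_add_norm_sq_rpow c (a - 1) hy).const_mul (2 * a)).fun_smul
      (innerSL ℝ (E := E)).hasFDerivAt
  have second_derivative (v : E) : fderiv ℝ (fderiv ℝ fun x : E => (c + ‖x‖ ^ 2) ^ a) y v v =
      2 * a * (c + ‖y‖ ^ 2) ^ (a - 1) * ‖v‖ ^ 2 +
        4 * a * (a - 1) * (c + ‖y‖ ^ 2) ^ (a - 2) * inner ℝ y v ^ 2 := by
    rw [fderiv_eq.fderiv_eq, hasFDerivAt_fderiv.fderiv]
    change 2 * a * (c + ‖y‖ ^ 2) ^ (a - 1) * inner ℝ v v +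
      2 * a * (2 * (a - 1) * (c + ‖y‖ ^ 2) ^ (a - 1 - 1) * inner ℝ y v) * inner ℝ y v = _
    rw [real_inner_self_eq_norm_sq, show a - 1 - 1 = a - 2 by ring]
    ring
  rw [laplacian_eq_sum_fderiv_fderiv (stdOrthonormalBasis ℝ E),
    Finset.sum_congr rfl fun i _ => second_derivative _, Finset.sum_add_distrib, ← Finset.mul_sum,
    ← Finset.mul_sum, OrthonormalBasis.sum_sq_inner_left]
  simp only [OrthonormalBasis.norm_eq_one, one_pow, Finset.sum_const, Finset.card_univ,
    Fintype.card_fin, nsmul_eq_mul, mul_one]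
  ring

lemma harmonicAt_norm_sq_rpow {ν : ℝ} (hν : 2 * ν + 2 = Module.finrank ℝ E) {y : E} (hy : y ≠ 0) :
    HarmonicAt (fun x : E => (0 + ‖x‖ ^ 2) ^ (-ν)) y := by
  have norm_sq_ne_zero {x : E} (hx : x ≠ 0) : 0 + ‖x‖ ^ 2 ≠ 0 := by simpa using hx
  refine ⟨ContDiffAt.rpow_const_of_ne (contDiffAt_const.add (contDiff_norm_sq ℝ).contDiffAt)
    (norm_sq_ne_zero hy), ?_⟩
  filter_upwards [eventually_ne_zero hy] with x hx
  rw [laplacian_add_norm_sq_rpow 0 _ (norm_sq_ne_zero hx), ← hν,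
    show -ν - 2 = -ν - 1 - 1 by ring, Real.rpow_sub_one (norm_sq_ne_zero hx) (-ν - 1), zero_add,
    Pi.zero_apply]
  have := norm_ne_zero_iff.2 hx
  field_simp
  ring

lemma laplacian_clm_zpow (L : E →L[ℝ] ℂ) {ι : Type*} [Fintype ι] (v : OrthonormalBasis ι ℝ E)
    (m : ℤ) {y : E} (hy : L y ≠ 0) :
    Δ (fun y => L y ^ m) y = m * (m - 1) * L y ^ (m - 1 - 1) * ∑ i, L (v i) ^ 2 := by
  have fderiv_eq : fderiv ℝ (fun y => L y ^ m) =ᶠ[𝓝 y] fun x => (m * L x ^ (m - 1)) • L := by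
    filter_upwards [L.continuous.continuousAt.eventually_ne hy] with x hx
      using (hasFDerivAt_clm_zpow L m hx).fderiv
  have hasFDerivAt_fderiv := ((hasFDerivAt_clm_zpow L (m - 1) hy).const_mul (m : ℂ)).smul_const L
  rw [laplacian_eq_sum_fderiv_fderiv v, fderiv_eq.fderiv_eq, hasFDerivAt_fderiv.fderiv,
    Finset.mul_sum]
  refine Finset.sum_congr rfl fun i _ => ?_
  simp
  ring

lemma harmonicAt_clm_zpow (L : E →L[ℝ] ℂ) {ι : Type*} [Fintype ι] (v : OrthonormalBasis ι ℝ E)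
    (hL : ∑ i, L (v i) ^ 2 = 0) (m : ℤ) {y : E} (hy : L y ≠ 0) :
    HarmonicAt (fun y => L y ^ m) y := by
  refine ⟨?_, ?_⟩
  · have contDiffAt_zpow : ContDiffAt ℂ 2 (fun z : ℂ => z ^ m) (L y) := by
      rcases m with m | m
      · simpa using contDiffAt_id.pow m
      · simp only [zpow_negSucc]
        exact (contDiffAt_id.pow (m + 1)).inv (pow_ne_zero _ hy)
    exact (contDiffAt_zpow.restrict_scalars ℝ).comp y L.contDiff.contDiffAt
  · filter_upwards [L.continuous.continuousAt.eventually_ne hy] with x hx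
    rw [laplacian_clm_zpow L v m hx, hL, mul_zero, Pi.zero_apply]

end Harmonic

section Kelvin

variable {κ : Type*} [Fintype κ]

lemma contDiff_gegenbauer (ν : ℝ) (n : ℕ) : ContDiff ℝ ∞ (gegenbauer ν n) := by
  induction n using Nat.twoStepInduction with
  | zero => exact contDiff_const
  | one => exact contDiff_const.mul contDiff_id
  | more n ih ih' =>
    exact (((contDiff_const.mul contDiff_id).mul ih').sub (contDiff_const.mul ih)).div_const _

/-- The zonal function `y ↦ ‖y‖⁻ⁿ⁻²ᵛ Cₙ⁽ᵛ⁾(yₗ / ‖y‖)` with axis `l`. When `2ν + 2` is the dimension,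
it is the Kelvin transform of the zonal harmonic polynomial of degree `n`. -/
noncomputable def kelvin (ν : ℝ) (l : κ) (n : ℕ) (y : EuclideanSpace ℝ κ) : ℝ :=
  gegenbauer ν n (y l / ‖y‖) * ‖y‖ ^ (-((n : ℝ) + 2 * ν))

variable (ν : ℝ) (l : κ)

lemma kelvin_zero : kelvin ν l 0 = fun y => (0 + ‖y‖ ^ 2) ^ (-ν) := by
  ext y
  rw [kelvin, gegenbauer, zero_add, one_mul, ← Real.rpow_natCast, ← Real.rpow_mul (norm_nonneg _)]
  congr 1
  push_cast; ring

lemma norm_sq_mul_kelvin_one {y : EuclideanSpace ℝ κ} (hy : y ≠ 0) :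
    ‖y‖ ^ 2 * kelvin ν l 1 y = 2 * ν * (y l * kelvin ν l 0 y) := by
  have norm_pos : 0 < ‖y‖ := norm_pos_iff.2 hy
  simp only [kelvin, gegenbauer]
  rw [show -(((1 : ℕ) : ℝ) + 2 * ν) = -(((0 : ℕ) : ℝ) + 2 * ν) - 1 by push_cast; ring,
    Real.rpow_sub_one norm_pos.ne']
  field_simp

lemma norm_sq_mul_kelvin_add_two (n : ℕ) {y : EuclideanSpace ℝ κ} (hy : y ≠ 0) :
    ‖y‖ ^ 2 * kelvin ν l (n + 2) y =
      (2 * (n + 1 + ν) / (n + 2)) * (y l * kelvin ν l (n + 1) y) -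
        ((n + 2 * ν) / (n + 2)) * kelvin ν l n y := by
  have norm_pos : 0 < ‖y‖ := norm_pos_iff.2 hy
  simp only [kelvin, gegenbauer]
  rw [show -(((n + 2 : ℕ) : ℝ) + 2 * ν) = -((n : ℝ) + 2 * ν) - 1 - 1 by push_cast; ring,
    show -(((n + 1 : ℕ) : ℝ) + 2 * ν) = -((n : ℝ) + 2 * ν) - 1 by push_cast; ring,
    Real.rpow_sub_one norm_pos.ne', Real.rpow_sub_one norm_pos.ne']
  field_simp

lemma isHomogeneousNeg_kelvin (n : ℕ) : IsHomogeneousNeg (kelvin ν l n) (n + 2 * ν) := by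
  intro r hr y _
  simp only [kelvin, norm_smul, Real.norm_of_nonneg hr.le, PiLp.smul_apply, smul_eq_mul]
  rw [mul_div_mul_left _ _ hr.ne', Real.mul_rpow hr.le (norm_nonneg _)]
  ring

lemma contDiffAt_kelvin (n : ℕ) {y : EuclideanSpace ℝ κ} (hy : y ≠ 0) :
    ContDiffAt ℝ ∞ (kelvin ν l n) y := by
  have norm_ne_zero : ‖y‖ ≠ 0 := norm_ne_zero_iff.2 hy
  have contDiffAt_norm : ContDiffAt ℝ ∞ (fun x : EuclideanSpace ℝ κ => ‖x‖) y :=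
    contDiffAt_id.norm ℝ hy
  have contDiffAt_coord : ContDiffAt ℝ ∞ (fun x : EuclideanSpace ℝ κ => x l) y :=
    (EuclideanSpace.proj l : EuclideanSpace ℝ κ →L[ℝ] ℝ).contDiff.contDiffAt
  exact ((contDiff_gegenbauer ν n).contDiffAt.comp y
    (contDiffAt_coord.div contDiffAt_norm norm_ne_zero)).mul
    (contDiffAt_norm.rpow_const_of_ne norm_ne_zero)

lemma differentiableAt_kelvin (n : ℕ) {y : EuclideanSpace ℝ κ} (hy : y ≠ 0) :
    DifferentiableAt ℝ (kelvin ν l n) y :=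
  (contDiffAt_kelvin ν l n hy).differentiableAt (by simp)

section Derivatives

variable [DecidableEq κ] {G : EuclideanSpace ℝ κ → ℝ} {y : EuclideanSpace ℝ κ}

lemma fderiv_norm_sq_mul (h : DifferentiableAt ℝ G y) :
    fderiv ℝ (fun x => ‖x‖ ^ 2 * G x) y (EuclideanSpace.single l 1) =
      ‖y‖ ^ 2 * fderiv ℝ G y (EuclideanSpace.single l 1) + 2 * y l * G y := by
  rw [((hasStrictFDerivAt_norm_sq y).hasFDerivAt.fun_mul h.hasFDerivAt).fderiv]
  simp [EuclideanSpace.inner_single_right]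
  ring

omit [Fintype κ] in
lemma fderiv_const_mul_coord_mul [Finite κ] (c : ℝ) (h : DifferentiableAt ℝ G y) :
    fderiv ℝ (fun x => c * (x l * G x)) y (EuclideanSpace.single l 1) =
      c * (y l * fderiv ℝ G y (EuclideanSpace.single l 1) + G y) := by
  have := Fintype.ofFinite κ
  have hasFDerivAt_coord : HasFDerivAt (fun x : EuclideanSpace ℝ κ => x l)
      (EuclideanSpace.proj l : EuclideanSpace ℝ κ →L[ℝ] ℝ) y :=
    (EuclideanSpace.proj l : EuclideanSpace ℝ κ →L[ℝ] ℝ).hasFDerivAt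
  rw [((hasFDerivAt_coord.fun_mul h.hasFDerivAt).const_mul c).fderiv]
  simp [mul_add]

lemma fderiv_kelvin_zero (hy : y ≠ 0) :
    fderiv ℝ (kelvin ν l 0) y (EuclideanSpace.single l 1) = -kelvin ν l 1 y := by
  have norm_sq_ne_zero : ‖y‖ ^ 2 ≠ 0 := by simpa using hy
  have recurrence := norm_sq_mul_kelvin_one ν l hy
  rw [← mul_right_inj' norm_sq_ne_zero, mul_neg, recurrence, kelvin_zero,
    (hasFDerivAt_add_norm_sq_rpow 0 (-ν) (by simpa using hy)).fderiv,
    Real.rpow_sub_one (by simpa using hy)]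
  simp only [zero_add, _root_.smul_apply, innerSL_apply_apply, EuclideanSpace.inner_single_right,
    smul_eq_mul, one_mul, conj_trivial]
  field_simp

lemma fderiv_kelvin_one (hy : y ≠ 0) :
    fderiv ℝ (kelvin ν l 1) y (EuclideanSpace.single l 1) = -2 * kelvin ν l 2 y := by
  have norm_sq_ne_zero : ‖y‖ ^ 2 ≠ 0 := by simpa using hy
  have recurrence : (fun x => ‖x‖ ^ 2 * kelvin ν l 1 x) =ᶠ[𝓝 y]
      fun x => 2 * ν * (x l * kelvin ν l 0 x) :=
    (eventually_ne_zero hy).mono fun x hx => norm_sq_mul_kelvin_one ν l hx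
  have differentiated := congrArg (· (EuclideanSpace.single l 1)) (recurrence.fderiv_eq (𝕜 := ℝ))
  beta_reduce at differentiated
  rw [fderiv_norm_sq_mul l (differentiableAt_kelvin ν l 1 hy),
    fderiv_const_mul_coord_mul l _ (differentiableAt_kelvin ν l 0 hy),
    fderiv_kelvin_zero ν l hy] at differentiated
  have next := norm_sq_mul_kelvin_add_two ν l 0 hy
  rw [← mul_right_inj' norm_sq_ne_zero]
  simp only [CharP.cast_eq_zero, zero_add] at next
  linear_combination differentiated + 2 * next

lemma fderiv_kelvin_add_two (n : ℕ) (hy : y ≠ 0)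
    (ih : fderiv ℝ (kelvin ν l n) y (EuclideanSpace.single l 1) = -(n + 1) * kelvin ν l (n + 1) y)
    (ih' : fderiv ℝ (kelvin ν l (n + 1)) y (EuclideanSpace.single l 1) =
      -(n + 2) * kelvin ν l (n + 2) y) :
    fderiv ℝ (kelvin ν l (n + 2)) y (EuclideanSpace.single l 1) =
      -(n + 3) * kelvin ν l (n + 3) y := by
  have norm_sq_ne_zero : ‖y‖ ^ 2 ≠ 0 := by simpa using hy
  have recurrence : (fun x => ‖x‖ ^ 2 * kelvin ν l (n + 2) x) =ᶠ[𝓝 y] fun x =>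
      (2 * (n + 1 + ν) / (n + 2)) * (x l * kelvin ν l (n + 1) x) -
        ((n + 2 * ν) / (n + 2)) * kelvin ν l n x :=
    (eventually_ne_zero hy).mono fun x hx => norm_sq_mul_kelvin_add_two ν l n hx
  have differentiableAt_coord_mul : DifferentiableAt ℝ
      (fun x : EuclideanSpace ℝ κ => x l * kelvin ν l (n + 1) x) y :=
    (EuclideanSpace.proj l : EuclideanSpace ℝ κ →L[ℝ] ℝ).differentiableAt.fun_mul
      (differentiableAt_kelvin ν l (n + 1) hy)
  have differentiated := congrArg (· (EuclideanSpace.single l 1)) (recurrence.fderiv_eq (𝕜 := ℝ))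
  beta_reduce at differentiated
  rw [fderiv_norm_sq_mul l (differentiableAt_kelvin ν l (n + 2) hy),
    fderiv_fun_sub (differentiableAt_coord_mul.const_mul _)
      ((differentiableAt_kelvin ν l n hy).const_mul _), _root_.sub_apply,
    fderiv_const_mul_coord_mul l _ (differentiableAt_kelvin ν l (n + 1) hy),
    fderiv_const_mul (differentiableAt_kelvin ν l n hy), _root_.smul_apply, ih, ih',
    smul_eq_mul] at differentiated
  have next := norm_sq_mul_kelvin_add_two ν l (n + 1) hy
  push_cast at next
  have add_two_ne_zero : (n : ℝ) + 2 ≠ 0 := by positivity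
  have : (n : ℝ) + 1 + 2 ≠ 0 := by positivity
  field_simp at differentiated next
  rw [← mul_right_inj' norm_sq_ne_zero, ← mul_right_inj' add_two_ne_zero]
  linear_combination differentiated + (n + 2) * next

lemma fderiv_kelvin (n : ℕ) (hy : y ≠ 0) :
    fderiv ℝ (kelvin ν l n) y (EuclideanSpace.single l 1) = -(n + 1) * kelvin ν l (n + 1) y := by
  induction n using Nat.twoStepInduction with
  | zero => simpa using fderiv_kelvin_zero ν l hy
  | one => simpa [one_add_one_eq_two] using fderiv_kelvin_one ν l hy
  | more n ih ih' =>
    have := fderiv_kelvin_add_two ν l n hy ih (by rw [ih']; push_cast; ring)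
    rw [this]
    push_cast
    ring

end Derivatives

lemma harmonicAt_kelvin {ν : ℝ} (hν : 2 * ν + 2 = Fintype.card κ) (n : ℕ)
    {y : EuclideanSpace ℝ κ} (hy : y ≠ 0) : HarmonicAt (kelvin ν l n) y := by
  classical
  induction n with
  | zero =>
    rw [kelvin_zero]
    exact harmonicAt_norm_sq_rpow (by rw [hν, finrank_euclideanSpace]) hy
  | succ n ih =>
    have eq_fderiv : kelvin ν l (n + 1) =ᶠ[𝓝 y] (-((n : ℝ) + 1)⁻¹) •
        fun x => fderiv ℝ (kelvin ν l n) x (EuclideanSpace.single l 1) := by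
      filter_upwards [eventually_ne_zero hy] with x hx
      rw [Pi.smul_apply, fderiv_kelvin ν l n hx, smul_eq_mul]
      field_simp
    rw [harmonicAt_congr_nhds eq_fderiv]
    exact (harmonicAt_fderiv_apply ih
      (contDiffAt_infty.1 (contDiffAt_kelvin ν l n hy) 3) _).const_smul

end Kelvin

/-! ### Homogeneous harmonic functions along the orbits -/

section Frame

variable (p q : ℕ)

/-- The part `∂u/∂w_j` of the derivative of `orbitPoint` in the direction `w_j`. -/
noncomputable def uVec (j : Fin (max (p - 1) q)) : Idx p q → ℝ :=
  Sum.elim (Sum.elim 0 (uPart p q (Pi.single j 1))) 0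

/-- The part `∂v/∂w_j` of the derivative of `orbitPoint` in the direction `w_j`, up to sign. -/
noncomputable def vVec (j : Fin (max (p - 1) q)) : Idx p q → ℝ :=
  Sum.elim 0 (Sum.elim (vPart p q (Pi.single j 1)) 0)

lemma uVec_castLE (i : Fin (p - 1)) :
    uVec p q (Fin.castLE (le_max_left _ _) i) = Pi.single (Sum.inl (Sum.inr i)) 1 := by
  ext ((k | k) | (k | k)) <;> simp [uVec, uPart, Pi.single_apply]

lemma vVec_castLE (i : Fin q) :
    vVec p q (Fin.castLE (le_max_right _ _) i) = Pi.single (Sum.inr (Sum.inl i.rev)) 1 := by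
  ext ((k | k) | (k | k)) <;> simp [vVec, vPart, Pi.single_apply, Fin.rev_eq_iff]

lemma uVec_eq_zero {j : Fin (max (p - 1) q)} (h : ¬(j : ℕ) < p - 1) : uVec p q j = 0 := by
  have uPart_eq_zero : uPart p q (Pi.single j 1) = 0 :=
    funext fun k => Pi.single_eq_of_ne (fun hk => h (by simp [← hk])) 1
  rw [uVec, uPart_eq_zero, Sum.elim_zero_zero, Sum.elim_zero_zero]

lemma vVec_eq_zero {j : Fin (max (p - 1) q)} (h : ¬(j : ℕ) < q) : vVec p q j = 0 := by
  have vPart_eq_zero : vPart p q (Pi.single j 1) = 0 :=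
    funext fun k => Pi.single_eq_of_ne (fun hk => h (by simpa [← hk] using k.rev.2)) 1
  rw [vVec, vPart_eq_zero, Sum.elim_zero_zero, Sum.elim_zero_zero]

/-- The null vector `e_{p+q+1} + e_1`, which is fixed by `N`. -/
noncomputable def nullVec : Idx p q → ℝ :=
  Pi.single (Sum.inr (Sum.inr ())) 1 + Pi.single (Sum.inl (Sum.inl ())) 1

/-- The null vector `e_{p+q+1} - e_1`. -/
noncomputable def oppositeNullVec : Idx p q → ℝ :=
  Pi.single (Sum.inr (Sum.inr ())) 1 - Pi.single (Sum.inl (Sum.inl ())) 1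

lemma orbitPoint_eq (ε : ℝ) (w : Fin (max (p - 1) q) → ℝ) :
    orbitPoint p q ε w = (1 / 2 : ℝ) • oppositeNullVec p q +
      ((ε + ∑ j, signCoef p q j * w j ^ 2) / 2) • nullVec p q +
      ∑ j, w j • (uVec p q j - vVec p q j) := by
  have sum_mul_uPart (i) : ∑ j, w j * uPart p q (Pi.single j 1) i = uPart p q w i := by
    simp [uPart, Pi.single_apply]
  have sum_mul_vPart (i) : ∑ j, w j * vPart p q (Pi.single j 1) i = vPart p q w i := by
    simp [vPart, Pi.single_apply]
  ext ((k | k) | (k | k)) <;>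
    simp [orbitPoint, nullVec, oppositeNullVec, uVec, vVec, Finset.sum_apply, sum_mul_uPart,
      sum_mul_vPart] <;> ring

lemma signCoef_smul (j : Fin (max (p - 1) q)) :
    signCoef p q j • (uVec p q j + vVec p q j) =
      signCoef p q j ^ 2 • (uVec p q j - vVec p q j) := by
  by_cases hu : (j : ℕ) < p - 1 <;> by_cases hv : (j : ℕ) < q <;>
    simp [signCoef, hu, hv, uVec_eq_zero, vVec_eq_zero]

variable {p q}

section Translate

/-- The last `q + 1` coordinates of `g x`, as a linear function of `x`. -/
noncomputable def translate (g : Mat p q) : (Idx p q → ℝ) →ₗ[ℝ] EuclideanSpace ℝ (Fin q ⊕ Unit) :=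
  negPart p q ∘ₗ g.mulVecLin

lemma translate_single (g : Mat p q) (b : Idx p q) :
    translate g (Pi.single b 1) = ∑ k, g (Sum.inr k) b • EuclideanSpace.single k (1 : ℝ) := by
  ext k
  have coord : translate g (Pi.single b 1) k = g (Sum.inr k) b := by
    change (g *ᵥ Pi.single b 1) (Sum.inr k) = _
    simp
  rw [coord]
  simp only [WithLp.ofLp_sum, Finset.sum_apply, PiLp.smul_apply, PiLp.single_apply,
    smul_eq_mul, mul_ite, mul_one, mul_zero, Finset.sum_ite_eq, Finset.mem_univ, if_true]

variable {g : Mat p q} {W : Type*} [NormedAddCommGroup W] [NormedSpace ℝ W]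

lemma sum_formSign_mul_mul (hg : gᵀ * form p q * g = form p q) (k l : Fin q ⊕ Unit) :
    ∑ b, formSign p q b * (g (Sum.inr k) b * g (Sum.inr l) b) = if k = l then -1 else 0 := by
  have entry := congrFun (congrFun (mul_form_mul_transpose hg) (Sum.inr k)) (Sum.inr l)
  rw [form_eq, Matrix.mul_apply] at entry
  simp only [Matrix.mul_diagonal, Matrix.transpose_apply, Matrix.diagonal_apply, Sum.inr.injEq,
    formSign, Sum.elim_inr] at entry
  rw [← entry]
  refine Finset.sum_congr rfl fun b _ => ?_
  simp only [formSign]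
  ring

variable (B : EuclideanSpace ℝ (Fin q ⊕ Unit) →L[ℝ] EuclideanSpace ℝ (Fin q ⊕ Unit) →L[ℝ] W)

lemma sum_formSign_bilinear (hg : gᵀ * form p q * g = form p q) :
    ∑ b, formSign p q b • B (translate g (Pi.single b 1)) (translate g (Pi.single b 1)) =
      -∑ k, B (EuclideanSpace.single k 1) (EuclideanSpace.single k 1) :=
  calc
    _ = ∑ b, ∑ k, ∑ l, (formSign p q b * (g (Sum.inr k) b * g (Sum.inr l) b)) •
        B (EuclideanSpace.single k 1) (EuclideanSpace.single l 1) := by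
      refine Finset.sum_congr rfl fun b _ => ?_
      rw [translate_single]
      simp only [map_sum, map_smul, _root_.sum_apply, _root_.smul_apply, Finset.smul_sum,
        smul_smul]
      rw [Finset.sum_comm]
      refine Finset.sum_congr rfl fun k _ => Finset.sum_congr rfl fun l _ => ?_
      congr 1; ring
    _ = ∑ k, ∑ l, (∑ b, formSign p q b * (g (Sum.inr k) b * g (Sum.inr l) b)) •
        B (EuclideanSpace.single k 1) (EuclideanSpace.single l 1) := by
      rw [Finset.sum_comm]
      refine Finset.sum_congr rfl fun k _ => ?_
      rw [Finset.sum_comm]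
      simp only [Finset.sum_smul]
    _ = _ := by
      simp_rw [sum_formSign_mul_mul hg]
      simp [Finset.sum_neg_distrib]

lemma sum_bilinear_uVec :
    ∑ j, B (translate g (uVec p q j)) (translate g (uVec p q j)) =
      ∑ i : Fin (p - 1), B (translate g (Pi.single (Sum.inl (Sum.inr i)) 1))
        (translate g (Pi.single (Sum.inl (Sum.inr i)) 1)) := by
  simp_rw [← uVec_castLE]
  rw [← sum_ite_lt_eq_sum_castLE (le_max_left _ _)
    fun j => B (translate g (uVec p q j)) (translate g (uVec p q j))]
  refine Finset.sum_congr rfl fun j _ => ?_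
  split_ifs with hj
  · rfl
  · simp [uVec_eq_zero p q hj]

lemma sum_bilinear_vVec :
    ∑ j, B (translate g (vVec p q j)) (translate g (vVec p q j)) =
      ∑ i : Fin q, B (translate g (Pi.single (Sum.inr (Sum.inl i)) 1))
        (translate g (Pi.single (Sum.inr (Sum.inl i)) 1)) := by
  rw [← Equiv.sum_comp Fin.revPerm fun i : Fin q =>
    B (translate g (Pi.single (Sum.inr (Sum.inl i)) 1))
      (translate g (Pi.single (Sum.inr (Sum.inl i)) 1))]
  simp_rw [Fin.revPerm_apply, ← vVec_castLE]
  rw [← sum_ite_lt_eq_sum_castLE (le_max_right _ _)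
    fun j => B (translate g (vVec p q j)) (translate g (vVec p q j))]
  refine Finset.sum_congr rfl fun j _ => ?_
  split_ifs with hj
  · rfl
  · simp [vVec_eq_zero p q hj]

lemma bilinear_nullVec_oppositeNullVec (hg : gᵀ * form p q * g = form p q)
    (hsymm : ∀ a b, B a b = B b a)
    (hB : ∑ k, B (EuclideanSpace.single k 1) (EuclideanSpace.single k 1) = 0) :
    B (translate g (nullVec p q)) (translate g (oppositeNullVec p q)) =
      ∑ j, B (translate g (uVec p q j - vVec p q j)) (translate g (uVec p q j + vVec p q j)) := by
  have contraction := sum_formSign_bilinear B hg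
  simp only [hB, Fintype.sum_sum_type, formSign, Sum.elim_inl, Sum.elim_inr, one_smul, neg_smul,
    Finset.univ_unique, Finset.sum_singleton, Finset.sum_neg_distrib, ← sum_bilinear_uVec,
    ← sum_bilinear_vVec, neg_zero, PUnit.default_eq_unit] at contraction
  have expand (j) :
      B (translate g (uVec p q j - vVec p q j)) (translate g (uVec p q j + vVec p q j)) =
        B (translate g (uVec p q j)) (translate g (uVec p q j)) -
          B (translate g (vVec p q j)) (translate g (vVec p q j)) := by
    simp only [map_sub, map_add, _root_.sub_apply]
    rw [hsymm (translate g (vVec p q j)) (translate g (uVec p q j))]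
    abel
  rw [Finset.sum_congr rfl fun j _ => expand j, Finset.sum_sub_distrib, nullVec, oppositeNullVec]
  simp only [map_sub, map_add, _root_.add_apply]
  rw [hsymm (translate g (Pi.single (Sum.inl (Sum.inl ())) 1)), ← sub_eq_zero, ← neg_eq_zero,
    ← contraction]
  abel

end Translate

section Family

variable {g : Mat p q} (hg : gᵀ * form p q * g = form p q)

/-- The paraboloids formed by the last `q + 1` coordinates of the orbits of `N^*` translated
by `g`. -/
noncomputable def orbitFamily :
    ParaboloidFamily (Fin (max (p - 1) q)) (EuclideanSpace ℝ (Fin q ⊕ Unit)) where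
  coeff := signCoef p q
  axis := translate g (nullVec p q)
  vertex := translate g (oppositeNullVec p q)
  chord j := translate g (uVec p q j - vVec p q j)
  conj j := translate g (uVec p q j + vVec p q j)
  lowerConst := (exists_mul_orbitWeight_le_norm_negPart hg).choose
  lowerConst_pos := (exists_mul_orbitWeight_le_norm_negPart hg).choose_spec.1
  coeff_cube := signCoef_cube p q
  coeff_sign := signCoef_sign p q
  coeff_smul_conj j := by rw [← map_smul, ← map_smul, signCoef_smul]
  lowerConst_mul_le ε w hε := by
    simp only [← map_smul, ← map_sum, ← map_add, ← orbitPoint_eq]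
    exact (exists_mul_orbitWeight_le_norm_negPart hg).choose_spec.2 ε w hε

lemma orbitFamily_point (ε : ℝ) (w : Fin (max (p - 1) q) → ℝ) :
    (orbitFamily hg).point ε w = negPart p q (g *ᵥ orbitPoint p q ε w) := by
  change _ = translate g _
  rw [orbitPoint_eq, map_add, map_add, map_sum]
  simp only [map_smul]
  rfl

lemma isWaveFunction_orbitFamily {W : Type*} [NormedAddCommGroup W] [NormedSpace ℝ W]
    {F : EuclideanSpace ℝ (Fin q ⊕ Unit) → W} (hp : 1 ≤ p) {lam : ℝ}
    (hF : HarmonicOnNhd F {0}ᶜ) (hhom : IsHomogeneousNeg F (lam + rho p q)) :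
    (orbitFamily hg).IsWaveFunction lam F where
  contDiffAt y hy := (hF y hy).1
  homogeneous := by
    change IsHomogeneousNeg F (lam + ∑ j, (1 - signCoef p q j ^ 2 / 2))
    rwa [sum_one_sub_signCoef_sq p q hp]
  wave y hy := by
    refine bilinear_nullVec_oppositeNullVec _ hg
      (fun a b => (hF y hy).1.isSymmSndFDerivAt (by simp) a b) ?_
    simpa [laplacian_eq_sum_fderiv_fderiv (EuclideanSpace.basisFun (Fin q ⊕ Unit) ℝ)]
      using (hF y hy).2.self_of_nhds

lemma isDecaying_orbitFamily (hp : 1 ≤ p) {lam : ℝ} (hmu : 0 < lam + ((p : ℝ) - q + 1) / 2) :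
    (orbitFamily hg).IsDecaying lam := by
  change (∀ j, 0 ≤ signCoef p q j) ∨
    (∀ j, signCoef p q j ≤ 0) ∧ 0 < lam + 1 - (∑ j, signCoef p q j ^ 2) / 2
  rcases le_total q (p - 1) with h | h
  · refine Or.inl fun j => ?_
    unfold signCoef; split_ifs <;> first | omega | norm_num
  · refine Or.inr ⟨fun j => ?_, ?_⟩
    · unfold signCoef; split_ifs <;> first | omega | norm_num
    · rw [sum_signCoef_sq p q hp, max_eq_right h, rho]
      linarith

include hg in
theorem radon_eq_zero_of_harmonicOnNhd (hp : 1 ≤ p) (hq : 1 ≤ q) {lam : ℝ} (hlam : 0 < lam)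
    (hmu : 0 < lam + ((p : ℝ) - q + 1) / 2) {F : EuclideanSpace ℝ (Fin q ⊕ Unit) → ℂ}
    (hF : HarmonicOnNhd F {0}ᶜ) (hhom : IsHomogeneousNeg F (lam + rho p q))
    {f : (Idx p q → ℝ) → ℂ} (hf : ∀ x, negPart p q x ≠ 0 → f x = F (negPart p q x)) :
    RadonConverges p q f g ∧ radon p q f g = 0 := by
  have : Nonempty (Fin (max (p - 1) q)) := ⟨⟨0, by omega⟩⟩
  have wave := isWaveFunction_orbitFamily hg hp hF hhom
  have eq_point (w) : f ((g * nStar p q w) *ᵥ basePoint p q) = F ((orbitFamily hg).point 1 w) := by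
    rw [mul_nStar_mulVec_basePoint, orbitFamily_point, hf]
    rw [← orbitFamily_point hg]
    exact (orbitFamily hg).point_ne_zero zero_le_one w
  simp only [RadonConverges, radon, eq_point]
  exact ⟨wave.integrable hlam zero_le_one,
    wave.integral_eq_zero hlam (isDecaying_orbitFamily hg hp hmu) one_pos⟩

end Family

end Frame

section Vanishing

lemma preserves_form_of_mem_groupG {p q : ℕ} {g : Mat p q} (hg : g ∈ groupG p q) :
    gᵀ * form p q * g = form p q :=
  (connectedComponentIn_subset _ _ hg).1

section Plane

/-- The coordinate `x_{p+q+1} + σ i x_{p+1}` on the plane of the last `q + 1 = 2` coordinates; it is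
complex if `σ = 1` and conjugate complex if `σ = -1`. -/
noncomputable def planeCoord (σ : ℝ) : EuclideanSpace ℝ (Fin 1 ⊕ Unit) →L[ℝ] ℂ :=
  Complex.ofRealCLM.comp (EuclideanSpace.proj (Sum.inr ())) +
    ((σ : ℂ) * Complex.I) • Complex.ofRealCLM.comp (EuclideanSpace.proj (Sum.inl 0))

lemma planeCoord_apply (σ : ℝ) (y : EuclideanSpace ℝ (Fin 1 ⊕ Unit)) :
    planeCoord σ y = (y (Sum.inr ()) : ℂ) + σ * Complex.I * (y (Sum.inl 0) : ℂ) := by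
  simp [planeCoord]

lemma planeCoord_ne_zero {σ : ℝ} (hσ : σ ≠ 0) {y : EuclideanSpace ℝ (Fin 1 ⊕ Unit)} (hy : y ≠ 0) :
    planeCoord σ y ≠ 0 := by
  contrapose! hy
  rw [planeCoord_apply] at hy
  have re_eq_zero : y (Sum.inr ()) = 0 := by simpa using congrArg Complex.re hy
  have im_eq_zero : y (Sum.inl 0) = 0 := by simpa [hσ] using congrArg Complex.im hy
  ext (k | _)
  · rw [Subsingleton.elim k 0, im_eq_zero]; rfl
  · exact re_eq_zero

lemma sum_planeCoord_sq {σ : ℝ} (hσ : σ ^ 2 = 1) :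
    ∑ k, planeCoord σ (EuclideanSpace.basisFun (Fin 1 ⊕ Unit) ℝ k) ^ 2 = 0 := by
  have hσ' : (σ : ℂ) ^ 2 = 1 := by exact_mod_cast hσ
  simp [planeCoord_apply, mul_pow, hσ']

lemma planeCoord_mul (y : EuclideanSpace ℝ (Fin 1 ⊕ Unit)) :
    planeCoord 1 y * planeCoord (-1) y = (‖y‖ : ℂ) ^ 2 := by
  have norm_sq : (‖y‖ : ℝ) ^ 2 = y (Sum.inr ()) ^ 2 + y (Sum.inl 0) ^ 2 := by
    rw [EuclideanSpace.norm_sq_eq]; simp [add_comm]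
  rw [planeCoord_apply, planeCoord_apply, ← Complex.ofReal_pow, norm_sq]
  push_cast
  linear_combination -(y (Sum.inl 0) : ℂ) ^ 2 * Complex.I_sq

lemma planeCoord_one_div_norm {y : EuclideanSpace ℝ (Fin 1 ⊕ Unit)} (hy : y ≠ 0) :
    planeCoord 1 y / ‖y‖ = ‖y‖ * (planeCoord (-1) y)⁻¹ := by
  have norm_ne_zero : (‖y‖ : ℂ) ≠ 0 := by exact_mod_cast norm_ne_zero_iff.2 hy
  have conj_ne_zero := planeCoord_ne_zero (σ := -1) (by norm_num) hy
  rw [(eq_div_iff conj_ne_zero).2 (planeCoord_mul y)]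
  field_simp

variable {p : ℕ} {lam : ℝ} {μ : ℤ}

lemma generatingFunction_one (x : Idx p 1 → ℝ) :
    generatingFunction p 1 lam μ x =
      (planeCoord 1 (negPart p 1 x) / ‖negPart p 1 x‖) ^ μ *
        ((‖negPart p 1 x‖ ^ (-|lam| - rho p 1) : ℝ) : ℂ) := by
  rw [generatingFunction, dif_pos rfl, ← norm_negPart, planeCoord_apply]
  congr 2
  rw [show lastCoord p 1 x = negPart p 1 x (Sum.inr ()) from rfl,
    show x (Sum.inr (Sum.inl ⟨0, by omega⟩)) = negPart p 1 x (Sum.inl 0) from rfl]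
  push_cast
  ring

lemma generatingFunction_one_of_neg (hlam : lam < 0) (hμ : (μ : ℝ) = muParam p 1 lam)
    {x : Idx p 1 → ℝ} (hx : negPart p 1 x ≠ 0) :
    generatingFunction p 1 lam μ x = planeCoord 1 (negPart p 1 x) ^ μ := by
  have norm_ne_zero : (‖negPart p 1 x‖ : ℂ) ≠ 0 := by exact_mod_cast norm_ne_zero_iff.2 hx
  rw [muParam, if_neg hlam.not_gt] at hμ
  rw [generatingFunction_one, show -|lam| - rho p 1 = μ by rw [hμ, abs_of_neg hlam]; ring,
    Real.rpow_intCast, Complex.ofReal_zpow, div_zpow,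
    div_mul_cancel₀ _ (zpow_ne_zero _ norm_ne_zero)]

lemma generatingFunction_one_of_pos (hlam : 0 < lam) (hμ : (μ : ℝ) = muParam p 1 lam)
    {x : Idx p 1 → ℝ} (hx : negPart p 1 x ≠ 0) :
    generatingFunction p 1 lam μ x = planeCoord (-1) (negPart p 1 x) ^ (-μ) := by
  have norm_ne_zero : (‖negPart p 1 x‖ : ℂ) ≠ 0 := by exact_mod_cast norm_ne_zero_iff.2 hx
  have exponent_eq : -|lam| - rho p 1 = ((-μ : ℤ) : ℝ) := by
    push_cast
    rw [hμ, muParam, if_pos hlam, rhoC, abs_of_pos hlam]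
    norm_num
    ring
  rw [generatingFunction_one, exponent_eq, Real.rpow_intCast, Complex.ofReal_zpow,
    planeCoord_one_div_norm hx, mul_zpow, inv_zpow', mul_right_comm, ← zpow_add₀ norm_ne_zero,
    add_neg_cancel, zpow_zero, one_mul]

lemma radon_eq_zero_of_eq_planeCoord_zpow (hp : 1 ≤ p) (hlam : 0 < lam) {g : Mat p 1}
    (hg : gᵀ * form p 1 * g = form p 1) {σ : ℝ} (hσ : σ ^ 2 = 1) {m : ℤ}
    (hm : (m : ℝ) = -(lam + rho p 1)) {f : (Idx p 1 → ℝ) → ℂ}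
    (hf : ∀ x, negPart p 1 x ≠ 0 → f x = planeCoord σ (negPart p 1 x) ^ m) :
    RadonConverges p 1 f g ∧ radon p 1 f g = 0 := by
  have hσ0 : σ ≠ 0 := by rintro rfl; norm_num at hσ
  have one_le_p : (1 : ℝ) ≤ p := by exact_mod_cast hp
  exact radon_eq_zero_of_harmonicOnNhd hg hp le_rfl hlam (by push_cast; linarith)
    (fun y hy => harmonicAt_clm_zpow (planeCoord σ) (EuclideanSpace.basisFun _ ℝ)
      (sum_planeCoord_sq hσ) m (planeCoord_ne_zero hσ0 hy))
    (isHomogeneousNeg_clm_zpow _ hm) hf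

theorem radon_generatingFunction_one_eq_zero (hp : 1 ≤ p) (hlam : lam ≠ 0)
    (hμ : (μ : ℝ) = muParam p 1 lam) {g : Mat p 1} (hg : gᵀ * form p 1 * g = form p 1) :
    RadonConverges p 1 (generatingFunction p 1 lam μ) g ∧
      radon p 1 (generatingFunction p 1 lam μ) g = 0 := by
  have abs_pos := abs_pos.2 hlam
  rcases lt_or_gt_of_ne hlam with hneg | hpos
  · refine radon_eq_zero_of_eq_planeCoord_zpow hp abs_pos hg (σ := 1) (m := μ) (by norm_num) ?_
      fun x hx => generatingFunction_one_of_neg hneg hμ hx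
    rw [hμ, muParam, if_neg hneg.not_gt, abs_of_neg hneg]
    ring
  · refine radon_eq_zero_of_eq_planeCoord_zpow hp abs_pos hg (σ := -1) (m := -μ) (by norm_num) ?_
      fun x hx => generatingFunction_one_of_pos hpos hμ hx
    push_cast
    rw [hμ, muParam, if_pos hpos, rhoC, abs_of_pos hpos]
    norm_num

end Plane

variable {p q : ℕ} {lam : ℝ} {μ : ℤ}

lemma toNat_add_two_mul_rhoC (hlam : 0 < lam) (hμ : (μ : ℝ) = muParam p q lam) (hμ0 : 0 ≤ μ) :
    (μ.toNat : ℝ) + 2 * rhoC q = lam + rho p q := by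
  have toNat_eq : (μ.toNat : ℝ) = μ := by exact_mod_cast Int.toNat_of_nonneg hμ0
  rw [toNat_eq, hμ, muParam, if_pos hlam]
  ring

lemma generatingFunction_of_nonneg (hq : 1 < q) (hlam : 0 < lam) (hμ : (μ : ℝ) = muParam p q lam)
    (hμ0 : 0 ≤ μ) (x : Idx p q → ℝ) :
    generatingFunction p q lam μ x = (gegenbauer (rhoC q) μ.toNat 1)⁻¹ •
      (kelvin (rhoC q) (Sum.inr ()) μ.toNat (negPart p q x) : ℂ) := by
  rw [generatingFunction, dif_neg hq.ne', if_pos hμ0, ← norm_negPart,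
    show -lam - rho p q = -((μ.toNat : ℝ) + 2 * rhoC q) by
      rw [toNat_add_two_mul_rhoC hlam hμ hμ0]; ring,
    show lastCoord p q x = negPart p q x (Sum.inr ()) from rfl, kelvin, zonal, Complex.real_smul]
  push_cast
  ring

theorem radon_generatingFunction_eq_zero (hp : 1 ≤ p) (hq : 1 < q) (hlam : 0 < lam)
    (hμ : (μ : ℝ) = muParam p q lam) (hμ0 : 0 < μ) {g : Mat p q}
    (hg : gᵀ * form p q * g = form p q) :
    RadonConverges p q (generatingFunction p q lam μ) g ∧
      radon p q (generatingFunction p q lam μ) g = 0 := by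
  have decay : 0 < lam + ((p : ℝ) - q + 1) / 2 := by
    have hμ_pos : (0 : ℝ) < muParam p q lam := hμ ▸ Int.cast_pos.2 hμ0
    rw [muParam, if_pos hlam, rho, rhoC] at hμ_pos
    linarith
  have dimension : 2 * rhoC q + 2 = Fintype.card (Fin q ⊕ Unit) := by simp [rhoC]; ring
  refine radon_eq_zero_of_harmonicOnNhd hg hp hq.le hlam decay
    (fun y hy => ((harmonicAt_kelvin (Sum.inr ()) dimension μ.toNat hy).comp_CLM
      Complex.ofRealCLM).const_smul (c := (gegenbauer (rhoC q) μ.toNat 1)⁻¹)) ?_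
    fun x _ => generatingFunction_of_nonneg hq hlam hμ hμ0.le x
  intro r hr y hy
  have homogeneous := isHomogeneousNeg_kelvin (rhoC q) (Sum.inr () : Fin q ⊕ Unit) μ.toNat r hr y hy
  rw [toNat_add_two_mul_rhoC hlam hμ hμ0.le] at homogeneous
  simp only [Pi.smul_apply, Function.comp_apply, Complex.ofRealCLM_apply, homogeneous, smul_eq_mul,
    Complex.ofReal_mul, ← Complex.real_smul]
  exact smul_comm _ _ _

end Vanishing

/-! ### Powers of the Laplace operator -/

section Radial

lemma abs_mul_sub_mul_le {c d f g C D y r : ℝ} (hy : 1 ≤ y) (hD : 0 ≤ D)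
    (hf : |f| ≤ C * y ^ r) (hg : |g| ≤ D * y ^ (r - 1)) :
    |c * f - d * g| ≤ (|c| * C + |d| * D) * y ^ r := by
  have hg' : |g| ≤ D * y ^ r := hg.trans <| mul_le_mul_of_nonneg_left
    (Real.rpow_le_rpow_of_exponent_le hy (by linarith)) hD
  calc |c * f - d * g| ≤ |c| * |f| + |d| * |g| := by
        simpa only [abs_mul] using abs_sub (c * f) (d * g)
    _ ≤ |c| * (C * y ^ r) + |d| * (D * y ^ r) := by gcongr
    _ = (|c| * C + |d| * D) * y ^ r := by ring

/-- The `m`-th power of the Laplace operator of a space of dimension `d`, applied to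
`(1 + |x|²)^a`, as a function of `t = |x|²`. -/
noncomputable def lapPow (d : ℝ) : ℕ → ℝ → ℝ → ℝ
  | 0, a, t => (1 + t) ^ a
  | m + 1, a, t => 2 * a * (d + 2 * (a - 1)) * lapPow d m (a - 1) t -
      4 * a * (a - 1) * lapPow d m (a - 2) t

lemma contDiff_lapPow_norm_sq {V : Type*} [NormedAddCommGroup V] [InnerProductSpace ℝ V]
    (d : ℝ) (m : ℕ) (a : ℝ) : ContDiff ℝ ∞ fun x : V => lapPow d m a (‖x‖ ^ 2) := by
  induction m generalizing a with
  | zero =>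
    simp only [lapPow]
    exact ContDiff.rpow_const_of_ne (contDiff_const.add (contDiff_norm_sq ℝ))
      fun x => by positivity
  | succ m ih =>
    simp only [lapPow]
    exact (contDiff_const.mul (ih _)).sub (contDiff_const.mul (ih _))

lemma exists_lapPow_bound (d : ℝ) (m : ℕ) (a : ℝ) :
    ∃ C, 0 ≤ C ∧ ∀ t, 0 ≤ t → |lapPow d m a t| ≤ C * (1 + t) ^ (a - m) := by
  induction m generalizing a with
  | zero =>
    refine ⟨1, zero_le_one, fun t ht => ?_⟩
    rw [lapPow, abs_of_nonneg (by positivity), Nat.cast_zero, sub_zero, one_mul]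
  | succ m ih =>
    obtain ⟨C, hC, bound_sub_one⟩ := ih (a - 1)
    obtain ⟨D, hD, bound_sub_two⟩ := ih (a - 2)
    refine ⟨|2 * a * (d + 2 * (a - 1))| * C + |4 * a * (a - 1)| * D, by positivity,
      fun t ht => abs_mul_sub_mul_le (by linarith) hD ?_ ?_⟩
    · convert bound_sub_one t ht using 3; push_cast; ring
    · convert bound_sub_two t ht using 3; push_cast; ring

section Laplacian

variable {V : Type*} [NormedAddCommGroup V] [InnerProductSpace ℝ V] [FiniteDimensional ℝ V]

lemma laplacian_one_add_norm_sq_rpow (a : ℝ) (x : V) :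
    (Δ (fun y : V => ((1 + ‖y‖ ^ 2) ^ a : ℝ)) : V → ℝ) x =
      2 * a * (Module.finrank ℝ V + 2 * (a - 1)) * (1 + ‖x‖ ^ 2) ^ (a - 1) -
        4 * a * (a - 1) * (1 + ‖x‖ ^ 2) ^ (a - 2) := by
  have base_ne_zero : 1 + ‖x‖ ^ 2 ≠ 0 := by positivity
  rw [laplacian_add_norm_sq_rpow 1 a base_ne_zero, show a - 2 = a - 1 - 1 by ring,
    Real.rpow_sub_one base_ne_zero (a - 1)]
  field_simp
  ring

lemma laplacian_lapPow (m : ℕ) (a : ℝ) :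
    Δ (fun x : V => lapPow (Module.finrank ℝ V) m a (‖x‖ ^ 2)) =
      fun x => lapPow (Module.finrank ℝ V) (m + 1) a (‖x‖ ^ 2) := by
  induction m generalizing a with
  | zero => ext x; exact laplacian_one_add_norm_sq_rpow a x
  | succ m ih =>
    ext x
    have smooth (b : ℝ) :
        ContDiffAt ℝ 2 (fun x : V => lapPow (Module.finrank ℝ V) m b (‖x‖ ^ 2)) x :=
      contDiffAt_infty.1 (contDiff_lapPow_norm_sq _ m b).contDiffAt 2
    have smooth_smul (c b : ℝ) :
        ContDiffAt ℝ 2 (c • fun x : V => lapPow (Module.finrank ℝ V) m b (‖x‖ ^ 2)) x :=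
      (smooth b).const_smul c
    have lapPow_succ_eq : (fun x : V => lapPow (Module.finrank ℝ V) (m + 1) a (‖x‖ ^ 2)) =
        (2 * a * (Module.finrank ℝ V + 2 * (a - 1))) •
          (fun x : V => lapPow (Module.finrank ℝ V) m (a - 1) (‖x‖ ^ 2)) -
        (4 * a * (a - 1)) • (fun x : V => lapPow (Module.finrank ℝ V) m (a - 2) (‖x‖ ^ 2)) := by
      ext x; simp [lapPow]
    rw [lapPow_succ_eq, ContDiffAt.laplacian_sub (smooth_smul _ _) (smooth_smul _ _),
      laplacian_smul _ (smooth _), laplacian_smul _ (smooth _), ih, ih]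
    simp only [lapPow, smul_eq_mul]

lemma iterate_laplacian (m : ℕ) (a : ℝ) :
    (fun h : V → ℝ => Δ h)^[m] (fun x => (1 + ‖x‖ ^ 2) ^ a) =
      fun x => lapPow (Module.finrank ℝ V) m a (‖x‖ ^ 2) := by
  induction m with
  | zero => rfl
  | succ m ih => rw [Function.iterate_succ_apply', ih, laplacian_lapPow]

end Laplacian

/-- The integral of `(1 + |x|²)^b` over a Euclidean space, a value of Euler's Beta function up to
a constant; it is the junk value `0` unless `2 b < -dim V`. -/
noncomputable def betaInt (V : Type*) [NormedAddCommGroup V] [MeasureSpace V] (b : ℝ) : ℝ :=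
  ∫ x : V, (1 + ‖x‖ ^ 2) ^ b

section Beta

lemma continuous_add_norm_sq_rpow {E : Type*} [NormedAddCommGroup E] {c : ℝ} (hc : 0 < c) (b : ℝ) :
    Continuous fun x : E => (c + ‖x‖ ^ 2) ^ b :=
  (continuous_const.add (continuous_norm.pow 2)).rpow_const fun _ =>
    .inl (add_pos_of_pos_of_nonneg hc (sq_nonneg _)).ne'

variable {V : Type*} [NormedAddCommGroup V] [InnerProductSpace ℝ V] [FiniteDimensional ℝ V]
  [MeasurableSpace V] [BorelSpace V]

lemma integrable_one_add_norm_sq_rpow {b : ℝ} (hb : 2 * b < -(Module.finrank ℝ V : ℝ)) :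
    Integrable fun x : V => (1 + ‖x‖ ^ 2) ^ b := by
  simpa [neg_div] using
    integrable_rpow_neg_one_add_norm_sq (E := V) (μ := volume) (r := -(2 * b)) (by linarith)

lemma betaInt_pos {b : ℝ} (hb : 2 * b < -(Module.finrank ℝ V : ℝ)) : 0 < betaInt V b := by
  rw [betaInt, integral_pos_iff_support_of_nonneg (fun x => by positivity)
    (integrable_one_add_norm_sq_rpow hb),
    Function.support_eq_univ fun x : V => (Real.rpow_pos_of_pos (by positivity) b).ne']
  exact Measure.measure_univ_pos.2 (NeZero.ne _)

lemma integral_add_norm_sq_rpow {c : ℝ} (hc : 0 < c) (b : ℝ) :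
    ∫ x : V, (c + ‖x‖ ^ 2) ^ b = c ^ (b + Module.finrank ℝ V / 2) * betaInt V b := by
  have comp_smul (x : V) : (c + ‖√c • x‖ ^ 2) ^ b = c ^ b * (1 + ‖x‖ ^ 2) ^ b := by
    rw [norm_smul, Real.norm_of_nonneg (Real.sqrt_nonneg _), mul_pow, Real.sq_sqrt hc.le,
      ← Real.mul_rpow hc.le (by positivity), mul_one_add]
  have sqrt_pow : √c ^ Module.finrank ℝ V = c ^ ((Module.finrank ℝ V : ℝ) / 2) := by
    rw [Real.sqrt_eq_rpow, ← Real.rpow_natCast, ← Real.rpow_mul hc.le, one_div_mul_eq_div]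
  have scaling := Measure.integral_comp_smul (volume : Measure V)
    (fun x : V => (c + ‖x‖ ^ 2) ^ b) (√c)
  simp only [comp_smul] at scaling
  rw [integral_const_mul, smul_eq_mul, abs_of_nonneg (by positivity), sqrt_pow] at scaling
  have := Real.rpow_pos_of_pos hc ((Module.finrank ℝ V : ℝ) / 2)
  rw [Real.rpow_add hc, betaInt, mul_right_comm, scaling]
  field_simp

lemma integrable_inner_sq_mul_rpow {a : ℝ} (ha : 2 * a < -(Module.finrank ℝ V : ℝ)) {e : V}
    (he : ‖e‖ = 1) : Integrable fun x : V => inner ℝ e x ^ 2 * (1 + ‖x‖ ^ 2) ^ (a - 1) := by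
  refine (integrable_one_add_norm_sq_rpow ha).mono'
    (((continuous_const.inner continuous_id).pow 2).mul
      (continuous_add_norm_sq_rpow one_pos _)).aestronglyMeasurable (.of_forall fun x => ?_)
  have inner_le : inner ℝ e x ^ 2 ≤ 1 + ‖x‖ ^ 2 := by
    have := sq_le_sq' (neg_le_of_abs_le (abs_real_inner_le_norm e x)) (real_inner_le_norm e x)
    rw [he, one_mul] at this
    linarith
  rw [Real.norm_of_nonneg (by positivity)]
  calc _ ≤ (1 + ‖x‖ ^ 2) * (1 + ‖x‖ ^ 2) ^ (a - 1) := by gcongr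
    _ = _ := by rw [Real.rpow_sub_one (by positivity)]; field_simp

lemma integrable_inner_mul_rpow {a : ℝ} (ha : 2 * a + 1 < -(Module.finrank ℝ V : ℝ)) {e : V}
    (he : ‖e‖ = 1) : Integrable fun x : V => inner ℝ e x * (1 + ‖x‖ ^ 2) ^ a := by
  refine (integrable_one_add_norm_sq_rpow (b := a + 1 / 2) (by linarith)).mono'
    ((continuous_const.inner continuous_id).mul
      (continuous_add_norm_sq_rpow one_pos a)).aestronglyMeasurable
    (.of_forall fun x => ?_)
  have inner_le : ‖(inner ℝ e x : ℝ)‖ ≤ √(1 + ‖x‖ ^ 2) := by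
    refine (norm_inner_le_norm e x).trans ?_
    rw [he, one_mul]
    exact Real.le_sqrt_of_sq_le (by linarith)
  rw [norm_mul, Real.norm_of_nonneg (Real.rpow_nonneg (by positivity) a),
    Real.rpow_add (by positivity), mul_comm, ← Real.sqrt_eq_rpow]
  gcongr

lemma two_mul_integral_inner_sq_mul_rpow {a : ℝ} (ha : 2 * a + 1 < -(Module.finrank ℝ V : ℝ))
    {e : V} (he : ‖e‖ = 1) :
    2 * a * ∫ x : V, inner ℝ e x ^ 2 * (1 + ‖x‖ ^ 2) ^ (a - 1) = -betaInt V a := by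
  have hasFDerivAt_rpow (x : V) :=
    hasFDerivAt_add_norm_sq_rpow 1 a (y := x) (by positivity)
  have fderiv_rpow (x : V) : fderiv ℝ (fun x : V => (1 + ‖x‖ ^ 2) ^ a) x e =
      2 * a * ((1 + ‖x‖ ^ 2) ^ (a - 1) * inner ℝ e x) := by
    rw [(hasFDerivAt_rpow x).fderiv]
    simp [real_inner_comm, mul_assoc]
  have fderiv_inner (x : V) : fderiv ℝ (fun x : V => inner ℝ e x) x e = 1 := by
    have fderiv_eq : fderiv ℝ (fun x : V => inner ℝ e x) x = innerSL ℝ e :=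
      (innerSL ℝ e).hasFDerivAt.fderiv
    rw [fderiv_eq, innerSL_apply_apply, real_inner_self_eq_norm_sq, he, one_pow]
  have mul_fderiv (x : V) : inner ℝ e x * (2 * a * ((1 + ‖x‖ ^ 2) ^ (a - 1) * inner ℝ e x)) =
      2 * a * (inner ℝ e x ^ 2 * (1 + ‖x‖ ^ 2) ^ (a - 1)) := by ring
  have parts := integral_mul_fderiv_eq_neg_fderiv_mul_of_integrable (μ := (volume : Measure V))
    (f := fun x => inner ℝ e x) (g := fun x => (1 + ‖x‖ ^ 2) ^ a) (v := e)
    (by simpa only [fderiv_inner, one_mul] using integrable_one_add_norm_sq_rpow (by linarith))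
    (by simpa only [fderiv_rpow, mul_fderiv] using
      (integrable_inner_sq_mul_rpow (by linarith) he).const_mul _)
    (integrable_inner_mul_rpow ha he)
    (fun x _ => (innerSL ℝ e).differentiableAt) (fun x _ => (hasFDerivAt_rpow x).differentiableAt)
  simpa only [betaInt, fderiv_rpow, fderiv_inner, one_mul, mul_fderiv, integral_const_mul]
    using parts

lemma betaInt_sub_one {a : ℝ} (ha : 2 * a + 1 < -(Module.finrank ℝ V : ℝ)) :
    a * betaInt V (a - 1) = (a + Module.finrank ℝ V / 2) * betaInt V a := by
  set e := stdOrthonormalBasis ℝ V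
  have sum_inner_sq (x : V) : ∑ k, inner ℝ (e k) x ^ 2 * (1 + ‖x‖ ^ 2) ^ (a - 1) =
      (1 + ‖x‖ ^ 2) ^ a - (1 + ‖x‖ ^ 2) ^ (a - 1) := by
    rw [← Finset.sum_mul, e.sum_sq_inner_right, Real.rpow_sub_one (by positivity)]
    field_simp
    ring
  have sum_integral : 2 * a * (betaInt V a - betaInt V (a - 1)) =
      -(Module.finrank ℝ V * betaInt V a) := by
    calc 2 * a * (betaInt V a - betaInt V (a - 1))
        = 2 * a * ∑ k, ∫ x : V, inner ℝ (e k) x ^ 2 * (1 + ‖x‖ ^ 2) ^ (a - 1) := by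
          rw [← integral_finsetSum _ fun k _ =>
            integrable_inner_sq_mul_rpow (by linarith) (e.norm_eq_one k)]
          simp only [sum_inner_sq]
          rw [integral_sub (integrable_one_add_norm_sq_rpow (by linarith))
            (integrable_one_add_norm_sq_rpow (by linarith)), betaInt, betaInt]
      _ = ∑ _ : Fin (Module.finrank ℝ V), -betaInt V a := by
          rw [Finset.mul_sum]
          exact Finset.sum_congr rfl fun k _ =>
            two_mul_integral_inner_sq_mul_rpow ha (e.norm_eq_one k)
      _ = -(Module.finrank ℝ V * betaInt V a) := by simp
  linear_combination -sum_integral / 2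

lemma integrable_lapPow_add_norm_sq (d : ℝ) (m : ℕ) {a : ℝ}
    (ha : 2 * a < -(Module.finrank ℝ V : ℝ)) {t : ℝ} (ht : 0 ≤ t) :
    Integrable fun x : V => lapPow d m a (t + ‖x‖ ^ 2) := by
  induction m generalizing a with
  | zero =>
    simp only [lapPow, ← add_assoc]
    refine (integrable_one_add_norm_sq_rpow ha).mono'
      (continuous_add_norm_sq_rpow (by positivity) a).aestronglyMeasurable (.of_forall fun x => ?_)
    rw [Real.norm_of_nonneg (by positivity)]
    have : (0 : ℝ) ≤ Module.finrank ℝ V := Nat.cast_nonneg _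
    exact Real.rpow_le_rpow_of_nonpos (by positivity) (by linarith) (by linarith)
  | succ m ih =>
    simp only [lapPow]
    exact ((ih (by linarith)).const_mul _).sub ((ih (by linarith)).const_mul _)

lemma integral_lapPow_add_norm_sq (m : ℕ) {a : ℝ} (ha : 2 * a + 1 < -(Module.finrank ℝ V : ℝ))
    {t : ℝ} (ht : 0 ≤ t) :
    ∫ x : V, lapPow (Module.finrank ℝ V + 1) m a (t + ‖x‖ ^ 2) =
      betaInt V a * lapPow 1 m (a + Module.finrank ℝ V / 2) t := by
  induction m generalizing a with
  | zero =>
    simp only [lapPow, ← add_assoc]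
    rw [integral_add_norm_sq_rpow (by positivity), mul_comm]
  | succ m ih =>
    have ih_sub_one := ih (a := a - 1) (by linarith)
    have ih_sub_two := ih (a := a - 2) (by linarith)
    have beta_sub_one := betaInt_sub_one ha
    have beta_sub_two := betaInt_sub_one (V := V) (a := a - 1) (by linarith)
    rw [sub_add_eq_add_sub] at ih_sub_one ih_sub_two
    rw [show a - 1 - 1 = a - 2 by ring] at beta_sub_two
    have integrable (b : ℝ) (hb : 2 * b + 1 < -(Module.finrank ℝ V : ℝ)) (c : ℝ) :
        Integrable fun x : V => c * lapPow (Module.finrank ℝ V + 1) m b (t + ‖x‖ ^ 2) :=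
      (integrable_lapPow_add_norm_sq _ m (by linarith) ht).const_mul c
    simp only [lapPow]
    rw [integral_sub (integrable _ (by linarith) _) (integrable _ (by linarith) _),
      integral_const_mul, integral_const_mul, ih_sub_one, ih_sub_two]
    generalize lapPow 1 m (a + Module.finrank ℝ V / 2 - 1) t = A
    generalize lapPow 1 m (a + Module.finrank ℝ V / 2 - 2) t = B
    linear_combination (2 * (Module.finrank ℝ V + 1 + 2 * (a - 1)) * A -
      4 * (a - 1 + Module.finrank ℝ V / 2) * B) * beta_sub_one - 4 * a * B * beta_sub_two

end Beta

end Radial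

/-! ### Fractional integrals of the derivatives of `(1 + x²)^a` -/

section OneVariable

/-- The `i`-th derivative of `(1 + x²)^a`, by the recursion coming from the one-dimensional
Laplace operator. -/
noncomputable def derivPow : ℕ → ℝ → ℝ → ℝ
  | 0, a, x => (1 + x ^ 2) ^ a
  | 1, a, x => 2 * a * x * (1 + x ^ 2) ^ (a - 1)
  | i + 2, a, x => 2 * a * (2 * a - 1) * derivPow i (a - 1) x -
      4 * a * (a - 1) * derivPow i (a - 2) x

lemma hasDerivAt_derivPow (i : ℕ) (a x : ℝ) :
    HasDerivAt (derivPow i a) (derivPow (i + 1) a x) x := by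
  have base_ne_zero : 1 + x ^ 2 ≠ 0 := by positivity
  have hasDerivAt_zero (a : ℝ) : HasDerivAt (derivPow 0 a) (derivPow 1 a x) x := by
    refine (((hasDerivAt_pow 2 x).const_add 1).rpow_const (p := a)
      (.inl base_ne_zero)).congr_deriv ?_
    simp only [derivPow]
    push_cast
    ring
  induction i using Nat.twoStepInduction generalizing a with
  | zero => exact hasDerivAt_zero a
  | one =>
    refine (((hasDerivAt_id x).const_mul (2 * a)).mul
      (hasDerivAt_zero (a - 1))).congr_deriv ?_
    simp only [derivPow, id]
    rw [show a - 2 = a - 1 - 1 by ring, Real.rpow_sub_one base_ne_zero (a - 1)]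
    field_simp
    ring
  | more i ih _ => exact ((ih (a - 1)).const_mul _).sub ((ih (a - 2)).const_mul _)

lemma continuous_derivPow (i : ℕ) (a : ℝ) : Continuous (derivPow i a) :=
  continuous_iff_continuousAt.2 fun x => (hasDerivAt_derivPow i a x).continuousAt

lemma derivPow_two_mul (m : ℕ) (a x : ℝ) : derivPow (2 * m) a x = lapPow 1 m a (x ^ 2) := by
  induction m generalizing a with
  | zero => rfl
  | succ m ih =>
    rw [mul_add_one, derivPow, lapPow, ih, ih]
    ring

lemma exists_derivPow_bound (i : ℕ) (a : ℝ) :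
    ∃ C, 0 ≤ C ∧ ∀ x, |derivPow i a x| ≤ C * (1 + x ^ 2) ^ (a - i / 2) := by
  induction i using Nat.twoStepInduction generalizing a with
  | zero =>
    refine ⟨1, zero_le_one, fun x => ?_⟩
    rw [derivPow, abs_of_nonneg (by positivity)]
    simp
  | one =>
    refine ⟨|2 * a|, abs_nonneg _, fun x => ?_⟩
    have abs_le : |x| ≤ (1 + x ^ 2) ^ (1 / 2 : ℝ) := by
      rw [← Real.sqrt_eq_rpow]
      exact Real.abs_le_sqrt (by linarith)
    rw [derivPow, abs_mul, abs_mul _ x, mul_assoc,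
      abs_of_nonneg (a := (1 + x ^ 2) ^ (a - 1)) (by positivity)]
    refine mul_le_mul_of_nonneg_left ?_ (abs_nonneg _)
    calc |x| * (1 + x ^ 2) ^ (a - 1) ≤ (1 + x ^ 2) ^ (1 / 2 : ℝ) * (1 + x ^ 2) ^ (a - 1) := by
          gcongr
      _ = (1 + x ^ 2) ^ (a - (1 : ℕ) / 2) := by
          rw [← Real.rpow_add (by positivity)]; congr 1; push_cast; ring
  | more i ih _ =>
    obtain ⟨C, hC, bound_sub_one⟩ := ih (a - 1)
    obtain ⟨D, hD, bound_sub_two⟩ := ih (a - 2)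
    refine ⟨|2 * a * (2 * a - 1)| * C + |4 * a * (a - 1)| * D, by positivity, fun x =>
      abs_mul_sub_mul_le (by linarith [sq_nonneg x]) hD ?_ ?_⟩
    · convert bound_sub_one x using 3; push_cast; ring
    · convert bound_sub_two x using 3; push_cast; ring

lemma derivPow_isBigO (i : ℕ) {a : ℝ} (ha : a ≤ 0) (S : ℝ) :
    (fun τ => derivPow i a (S - τ)) =O[atTop] fun τ => τ ^ (-(i - 2 * a)) := by
  obtain ⟨C, hC, bound⟩ := exists_derivPow_bound i a
  have : (0 : ℝ) ≤ i := i.cast_nonneg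
  refine Asymptotics.IsBigO.of_bound (C * (2 + 2 * S ^ 2) ^ (i / 2 - a)) ?_
  filter_upwards [eventually_gt_atTop 0] with τ hτ
  have sq_le : τ ^ 2 ≤ (2 + 2 * S ^ 2) * (1 + (S - τ) ^ 2) := by
    nlinarith [sq_nonneg (τ - 2 * S), sq_nonneg (S * (S - τ))]
  have rpow_le :=
    rpow_neg_le_of_le (r := i / 2 - a) (by positivity) (by positivity) (by linarith) sq_le
  have sq_rpow : (τ ^ 2) ^ (-((i : ℝ) / 2 - a)) = τ ^ (-(i - 2 * a)) := by
    rw [← Real.rpow_natCast, ← Real.rpow_mul hτ.le]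
    congr 1; push_cast; ring
  rw [sq_rpow, neg_sub] at rpow_le
  rw [Real.norm_of_nonneg (Real.rpow_nonneg hτ.le _), mul_assoc]
  exact (bound _).trans (mul_le_mul_of_nonneg_left rpow_le hC)

lemma continuous_derivPow_sub (i : ℕ) (a S : ℝ) : Continuous fun τ => derivPow i a (S - τ) :=
  (continuous_derivPow i a).comp (continuous_const.sub continuous_id)

lemma hasDerivAt_neg_derivPow_sub (i : ℕ) (a S τ : ℝ) :
    HasDerivAt (fun τ => -derivPow i a (S - τ)) (derivPow (i + 1) a (S - τ)) τ :=
  ((hasDerivAt_derivPow i a (S - τ)).comp τ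
    ((hasDerivAt_id τ).const_sub S)).neg.congr_deriv (by simp)

lemma integrableOn_rpow_mul_derivPow (i : ℕ) {a α : ℝ} (ha : a ≤ 0) (S : ℝ) (hα : -1 < α)
    (hi : α + 1 < i - 2 * a) :
    IntegrableOn (fun τ => τ ^ α * derivPow i a (S - τ)) (Ioi 0) := by
  have continuous := continuous_derivPow_sub i a S
  have isBigO_zero : (fun τ => derivPow i a (S - τ)) =O[𝓝[>] 0] fun τ => τ ^ (-0 : ℝ) := by
    simpa only [neg_zero, Real.rpow_zero] using
      (continuous.tendsto 0).isBigO_one ℝ |>.mono nhdsWithin_le_nhds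
  simpa using mellin_convergent_of_isBigO_scalar (s := α + 1)
    (continuous.locallyIntegrable.locallyIntegrableOn _) (derivPow_isBigO i ha S) hi isBigO_zero
    (by linarith)

lemma tendsto_rpow_mul_derivPow_atTop (i : ℕ) {a α : ℝ} (ha : a ≤ 0) (S : ℝ)
    (hi : α < i - 2 * a) :
    Tendsto (fun τ => τ ^ α * derivPow i a (S - τ)) atTop (𝓝 0) := by
  refine ((Asymptotics.isBigO_refl _ _).mul (derivPow_isBigO i ha S)).trans_tendsto ?_
  refine (tendsto_rpow_neg_atTop (y := i - 2 * a - α) (by linarith)).congr' ?_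
  filter_upwards [eventually_gt_atTop 0] with τ hτ
  rw [← Real.rpow_add hτ]
  congr 1
  ring

/-- The integral of `τ^α` against the `i`-th derivative of `(1 + x²)^a` at `S - τ`: up to the
factor `Γ(α + 1)`, the fractional integral of order `α + 1` of this derivative at `S`. -/
noncomputable def fracInt (a S : ℝ) (i : ℕ) (α : ℝ) : ℝ :=
  ∫ τ in Ioi 0, τ ^ α * derivPow i a (S - τ)

lemma fracInt_succ (i : ℕ) {a α : ℝ} (ha : a ≤ 0) (S : ℝ) (hα : 0 < α) (hi : α < i - 2 * a) :
    fracInt a S (i + 1) α = α * fracInt a S i (α - 1) := by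
  have integrable := integrableOn_rpow_mul_derivPow i (α := α - 1) ha S (by linarith) (by linarith)
  have integrable_succ :=
    integrableOn_rpow_mul_derivPow (i + 1) (α := α) ha S (by linarith) (by push_cast; linarith)
  have tendsto_zero : Tendsto (fun τ : ℝ => τ ^ α * -derivPow i a (S - τ)) (𝓝[>] 0) (𝓝 0) := by
    have := (Real.continuousAt_rpow_const 0 α (.inr hα.le)).tendsto.mul
      ((continuous_derivPow_sub i a S).neg.tendsto 0)
    rw [Real.zero_rpow hα.ne', zero_mul] at this
    exact this.mono_left nhdsWithin_le_nhds
  have tendsto_atTop : Tendsto (fun τ : ℝ => τ ^ α * -derivPow i a (S - τ)) atTop (𝓝 0) := by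
    simpa only [mul_neg, neg_zero] using (tendsto_rpow_mul_derivPow_atTop i ha S hi).neg
  have parts := integral_Ioi_mul_deriv_eq_deriv_mul (u := fun τ => τ ^ α)
    (fun τ hτ => Real.hasDerivAt_rpow_const (.inl (ne_of_gt hτ)))
    (fun τ _ => hasDerivAt_neg_derivPow_sub i a S τ) integrable_succ
    ((integrable.const_mul (-α)).congr (.of_forall fun τ => by simp only [Pi.mul_apply]; ring))
    tendsto_zero tendsto_atTop
  rw [fracInt, parts, fracInt, ← integral_const_mul, sub_self, zero_sub, ← integral_neg]
  exact integral_congr_ae (.of_forall fun τ => by ring)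

lemma fracInt_add (i : ℕ) {a α : ℝ} (ha : a ≤ 0) (S : ℝ) (hα : -1 < α)
    (hα' : α + 1 < -(2 * a)) :
    fracInt a S i (α + i) = (∏ j ∈ Finset.range i, (α + j + 1)) * fracInt a S 0 α := by
  induction i with
  | zero => simp
  | succ i ih =>
    have : (0 : ℝ) ≤ i := i.cast_nonneg
    rw [fracInt_succ i ha S (by push_cast; linarith) (by push_cast; linarith),
      Finset.prod_range_succ, Nat.cast_succ, ← add_assoc, add_sub_cancel_right, ih]
    ring

section Substitution

lemma integral_comp_div_Ioi (F : ℝ → ℝ) {b : ℝ} (hb : 0 < b) :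
    ∫ σ in Ioi 0, b / σ ^ 2 * F (b / σ) = ∫ τ in Ioi 0, F τ := by
  have inversion := integral_comp_rpow_Ioi (fun u => F (b * u)) (p := -1) (by norm_num)
  rw [integral_comp_mul_left_Ioi _ 0 hb, mul_zero, smul_eq_mul,
    eq_inv_mul_iff_mul_eq₀ hb.ne', ← integral_const_mul] at inversion
  rw [← inversion]
  refine setIntegral_congr_fun measurableSet_Ioi fun σ (hσ : 0 < σ) => ?_
  simp only [Real.rpow_neg_one, ← div_eq_mul_inv, smul_eq_mul]
  rw [show (-1 : ℝ) - 1 = -(2 : ℕ) by norm_num, Real.rpow_neg hσ.le, Real.rpow_natCast, abs_neg,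
    abs_one]
  ring

lemma hasDerivAt_sqrt_sub (c : ℝ) {τ : ℝ} (hτ : 0 < τ) :
    HasDerivAt (fun τ => √τ - c / √τ) (1 / (2 * √τ) * (1 + c / τ)) τ := by
  have hs : 0 < √τ := Real.sqrt_pos.2 hτ
  refine ((Real.hasDerivAt_sqrt hτ.ne').sub
    (((Real.hasDerivAt_sqrt hτ.ne').inv hs.ne').const_mul c)).congr_deriv ?_
  rw [Real.sq_sqrt hτ.le]
  field_simp
  ring

lemma image_sqrt_sub {c : ℝ} (hc : 0 < c) : (fun τ => √τ - c / √τ) '' Ioi 0 = univ := by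
  refine eq_univ_of_forall fun v => ?_
  have abs_lt : |v| < √(v ^ 2 + 4 * c) := by
    rw [← Real.sqrt_sq_eq_abs]
    exact Real.sqrt_lt_sqrt (sq_nonneg v) (by linarith)
  have discr := Real.sq_sqrt (show 0 ≤ v ^ 2 + 4 * c by positivity)
  have root_pos : 0 < (v + √(v ^ 2 + 4 * c)) / 2 := by linarith [neg_abs_le v]
  refine ⟨((v + √(v ^ 2 + 4 * c)) / 2) ^ 2, pow_pos root_pos 2, ?_⟩
  beta_reduce
  rw [Real.sqrt_sq root_pos.le, sub_eq_iff_eq_add, ← sub_eq_iff_eq_add', eq_div_iff root_pos.ne']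
  linear_combination discr / 4

lemma injOn_sqrt_sub {c : ℝ} (hc : 0 < c) : InjOn (fun τ => √τ - c / √τ) (Ioi 0) := by
  refine StrictMonoOn.injOn fun σ hσ τ _ hστ => ?_
  have sqrt_lt : √σ < √τ := Real.sqrt_lt_sqrt (le_of_lt hσ) hστ
  exact sub_lt_sub sqrt_lt (div_lt_div_of_pos_left hc (Real.sqrt_pos.2 hσ) sqrt_lt)

lemma integral_comp_sqrt_sub (F : ℝ → ℝ) {c : ℝ} (hc : 0 < c) :
    ∫ τ in Ioi 0, 1 / (2 * √τ) * (1 + c / τ) * F (√τ - c / √τ) = ∫ v, F v := by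
  have substitution := integral_image_eq_integral_abs_deriv_smul measurableSet_Ioi
    (fun τ hτ => (hasDerivAt_sqrt_sub c hτ).hasDerivWithinAt) (injOn_sqrt_sub hc) F
  rw [image_sqrt_sub hc, setIntegral_univ] at substitution
  rw [substitution]
  refine setIntegral_congr_fun measurableSet_Ioi fun τ hτ => ?_
  have : 0 < τ := hτ
  rw [abs_of_pos (by positivity), smul_eq_mul]

end Substitution

lemma one_add_sinh_sub_sq (s τ : ℝ) :
    1 + (Real.sinh s - τ) ^ 2 = τ ^ 2 - 2 * Real.sinh s * τ + Real.cosh s ^ 2 := by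
  linear_combination -Real.cosh_sq_sub_sinh_sq s

lemma mul_inversion_rpow (lam : ℝ) {c σ : ℝ} (hc : 0 < c) (hσ : 0 < σ) :
    c * (c ^ 2 / σ ^ 2 * ((c ^ 2 / σ) ^ (lam - 1) * (c ^ 2 / σ ^ 2) ^ (-lam - 1 / 2))) =
      σ ^ lam := by
  refine Real.log_injOn_pos (mem_Ioi.2 (by positivity)) (mem_Ioi.2 (by positivity)) ?_
  rw [Real.log_mul (by positivity) (by positivity), Real.log_mul (by positivity) (by positivity),
    Real.log_mul (by positivity) (by positivity), Real.log_rpow (by positivity),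
    Real.log_rpow (by positivity), Real.log_rpow (by positivity),
    Real.log_div (by positivity) (by positivity), Real.log_div (by positivity) (by positivity),
    Real.log_pow, Real.log_pow]
  push_cast
  ring

lemma cosh_mul_fracInt (lam s : ℝ) :
    Real.cosh s * fracInt (-lam - 1 / 2) (Real.sinh s) 0 (lam - 1) =
      fracInt (-lam - 1 / 2) (Real.sinh s) 0 lam := by
  set c := Real.cosh s with hc
  have hc0 : 0 < c := Real.cosh_pos s
  -- The inversion `τ ↦ cosh² s / τ` preserves the quadratic `1 + (sinh s - τ)²` up to a factor.
  rw [fracInt, fracInt, ← integral_comp_div_Ioi _ (pow_pos hc0 2), ← integral_const_mul]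
  refine setIntegral_congr_fun measurableSet_Ioi fun σ (hσ : 0 < σ) => ?_
  have quadratic_nonneg : 0 ≤ σ ^ 2 - 2 * Real.sinh s * σ + c ^ 2 := by
    rw [hc, ← one_add_sinh_sub_sq]; positivity
  have quadratic_inversion : (c ^ 2 / σ) ^ 2 - 2 * Real.sinh s * (c ^ 2 / σ) + c ^ 2 =
      (c ^ 2 / σ ^ 2) * (σ ^ 2 - 2 * Real.sinh s * σ + c ^ 2) := by
    field_simp; ring
  simp only [derivPow, one_add_sinh_sub_sq, ← hc]
  rw [quadratic_inversion, Real.mul_rpow (by positivity) quadratic_nonneg]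
  linear_combination (σ ^ 2 - 2 * Real.sinh s * σ + c ^ 2) ^ (-lam - 1 / 2) *
    mul_inversion_rpow lam hc0 hσ

lemma rpow_comp_sqrt_sub (lam s : ℝ) {τ : ℝ} (hτ : 0 < τ) :
    1 / (2 * √τ) * (1 + Real.cosh s / τ) *
        (2 * Real.exp (-s) + ‖√τ - Real.cosh s / √τ‖ ^ 2) ^ (-lam - 1 / 2) =
      1 / 2 * (τ ^ lam * derivPow 0 (-lam - 1 / 2) (Real.sinh s - τ)) +
        1 / 2 * (Real.cosh s * (τ ^ (lam - 1) * derivPow 0 (-lam - 1 / 2) (Real.sinh s - τ))) := by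
  have : 0 < √τ := Real.sqrt_pos.2 hτ
  have quadratic_eq : 2 * Real.exp (-s) + (√τ - Real.cosh s / √τ) ^ 2 =
      (1 + (Real.sinh s - τ) ^ 2) * τ⁻¹ := by
    rw [one_add_sinh_sub_sq, ← Real.cosh_sub_sinh, sub_sq, div_pow, Real.sq_sqrt hτ.le]
    field_simp
    ring
  simp only [derivPow]
  rw [Real.norm_eq_abs, sq_abs, quadratic_eq,
    Real.mul_rpow (by positivity) (by positivity), Real.inv_rpow hτ.le,
    ← Real.rpow_neg hτ.le, show -(-lam - 1 / 2) = lam + 1 / 2 by ring, Real.rpow_add hτ,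
    ← Real.sqrt_eq_rpow, Real.rpow_sub_one hτ.ne']
  field_simp

lemma fracInt_zero {lam : ℝ} (hlam : 0 < lam) (s : ℝ) :
    fracInt (-lam - 1 / 2) (Real.sinh s) 0 lam =
      2 ^ (-lam) * betaInt ℝ (-lam - 1 / 2) * Real.exp (lam * s) := by
  have integrable (α : ℝ) (hα : -1 < α) (hα' : α ≤ lam) :=
    integrableOn_rpow_mul_derivPow 0 (a := -lam - 1 / 2) (α := α) (by linarith) (Real.sinh s) hα
      (by push_cast; linarith)
  have value : ∫ v : ℝ, (2 * Real.exp (-s) + ‖v‖ ^ 2) ^ (-lam - 1 / 2) =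
      2 ^ (-lam) * Real.exp (lam * s) * betaInt ℝ (-lam - 1 / 2) := by
    rw [integral_add_norm_sq_rpow (by positivity), Module.finrank_self,
      Real.mul_rpow (by norm_num) (Real.exp_pos _).le, ← Real.exp_mul]
    congr 3 <;> push_cast <;> ring
  calc fracInt (-lam - 1 / 2) (Real.sinh s) 0 lam
      = 1 / 2 * fracInt (-lam - 1 / 2) (Real.sinh s) 0 lam +
          1 / 2 * (Real.cosh s * fracInt (-lam - 1 / 2) (Real.sinh s) 0 (lam - 1)) := by
        rw [cosh_mul_fracInt]; ring
    _ = ∫ v : ℝ, (2 * Real.exp (-s) + ‖v‖ ^ 2) ^ (-lam - 1 / 2) := by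
        rw [← integral_comp_sqrt_sub _ (Real.cosh_pos s), fracInt, fracInt, ← integral_const_mul,
          ← integral_const_mul, ← integral_const_mul,
          ← integral_add ((integrable lam (by linarith) le_rfl).const_mul _)
            (((integrable (lam - 1) (by linarith) (by linarith)).const_mul _).const_mul _)]
        exact setIntegral_congr_fun measurableSet_Ioi fun τ hτ =>
          (rpow_comp_sqrt_sub lam s hτ).symm
    _ = 2 ^ (-lam) * betaInt ℝ (-lam - 1 / 2) * Real.exp (lam * s) := by rw [value]; ring

lemma fracInt_add_eq_exp (i : ℕ) {lam : ℝ} (hlam : 0 < lam) (s : ℝ) :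
    fracInt (-lam - 1 / 2) (Real.sinh s) i (lam + i) =
      (∏ j ∈ Finset.range i, (lam + j + 1)) * (2 ^ (-lam) * betaInt ℝ (-lam - 1 / 2)) *
        Real.exp (lam * s) := by
  rw [fracInt_add i (by linarith) _ (by linarith) (by linarith), fracInt_zero hlam]
  ring

lemma cosh_mul_fracInt_sub (i : ℕ) {lam : ℝ} (hlam : 0 < lam) (s : ℝ) :
    Real.cosh s * fracInt (-lam - 1 / 2) (Real.sinh s) (i + 1) (lam + i) -
        fracInt (-lam - 1 / 2) (Real.sinh s) (i + 1) (lam + i + 1) =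
      -(i + 1) * (∏ j ∈ Finset.range i, (lam + j + 1)) *
        (2 ^ (-lam) * betaInt ℝ (-lam - 1 / 2)) * Real.exp (lam * s) := by
  have prod_shift : ∏ j ∈ Finset.range (i + 1), (lam - 1 + (j : ℝ) + 1) =
      lam * ∏ j ∈ Finset.range i, (lam + j + 1) := by
    rw [Finset.prod_range_succ', mul_comm]
    congr 1
    · push_cast; ring
    · exact Finset.prod_congr rfl fun j _ => by push_cast; ring
  have lower := fracInt_add (i + 1) (a := -lam - 1 / 2) (α := lam - 1) (by linarith)
    (Real.sinh s) (by linarith) (by linarith)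
  have upper := fracInt_add_eq_exp (i + 1) hlam s
  rw [prod_shift, Nat.cast_add_one, sub_add_add_cancel] at lower
  rw [Finset.prod_range_succ, Nat.cast_add_one, ← add_assoc] at upper
  rw [lower, upper]
  have inversion := cosh_mul_fracInt lam s
  rw [fracInt_zero hlam] at inversion
  linear_combination (lam * ∏ j ∈ Finset.range i, (lam + j + 1)) * inversion

lemma prod_mul_betaInt_pos (i : ℕ) {lam : ℝ} (hlam : 0 < lam) :
    0 < (∏ j ∈ Finset.range i, (lam + j + 1)) * (2 ^ (-lam) * betaInt ℝ (-lam - 1 / 2)) := by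
  have beta_pos : 0 < betaInt ℝ (-lam - 1 / 2) :=
    betaInt_pos (by rw [Module.finrank_self]; push_cast; linarith)
  exact mul_pos (Finset.prod_pos fun j _ => by positivity) (by positivity)

lemma exists_integral_lapPow_even (m : ℕ) {lam : ℝ} (hlam : 0 < lam) : ∃ A : ℝ, A ≠ 0 ∧ ∀ s : ℝ,
    ∫ τ in Ioi 0, τ ^ (lam + (2 * m : ℕ)) *
      lapPow 1 m (-lam - 1 / 2) ((Real.sinh s - τ) ^ 2) = A * Real.exp (lam * s) := by
  refine ⟨_, (prod_mul_betaInt_pos (2 * m) hlam).ne', fun s => ?_⟩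
  simpa only [fracInt, derivPow_two_mul] using fracInt_add_eq_exp (2 * m) hlam s

lemma exists_integral_lapPow_odd (m : ℕ) {lam : ℝ} (hlam : 0 < lam) : ∃ A : ℝ, A ≠ 0 ∧ ∀ s : ℝ,
    ∫ τ in Ioi 0, τ ^ (lam + (2 * m + 1 : ℕ)) * ((Real.cosh s - τ) *
      lapPow 1 (m + 1) (-lam - 1 / 2) ((Real.sinh s - τ) ^ 2)) = A * Real.exp (lam * s) := by
  obtain ⟨n, hn⟩ : ∃ n, n = 2 * m + 1 := ⟨_, rfl⟩
  have : (0 : ℝ) ≤ n := n.cast_nonneg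
  refine ⟨-(n + 1) * ((∏ j ∈ Finset.range n, (lam + j + 1)) *
    (2 ^ (-lam) * betaInt ℝ (-lam - 1 / 2))),
    mul_ne_zero (by linarith) (prod_mul_betaInt_pos n hlam).ne', fun s => ?_⟩
  have integrable (α : ℝ) (hα : -1 < α) (hα' : α ≤ lam + n + 1) :=
    integrableOn_rpow_mul_derivPow (n + 1) (a := -lam - 1 / 2) (α := α) (by linarith)
      (Real.sinh s) hα (by push_cast; linarith)
  rw [← hn, ← mul_assoc (-((n : ℝ) + 1)), ← cosh_mul_fracInt_sub n hlam, fracInt, fracInt,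
    ← integral_const_mul, ← integral_sub
      ((integrable (lam + n) (by linarith) (by linarith)).const_mul _)
      (integrable (lam + n + 1) (by linarith) le_rfl)]
  refine setIntegral_congr_fun measurableSet_Ioi fun τ (hτ : 0 < τ) => ?_
  rw [show n + 1 = 2 * (m + 1) by omega, derivPow_two_mul, Real.rpow_add_one hτ.ne']
  ring

end OneVariable

/-! ### The Radon transform on the boosts -/

section Boost

lemma measurable_lapPow (d : ℝ) (m : ℕ) (a : ℝ) : Measurable (lapPow d m a) := by
  induction m generalizing a with
  | zero => exact (measurable_const.add measurable_id).pow_const a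
  | succ m ih => exact ((ih _).const_mul _).sub ((ih _).const_mul _)

section Polar

variable {V : Type*} [NormedAddCommGroup V] [InnerProductSpace ℝ V] [FiniteDimensional ℝ V]
  [MeasurableSpace V] [BorelSpace V] [Nontrivial V]

lemma integral_comp_norm_sq (F : ℝ → ℝ) :
    ∫ y : V, F (‖y‖ ^ 2) = Module.finrank ℝ V * (volume : Measure V).real (Metric.ball 0 1) / 2 *
      ∫ v in Ioi 0, v ^ ((Module.finrank ℝ V : ℝ) / 2 - 1) * F v := by
  have finrank_pos : 1 ≤ Module.finrank ℝ V := Module.finrank_pos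
  rw [integral_fun_norm_addHaar volume (fun r : ℝ => F (r ^ 2)), nsmul_eq_mul, smul_eq_mul,
    ← integral_comp_rpow_Ioi (E := ℝ) (fun v => v ^ ((Module.finrank ℝ V : ℝ) / 2 - 1) * F v)
      two_ne_zero, div_mul_eq_mul_div, mul_div_assoc, ← integral_div, mul_assoc]
  congr 2
  refine setIntegral_congr_fun measurableSet_Ioi fun r (hr : 0 < r) => ?_
  have rpow_eq : r ^ ((2 : ℝ) - 1) * (r ^ (2 : ℝ)) ^ ((Module.finrank ℝ V : ℝ) / 2 - 1) =
      r ^ (Module.finrank ℝ V - 1) := by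
    rw [← Real.rpow_mul hr.le, ← Real.rpow_add hr, ← Real.rpow_natCast, Nat.cast_sub finrank_pos]
    congr 1; push_cast; ring
  simp only [smul_eq_mul, abs_two, ← rpow_eq, Real.rpow_two]
  ring

variable (V) in
lemma exists_integral_comp_mul_norm_sq : ∃ c, 0 < c ∧ ∀ b, 0 < b → ∀ F : ℝ → ℝ,
    ∫ y : V, F (b * ‖y‖ ^ 2) = c * b ^ (-(Module.finrank ℝ V / 2 : ℝ)) *
      ∫ v in Ioi 0, v ^ ((Module.finrank ℝ V : ℝ) / 2 - 1) * F v := by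
  have finrank_pos : 0 < Module.finrank ℝ V := Module.finrank_pos
  have ball_pos : 0 < (volume : Measure V).real (Metric.ball 0 1) :=
    ENNReal.toReal_pos (Metric.measure_ball_pos volume 0 one_pos).ne' measure_ball_lt_top.ne
  refine ⟨Module.finrank ℝ V * (volume : Measure V).real (Metric.ball 0 1) / 2, by positivity,
    fun b hb F => ?_⟩
  have norm_smul_sq (y : V) : b * ‖y‖ ^ 2 = ‖√b • y‖ ^ 2 := by
    rw [norm_smul, mul_pow, Real.norm_eq_abs, sq_abs, Real.sq_sqrt hb.le]
  simp only [norm_smul_sq]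
  rw [Measure.integral_comp_smul volume (fun y : V => F (‖y‖ ^ 2)), integral_comp_norm_sq,
    smul_eq_mul, abs_of_pos (by positivity), Real.sqrt_eq_rpow, ← Real.rpow_natCast,
    ← Real.rpow_mul hb.le, ← Real.rpow_neg hb.le, one_div_mul_eq_div]
  ring

end Polar

lemma isHomogeneousNeg_norm_rpow {E : Type*} [NormedAddCommGroup E] [NormedSpace ℝ E] (N : ℝ) :
    IsHomogeneousNeg (fun y : E => ‖y‖ ^ (-N)) N := by
  intro r hr y _
  beta_reduce
  rw [norm_smul, Real.norm_of_nonneg hr.le, Real.mul_rpow hr.le (norm_nonneg y), smul_eq_mul]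

lemma exists_bound_pow_mul_lapPow (d : ℝ) {m l : ℕ} {a N : ℝ} (ha : 2 * a + l - 2 * m = -N) :
    ∃ C, ∀ x r t : ℝ, |x| ≤ r → 0 ≤ t → r ^ 2 = 1 + t →
      |x ^ l * lapPow d m a t| ≤ C * r ^ (-N) := by
  obtain ⟨C, _, hC⟩ := exists_lapPow_bound d m a
  refine ⟨C, fun x r t hx ht hr => ?_⟩
  have r_nonneg : 0 ≤ r := (abs_nonneg x).trans hx
  have r_pos : 0 < r := by nlinarith
  calc |x ^ l * lapPow d m a t| = |x| ^ l * |lapPow d m a t| := by rw [abs_mul, abs_pow]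
    _ ≤ r ^ l * (C * (1 + t) ^ (a - m)) := by gcongr; exact hC t ht
    _ = C * r ^ (-N) := by
      rw [← hr, ← Real.rpow_natCast r l, ← Real.rpow_natCast r 2, ← Real.rpow_mul r_nonneg,
        mul_left_comm, ← Real.rpow_add r_pos, ← ha]
      congr 2; push_cast; ring

variable {p q : ℕ}

/-- The square of the length of the first `p` coordinates. -/
def posNormSq (p q : ℕ) (x : Idx p q → ℝ) : ℝ := ∑ i, x (Sum.inl i) ^ 2

lemma phi_eq (hp : 1 ≤ p) (n m : ℕ) (x : Idx p q → ℝ) :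
    phi p q n m x = lapPow p m (n - rhoC q) (posNormSq p q x) := by
  have finrank_eq : Module.finrank ℝ (EuclideanSpace ℝ (Unit ⊕ Fin (p - 1))) = p := by
    rw [finrank_euclideanSpace, Fintype.card_sum, Fintype.card_unit, Fintype.card_fin]
    omega
  rw [phi, iterate_laplacian, finrank_eq]
  simp only [EuclideanSpace.norm_sq_eq, posNormSq, Real.norm_eq_abs, sq_abs]

section Integrability

variable {g : Mat p q} (hg : gᵀ * form p q * g = form p q)
include hg

lemma norm_negPart_sq_orbit (w : Fin (max (p - 1) q) → ℝ) :
    ‖negPart p q (g *ᵥ orbitPoint p q 1 w)‖ ^ 2 =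
      1 + posNormSq p q (g *ᵥ orbitPoint p q 1 w) := by
  have form_eq_neg := sum_formSign_mulVec hg (orbitPoint p q 1 w)
  rw [sum_formSign_orbitPoint, Fintype.sum_sum_type] at form_eq_neg
  simp only [formSign, Sum.elim_inl, Sum.elim_inr, one_mul, neg_one_mul,
    Finset.sum_neg_distrib] at form_eq_neg
  rw [norm_negPart_sq, posNormSq]
  linarith

lemma integrable_lastCoord_pow_mul_lapPow (hp : 1 ≤ p) (hq : 1 ≤ q) {lam : ℝ} (hlam : 0 < lam)
    (d : ℝ) {m l : ℕ} {a : ℝ} (ha : 2 * a + l - 2 * m = -(lam + rho p q)) :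
    Integrable fun w : Fin (max (p - 1) q) → ℝ =>
      lastCoord p q (g *ᵥ orbitPoint p q 1 w) ^ l *
        lapPow d m a (posNormSq p q (g *ᵥ orbitPoint p q 1 w)) := by
  have : Nonempty (Fin (max (p - 1) q)) := ⟨⟨0, lt_max_of_lt_right hq⟩⟩
  have posNormSq_eq (w) : posNormSq p q (g *ᵥ orbitPoint p q 1 w) =
      ‖(orbitFamily hg).point 1 w‖ ^ 2 - 1 := by
    rw [orbitFamily_point, norm_negPart_sq_orbit hg, add_sub_cancel_left]
  have lastCoord_eq (w) : lastCoord p q (g *ᵥ orbitPoint p q 1 w) =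
      (orbitFamily hg).point 1 w (Sum.inr ()) := by
    rw [orbitFamily_point]; rfl
  have posNormSq_nonneg (w) : 0 ≤ ‖(orbitFamily hg).point 1 w‖ ^ 2 - 1 :=
    posNormSq_eq w ▸ Finset.sum_nonneg fun _ _ => sq_nonneg _
  have continuous := (orbitFamily hg).continuous_point 1
  have homogeneous : IsHomogeneousNeg (fun y : EuclideanSpace ℝ (Fin q ⊕ Unit) =>
      ‖y‖ ^ (-(lam + rho p q))) (orbitDegree (orbitFamily hg).coeff lam + 0) := by
    change IsHomogeneousNeg _ (lam + ∑ j, (1 - signCoef p q j ^ 2 / 2) + 0)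
    rw [add_zero, sum_one_sub_signCoef_sq p q hp]
    exact isHomogeneousNeg_norm_rpow _
  have continuousOn : ContinuousOn (fun y : EuclideanSpace ℝ (Fin q ⊕ Unit) =>
      ‖y‖ ^ (-(lam + rho p q))) {0}ᶜ :=
    continuous_norm.continuousOn.rpow_const fun y hy => Or.inl (norm_ne_zero_iff.2 hy)
  obtain ⟨C, hC⟩ := exists_bound_pow_mul_lapPow d ha
  simp only [posNormSq_eq, lastCoord_eq]
  refine (((orbitFamily hg).integrable_comp_point hlam le_rfl homogeneous continuousOn
    zero_le_one).const_mul C).mono' (Measurable.aestronglyMeasurable ?_) (.of_forall fun w => ?_)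
  · have := measurable_lapPow d m a
    fun_prop
  · exact hC _ _ _ (PiLp.norm_apply_le ((orbitFamily hg).point 1 w) _) (posNormSq_nonneg w)
      (by ring)

end Integrability

section Split

variable (p q)

/-- The coordinates of `N^*` on which both `u` and `v` depend, if `p - 1 < q`. -/
abbrev PairedSpace : Type := EuclideanSpace ℝ {j : Fin (max (p - 1) q) // (j : ℕ) < p - 1}

/-- The coordinates of `N^*` on which only `v` depends, if `p - 1 < q`. -/
abbrev UnpairedSpace : Type := EuclideanSpace ℝ {j : Fin (max (p - 1) q) // ¬(j : ℕ) < p - 1}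

/-- The splitting of the coordinates of `N^*` according to their dependence on `u`. -/
noncomputable abbrev pairedSplit :
    (Fin (max (p - 1) q) → ℝ) ≃ᵐ PairedSpace p q × UnpairedSpace p q :=
  splitEquiv fun j : Fin (max (p - 1) q) => (j : ℕ) < p - 1

lemma card_paired : Fintype.card {j : Fin (max (p - 1) q) // (j : ℕ) < p - 1} = p - 1 := by
  rw [Fintype.card_subtype, Finset.card_filter,
    sum_ite_lt_eq_sum_castLE (le_max_left (p - 1) q) fun _ => 1]
  simp

variable {p q}

lemma finrank_pairedSpace (hp : 1 ≤ p) : (Module.finrank ℝ (PairedSpace p q) : ℝ) = p - 1 := by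
  rw [finrank_euclideanSpace, card_paired, Nat.cast_sub hp, Nat.cast_one]

lemma finrank_unpairedSpace (hp : 1 ≤ p) (hpq : p - 1 < q) :
    (Module.finrank ℝ (UnpairedSpace p q) : ℝ) = q - p + 1 := by
  rw [finrank_euclideanSpace, Fintype.card_subtype_compl, card_paired, Fintype.card_fin,
    max_eq_right hpq.le, Nat.cast_sub hpq.le, Nat.cast_sub hp]
  push_cast; ring

lemma sum_signCoef_mul_sq (hpq : p - 1 < q) (w : Fin (max (p - 1) q) → ℝ) :
    ∑ j, signCoef p q j * w j ^ 2 = -‖(pairedSplit p q w).2‖ ^ 2 := by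
  have lt_q (j : Fin (max (p - 1) q)) : (j : ℕ) < q := by have := j.2; omega
  rw [norm_splitEquiv_snd,
    ← Fintype.sum_subtype_add_sum_subtype (fun j : Fin (max (p - 1) q) => (j : ℕ) < p - 1),
    Finset.sum_eq_zero fun j _ => by simp [signCoef, lt_q, j.2], zero_add,
    ← Finset.sum_neg_distrib]
  exact Finset.sum_congr rfl fun j _ => by simp [signCoef, lt_q, j.2]

lemma sum_sq_uPart (w : Fin (max (p - 1) q) → ℝ) :
    ∑ i, uPart p q w i ^ 2 = ‖(pairedSplit p q w).1‖ ^ 2 := by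
  rw [norm_splitEquiv_fst, sum_uPart p q (· ^ 2),
    ← Fintype.sum_subtype_add_sum_subtype (fun j : Fin (max (p - 1) q) => (j : ℕ) < p - 1),
    Finset.sum_congr rfl fun j _ => if_pos j.2, Finset.sum_congr rfl fun j _ => if_neg j.2,
    Finset.sum_const_zero, add_zero]

lemma boost_preserves_form (s : ℝ) : (boost p q s)ᵀ * form p q * boost p q s = form p q := by
  have cosh_sq := Real.cosh_sq_sub_sinh_sq s
  rw [form_eq]
  ext ((i | i) | (i | i)) ((j | j) | (j | j)) <;>
    simp [boost, Matrix.fromBlocks, Matrix.mul_apply, Matrix.diagonal_apply, formSign,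
      Fintype.sum_sum_type, Matrix.one_apply] <;> grind

lemma boost_mulVec_orbitPoint (hpq : p - 1 < q) (s : ℝ) (w : Fin (max (p - 1) q) → ℝ) :
    boost p q s *ᵥ orbitPoint p q 1 w = Sum.elim
      (Sum.elim (fun _ => Real.sinh s - Real.exp s / 2 * ‖(pairedSplit p q w).2‖ ^ 2)
        (uPart p q w))
      (Sum.elim (-vPart p q w)
        fun _ => Real.cosh s - Real.exp s / 2 * ‖(pairedSplit p q w).2‖ ^ 2) := by
  have exp_eq := Real.cosh_add_sinh s
  ext ((_ | i) | (i | _)) <;>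
    simp [boost, orbitPoint, Matrix.mulVec, dotProduct, Fintype.sum_sum_type,
      Matrix.fromBlocks, Matrix.one_apply, sum_signCoef_mul_sq hpq] <;> grind

lemma lastCoord_boost (hpq : p - 1 < q) (s : ℝ) (w : Fin (max (p - 1) q) → ℝ) :
    lastCoord p q (boost p q s *ᵥ orbitPoint p q 1 w) =
      Real.cosh s - Real.exp s / 2 * ‖(pairedSplit p q w).2‖ ^ 2 := by
  rw [boost_mulVec_orbitPoint hpq]; rfl

lemma posNormSq_boost (hpq : p - 1 < q) (s : ℝ) (w : Fin (max (p - 1) q) → ℝ) :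
    posNormSq p q (boost p q s *ᵥ orbitPoint p q 1 w) =
      (Real.sinh s - Real.exp s / 2 * ‖(pairedSplit p q w).2‖ ^ 2) ^ 2 +
        ‖(pairedSplit p q w).1‖ ^ 2 := by
  rw [boost_mulVec_orbitPoint hpq, ← sum_sq_uPart, posNormSq, Fintype.sum_sum_type]
  simp only [Sum.elim_inl, Sum.elim_inr, Finset.univ_unique, Finset.sum_singleton]

lemma integral_comp_splitEquiv {ι : Type*} [Fintype ι] {P : ι → Prop} [DecidablePred P]
    {F : EuclideanSpace ℝ {i // P i} × EuclideanSpace ℝ {i // ¬P i} → ℝ}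
    (hF : Integrable fun w => F (splitEquiv P w)) :
    ∫ w, F (splitEquiv P w) = ∫ y, ∫ x, F (x, y) := by
  have integrable := ((measurePreserving_splitEquiv P).integrable_comp_emb
    (splitEquiv P).measurableEmbedding).1 hF
  rw [(measurePreserving_splitEquiv P).integral_comp', Measure.volume_eq_prod,
    integral_prod_symm F integrable]

end Split

lemma exp_div_two_rpow (s b : ℝ) :
    (Real.exp s / 2) ^ (-b) = 2 ^ b * Real.exp (-b * s) := by
  rw [div_eq_inv_mul, Real.mul_rpow (by positivity) (Real.exp_pos _).le, ← Real.exp_mul,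
    Real.inv_rpow zero_le_two, Real.rpow_neg zero_le_two, inv_inv, mul_comm s]

lemma integral_pairedSpace_lapPow (hp : 1 ≤ p) {lam : ℝ} (hlam : 0 < lam) {n : ℕ}
    (hN : lam + n = ((q : ℝ) - p + 1) / 2 - 1) (m : ℕ) {t : ℝ} (ht : 0 ≤ t) :
    ∫ x : PairedSpace p q, lapPow p m (n - rhoC q) (t + ‖x‖ ^ 2) =
      betaInt (PairedSpace p q) (n - rhoC q) * lapPow 1 m (-lam - 1 / 2) t := by
  have decay : 2 * ((n : ℝ) - rhoC q) + 1 < -(Module.finrank ℝ (PairedSpace p q) : ℝ) := by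
    rw [finrank_pairedSpace hp, rhoC]; linarith
  have exponent : (n : ℝ) - rhoC q + (p - 1) / 2 = -lam - 1 / 2 := by rw [rhoC]; linarith
  have integral_eq := integral_lapPow_add_norm_sq m decay ht
  rwa [finrank_pairedSpace hp, sub_add_cancel, exponent] at integral_eq

lemma integral_lastCoord_pow_mul_lapPow (hp : 1 ≤ p) (hpq : p - 1 < q) {lam : ℝ} (hlam : 0 < lam)
    {n m l : ℕ} (hn : 2 * m = n + l) (hN : lam + n = ((q : ℝ) - p + 1) / 2 - 1) :
    ∃ B : ℝ, B ≠ 0 ∧ ∀ s, ∫ w : Fin (max (p - 1) q) → ℝ,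
      lastCoord p q (boost p q s *ᵥ orbitPoint p q 1 w) ^ l *
        lapPow p m (n - rhoC q) (posNormSq p q (boost p q s *ᵥ orbitPoint p q 1 w)) =
      B * Real.exp (-(((q : ℝ) - p + 1) / 2) * s) *
        ∫ τ in Ioi 0, τ ^ (lam + n) * ((Real.cosh s - τ) ^ l *
          lapPow 1 m (-lam - 1 / 2) ((Real.sinh s - τ) ^ 2)) := by
  have finrank_unpaired := finrank_unpairedSpace hp hpq
  have unpaired_pos : 0 < (q : ℝ) - p + 1 := by linarith [n.cast_nonneg (α := ℝ)]
  have : Nontrivial (UnpairedSpace p q) := Module.finrank_pos_iff (R := ℝ) |>.1 <| by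
    rw [← Nat.cast_pos (α := ℝ), finrank_unpaired]; exact unpaired_pos
  have hn' : (2 : ℝ) * m = n + l := by exact_mod_cast hn
  set β := betaInt (PairedSpace p q) (n - rhoC q)
  have β_pos : 0 < β := betaInt_pos (by rw [finrank_pairedSpace hp, rhoC]; linarith)
  obtain ⟨c, c_pos, integral_unpaired⟩ := exists_integral_comp_mul_norm_sq (UnpairedSpace p q)
  refine ⟨β * (c * 2 ^ (((q : ℝ) - p + 1) / 2)), by positivity, fun s => ?_⟩
  have integrable := integrable_lastCoord_pow_mul_lapPow (boost_preserves_form (p := p) (q := q) s)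
    hp (by omega) hlam p (m := m) (l := l) (a := n - rhoC q) (by rw [rho, rhoC]; linarith)
  simp only [lastCoord_boost hpq, posNormSq_boost hpq] at integrable ⊢
  have inner_integral (y : UnpairedSpace p q) : ∫ x : PairedSpace p q,
      (Real.cosh s - Real.exp s / 2 * ‖y‖ ^ 2) ^ l *
        lapPow p m (n - rhoC q) ((Real.sinh s - Real.exp s / 2 * ‖y‖ ^ 2) ^ 2 + ‖x‖ ^ 2) =
      β * ((Real.cosh s - Real.exp s / 2 * ‖y‖ ^ 2) ^ l *
        lapPow 1 m (-lam - 1 / 2) ((Real.sinh s - Real.exp s / 2 * ‖y‖ ^ 2) ^ 2)) := by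
    rw [integral_const_mul, integral_pairedSpace_lapPow hp hlam hN m (sq_nonneg _), mul_left_comm]
  rw [integral_comp_splitEquiv (F := fun z : PairedSpace p q × UnpairedSpace p q =>
    (Real.cosh s - Real.exp s / 2 * ‖z.2‖ ^ 2) ^ l * lapPow p m (n - rhoC q)
      ((Real.sinh s - Real.exp s / 2 * ‖z.2‖ ^ 2) ^ 2 + ‖z.1‖ ^ 2)) integrable]
  simp only [inner_integral]
  rw [integral_const_mul, integral_unpaired _ (half_pos (Real.exp_pos s)) (fun τ =>
    (Real.cosh s - τ) ^ l * lapPow 1 m (-lam - 1 / 2) ((Real.sinh s - τ) ^ 2)), finrank_unpaired,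
    ← hN, exp_div_two_rpow]
  ring

lemma exists_radon_boost_eq (hp : 1 ≤ p) (hpq : p - 1 < q) {lam : ℝ} (hlam : 0 < lam)
    {n m l : ℕ} (hn : 2 * m = n + l) (hN : lam + n = ((q : ℝ) - p + 1) / 2 - 1)
    {f : (Idx p q → ℝ) → ℂ} (hf : ∀ x, ‖negPart p q x‖ ^ 2 = 1 + posNormSq p q x →
      f x = ((lastCoord p q x ^ l * lapPow p m (n - rhoC q) (posNormSq p q x) : ℝ) : ℂ))
    {A : ℝ} (hA : A ≠ 0) (hI : ∀ s, ∫ τ in Ioi 0, τ ^ (lam + n) * ((Real.cosh s - τ) ^ l *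
      lapPow 1 m (-lam - 1 / 2) ((Real.sinh s - τ) ^ 2)) = A * Real.exp (lam * s)) :
    ∃ C : ℂ, C ≠ 0 ∧ ∀ s : ℝ, RadonConverges p q f (boost p q s) ∧ radon p q f (boost p q s) =
      C * (Real.exp ((-(((q : ℝ) - p + 1) / 2) + lam) * s) : ℂ) := by
  have hn' : (2 : ℝ) * m = n + l := by exact_mod_cast hn
  obtain ⟨B, hB, integral_eq⟩ := integral_lastCoord_pow_mul_lapPow hp hpq hlam hn hN
  refine ⟨((B * A : ℝ) : ℂ), by exact_mod_cast mul_ne_zero hB hA, fun s => ?_⟩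
  have preserves_form := boost_preserves_form (p := p) (q := q) s
  have f_orbit (w : Fin (max (p - 1) q) → ℝ) : f ((boost p q s * nStar p q w) *ᵥ basePoint p q) =
      ((lastCoord p q (boost p q s *ᵥ orbitPoint p q 1 w) ^ l * lapPow p m (n - rhoC q)
        (posNormSq p q (boost p q s *ᵥ orbitPoint p q 1 w)) : ℝ) : ℂ) := by
    rw [mul_nStar_mulVec_basePoint, hf _ (norm_negPart_sq_orbit preserves_form w)]
  simp only [RadonConverges, radon, f_orbit]
  constructor
  · exact (integrable_lastCoord_pow_mul_lapPow preserves_form hp (by omega) hlam p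
      (by rw [rho, rhoC]; linarith)).ofReal
  · rw [integral_complex_ofReal, integral_eq s, hI s, ← Complex.ofReal_mul, add_mul, Real.exp_add]
    congr 1
    ring

section NonposParam

variable {n m : ℕ} {lam : ℝ}

lemma generatingFunction_neg_even (hp : 1 ≤ p) (hq : q ≠ 1) (hn : n = 2 * m)
    (hμ : -(n : ℝ) = lam + rho p q - 2 * rhoC q) {x : Idx p q → ℝ}
    (hx : ‖negPart p q x‖ ^ 2 = 1 + posNormSq p q x) :
    generatingFunction p q lam (-n) x =
      ((lapPow p m (n - rhoC q) (posNormSq p q x) : ℝ) : ℂ) := by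
  rw [generatingFunction, dif_neg hq]
  rcases Nat.eq_zero_or_pos m with rfl | m_pos
  · obtain rfl : n = 0 := hn
    rw [if_pos (by simp), lapPow, ← hx, ← norm_negPart, ← Real.rpow_natCast,
      ← Real.rpow_mul (norm_nonneg _)]
    simp only [Nat.cast_zero, neg_zero, Int.toNat_zero, zonal, gegenbauer, div_one, one_mul]
    congr 2
    push_cast at hμ ⊢
    linarith
  · rw [if_neg (by omega), if_pos (by simp [hn]), phi_eq hp, neg_neg, Int.toNat_natCast,
      show n / 2 = m by omega]

lemma generatingFunction_neg_odd (hp : 1 ≤ p) (hq : q ≠ 1) (hn : n = 2 * m + 1)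
    (x : Idx p q → ℝ) :
    generatingFunction p q lam (-n) x =
      ((lastCoord p q x * lapPow p (m + 1) (n - rhoC q) (posNormSq p q x) : ℝ) : ℂ) := by
  have not_even : ¬Even (-(n : ℤ)) := by
    rw [even_neg, Int.even_coe_nat, Nat.not_even_iff_odd]
    exact ⟨m, hn⟩
  rw [generatingFunction, dif_neg hq, if_neg (by omega), if_neg not_even, phi_eq hp, neg_neg,
    Int.toNat_natCast, show (n + 1) / 2 = m + 1 by omega]

lemma exists_radon_generatingFunction_boost_eq (hp : 1 ≤ p) (hlam : 0 < lam)
    {μ : ℤ} (hμ : (μ : ℝ) = muParam p q lam) (hμ0 : μ ≤ 0) :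
    ∃ C : ℂ, C ≠ 0 ∧ ∀ s : ℝ,
      RadonConverges p q (generatingFunction p q lam μ) (boost p q s) ∧
      radon p q (generatingFunction p q lam μ) (boost p q s) =
        C * (Real.exp ((-rhoOne p q + lam) * s) : ℂ) := by
  rw [muParam, if_pos hlam] at hμ
  obtain ⟨n, rfl⟩ : ∃ n : ℕ, μ = -n := ⟨(-μ).toNat, by omega⟩
  push_cast at hμ
  have lam_add_n : lam + n = ((q : ℝ) - p + 1) / 2 - 1 := by
    rw [rho, rhoC] at hμ; linarith
  have p_add_one_lt_q : p + 1 < q := by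
    rify; linarith [n.cast_nonneg (α := ℝ)]
  have q_ne_one : q ≠ 1 := by omega
  rw [rhoOne, if_neg (by omega)]
  rcases Nat.even_or_odd' n with ⟨m, n_eq | n_eq⟩
  · obtain ⟨A, hA, integral_eq⟩ := exists_integral_lapPow_even m hlam
    refine exists_radon_boost_eq hp (by omega) hlam (m := m) (l := 0) (by omega) lam_add_n
      (fun x hx => ?_) hA (by simpa only [n_eq, pow_zero, one_mul] using integral_eq)
    rw [pow_zero, one_mul, generatingFunction_neg_even hp q_ne_one n_eq hμ hx]
  · obtain ⟨A, hA, integral_eq⟩ := exists_integral_lapPow_odd m hlam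
    refine exists_radon_boost_eq hp (by omega) hlam (m := m + 1) (l := 1) (by omega) lam_add_n
      (fun x _ => ?_) hA (by simpa only [n_eq, pow_one] using integral_eq)
    rw [pow_one, generatingFunction_neg_odd hp q_ne_one n_eq]

end NonposParam

end Boost

end Hyperbolic

theorem theorem5p2 (p q : ℕ) (hp : 1 ≤ p) (hq : 1 ≤ q) (lam : ℝ)
    (hlam : Hyperbolic.IsDiscreteSeriesParameter p q lam)
    (μ : ℤ) (hμ : (μ : ℝ) = Hyperbolic.muParam p q lam) :
    ((0 < lam ∧ 0 < μ) ∨ (lam < 0 ∧ μ < 0) →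
      ∀ g ∈ Hyperbolic.groupG p q,
        Hyperbolic.RadonConverges p q (Hyperbolic.generatingFunction p q lam μ) g ∧
        Hyperbolic.radon p q (Hyperbolic.generatingFunction p q lam μ) g = 0) ∧
    (0 < lam ∧ μ ≤ 0 →
      ∃ C : ℂ, C ≠ 0 ∧ ∀ s : ℝ,
        Hyperbolic.RadonConverges p q (Hyperbolic.generatingFunction p q lam μ)
          (Hyperbolic.boost p q s) ∧
        Hyperbolic.radon p q (Hyperbolic.generatingFunction p q lam μ)
          (Hyperbolic.boost p q s) =
            C * (Real.exp ((-Hyperbolic.rhoOne p q + lam) * s) : ℂ)) := by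
  refine ⟨fun h g hg => ?_, fun h =>
    Hyperbolic.exists_radon_generatingFunction_boost_eq hp h.1 hμ h.2⟩
  have preserves_form := Hyperbolic.preserves_form_of_mem_groupG hg
  rcases eq_or_lt_of_le hq with rfl | one_lt_q
  · have lam_ne_zero : lam ≠ 0 := h.elim (·.1.ne') (·.1.ne)
    exact Hyperbolic.radon_generatingFunction_one_eq_zero hp lam_ne_zero hμ preserves_form
  · rw [Hyperbolic.IsDiscreteSeriesParameter, if_neg one_lt_q.ne'] at hlam
    have μ_pos : 0 < μ := (h.resolve_right fun neg => neg.1.not_gt hlam.1).2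
    exact Hyperbolic.radon_generatingFunction_eq_zero hp one_lt_q hlam.1 hμ μ_pos preserves_form
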